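/- Let $\sigma\in(1,2)$ and let $z_0\in(0,1)$ satisfy $F(z_0;\sigma)=0$, where $$F(z;\sigma)=(\sigma-1)^2\Big[\int_0^\infty(\cosh y-z)^{-1/\sigma}dy\Big]^2-\Big[\int_0^\infty(\cosh y-z)^{-1/\sigma-1}(z\cosh y-1)\,dy\Big]^2 .$$ For $4\omega>c^2$ let $$\Phi_{\omega,c}(x)=\Big(\tfrac{(\sigma+1)(4\omega-c^2)}{2\sqrt\omega\,(\cosh(\sigma\sqrt{4\omega-c^2}\,x)-\frac{c}{2\sqrt\omega})}\Big)^{\frac1{2\sigma}},\qquad Q_{\omega,c}(x)=\Phi_{\omega,c}(x)\exp\Big\{i\tfrac c2x-\tfrac{i}{2\sigma+2}\int_{-\infty}^x\Phi_{\omega,c}^{2\sigma}\Big\}.$$ Let $(\omega_k^0,c_k^0)\in\mathbb R^2$, $k=1,2$, satisfy $-2\sqrt{\omega_k^0}<c_k^0<2z_0\sqrt{\omega_k^0}$, and, with $m^0=\frac{\omega_2^0-\omega_1^0}{c_2^0-c_1^0}$, assume $m^0>0$, $c_1^0<m^0$ and $4m^0<c_2^0$. Let $\varphi\in C^3(\mathbb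 R)$ be nondecreasing with $\varphi=0$ on $(-\infty,-1]$ and $\varphi=1$ on $[1,\infty)$. For $\alpha,L>0$ let $\mathcal U(\alpha,L)$ be the set of $v\in H^1(\mathbb R)\setminus\{0\}$ with $$\inf_{x_2-x_1>L,\ \gamma_1,\gamma_2\in\mathbb R}\Big\|v-\sum_{k=1}^2Q_{\omega_k^0,c_k^0}(\cdot-x_k)e^{i\gamma_k}\Big\|_{H^1}<\alpha .$$ Then there are positive constants $\alpha_0,\eta,L_0,C$, depending only on $\sigma,z_0,\omega_k^0,c_k^0,\varphi$, such that the following holds for all $0<\alpha<\alpha_0$, $L>L_0$, $T^*>0$. Let $u\in C([0,T^*],H^1(\mathbb R))$ be a solution of $iu_t+u_{xx}+i|u|^{2\sigma}u_x=0$ with $$\Big\|u(0)-\sum_{k=1}^2Q_{\omega_k^0,c_k^0}(\cdot-x_k^0)e^{i\gamma_k^0}\Big\|_{H^1}<\alpha,\quad x_2^0-x_1^0>L,\qquad u(t)\in\mathcal U(\alpha,L/2)\ \text{ for } t\in(0,T^*].$$ Let $\omega_k(t),c_k(t),x_k(t),\gamma_k(t)$, $t\in[0,T^*]$, be any real parameters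 such that $$\varepsilon(t)=u(t)-\sum_{k=1}^2Q_{\omega_k(t),c_k(t)}(\cdot-x_k(t))e^{i\gamma_k(t)}$$ satisfies $\|\varepsilon(t)\|_{H^1}+\sum_k(|\omega_k(t)-\omega_k^0|+|c_k(t)-c_k^0|)<\eta$ on $[0,T^*]$ (in particular, the decomposition in which $\varepsilon(t)$ is orthogonal to $R_k,iR_k,\partial_xR_k,i\partial_xR_k$, where $R_k=Q_{\omega_k(t),c_k(t)}(\cdot-x_k(t))e^{i\gamma_k(t)}$). Put $\Delta\omega=\omega_2(0)-\omega_1(0)$, $\Delta c=c_2(0)-c_1(0)$, $\mu=2\Delta\omega/\Delta c$, $\kappa_k=\sqrt{4\omega_k^0-(c_k^0)^2}$, $a=L^2/64$, $\bar x^0=\frac{x_1^0+x_2^0}2$, $$\theta_3=\min\{\tfrac{\kappa_1}{64},\tfrac{\kappa_2}{64},4(\mu-c_1^0),4(c_2^0-\mu)\},\qquad \theta_4=\min\{\tfrac{\kappa_1}{64},\tfrac{\kappa_2}{64},\mu-2c_1^0,4c_2^0-2\mu\},$$ and, for $A,B,\nu\in\mathbb R$, $$\mathcal J[A,B,\nu](t)=A\int|u|^2\varphi\Big(\tfrac{x-\bar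 x^0-\nu t}{\sqrt{t+a}}\Big)dx-B\,\mathrm{Im}\int\bar uu_x\,\varphi\Big(\tfrac{x-\bar x^0-\nu t}{\sqrt{t+a}}\Big)dx .$$ Let $\mathcal J=\mathcal J[\frac{\Delta\omega}2,\frac{\Delta c}2,\mu]$, $\mathcal J_{+,0}=\mathcal J[\Delta\omega,\frac{\Delta c}2,2\mu]$, $\mathcal J_{-,0}=\mathcal J[\frac{\Delta\omega}4,\frac{\Delta c}2,\frac\mu2]$, $\mathcal J_{0,+}=\mathcal J[\frac{\Delta\omega}2,\Delta c,\frac\mu2]$, $\mathcal J_{0,-}=\mathcal J[\frac{\Delta\omega}2,\frac{\Delta c}4,2\mu]$. Then $\mathcal J$ is differentiable on $[0,T^*]$ (one-sidedly at the end points) and, for all $t\in[0,T^*]$, $$\frac{d}{dt}\mathcal J(t)\le\frac{C}{(t+a)^{3/2}}\|\varepsilon(t)\|_{H^1}^2+\frac{C}{(t+a)^{3/2}}e^{-\theta_3(L+\theta_3t)},$$ $$\mathcal J(t)-\mathcal J(0)\le\frac CL\sup_{0<s<t}\|\varepsilon(s)\|_{H^1}^2+Ce^{-\theta_3L},$$ and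 each of the four functionals $\mathcal J_{+,0},\mathcal J_{-,0},\mathcal J_{0,+},\mathcal J_{0,-}$, in place of $\mathcal J$, satisfies $$\mathcal J_*(t)-\mathcal J_*(0)\le\frac CL\sup_{0<s<t}\|\varepsilon(s)\|_{H^1}^2+Ce^{-\theta_4L}$$ (the supremum is read as $0$ at $t=0$). -/

import Mathlib

open MeasureTheory Set Filter Topology

namespace GDNLS

noncomputable section

/-! Sobolev space `H¹(ℝ; ℂ)` through weak derivatives -/

/-- `g` is the weak derivative of `f` on the real line (tested with smooth compactly supported
functions). It is only used for `f` and `g` in `L²`, so that all integrals converge. -/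
def IsWeakDeriv (f g : ℝ → ℂ) : Prop :=
  ∀ ψ : ℝ → ℝ, ContDiff ℝ (⊤ : ℕ∞) ψ → HasCompactSupport ψ →
    ∫ x, ((deriv ψ x : ℝ) : ℂ) * f x = -∫ x, ((ψ x : ℝ) : ℂ) * g x

/-- Membership in `H¹(ℝ; ℂ)`: the function and its weak derivative are square integrable. -/
def MemH1 (f : ℝ → ℂ) : Prop :=
  MemLp f 2 volume ∧ ∃ g : ℝ → ℂ, MemLp g 2 volume ∧ IsWeakDeriv f g

open Classical in
/-- The square integrable weak derivative of `f` (unique up to null sets); the value `0` is used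
when there is none. -/
def weakDeriv (f : ℝ → ℂ) : ℝ → ℂ :=
  if h : ∃ g : ℝ → ℂ, MemLp g 2 volume ∧ IsWeakDeriv f g then h.choose else 0

theorem MemH1.weakDeriv_spec {f : ℝ → ℂ} (hf : MemH1 f) :
    MemLp (weakDeriv f) 2 volume ∧ IsWeakDeriv f (weakDeriv f) := by
  have h := hf.2
  rw [weakDeriv, dif_pos h]
  exact h.choose_spec

/-- The `H¹` norm `(∫ |f|² + ∫ |f'|²)^{1/2}` of a function in `H¹`. -/
def h1Norm (f : ℝ → ℂ) : ℝ :=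
  Real.sqrt ((∫ x, ‖f x‖ ^ 2) + ∫ x, ‖weakDeriv f x‖ ^ 2)

/-! The equation `i u_t + u_xx + i |u|^{2σ} u_x = 0` -/

/-- `u ∈ C([0,T], H¹)` solves `i u_t + u_xx + i |u|^{2σ} u_x = 0` on `[0,T]`. The equation, in the
form `u_t = i u_xx - |u|^{2σ} u_x`, holds in the sense of distributions in `x` at every time
(one-sided time derivatives at the end points). -/
structure IsSolution (σ T : ℝ) (u : ℝ → ℝ → ℂ) : Prop where
  memH1 : ∀ t ∈ Icc 0 T, MemH1 (u t)
  continuous_h1 : ∀ t ∈ Icc 0 T,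
    Tendsto (fun s => h1Norm (fun x => u s x - u t x)) (𝓝[Icc 0 T] t) (𝓝 0)
  equation : ∀ ψ : ℝ → ℝ, ContDiff ℝ (⊤ : ℕ∞) ψ → HasCompactSupport ψ → ∀ t ∈ Icc 0 T,
    HasDerivWithinAt (fun s => ∫ x, u s x * ((ψ x : ℝ) : ℂ))
      (-Complex.I * (∫ x, weakDeriv (u t) x * ((deriv ψ x : ℝ) : ℂ))
        - ∫ x, ((‖u t x‖ ^ (2 * σ) : ℝ) : ℂ) * weakDeriv (u t) x * ((ψ x : ℝ) : ℂ))
      (Icc 0 T) t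

/-! Solitary waves -/

/-- The real profile `Φ_{ω,c}` of the solitary wave. -/
def profile (σ ω c : ℝ) (x : ℝ) : ℝ :=
  ((σ + 1) * (4 * ω - c ^ 2) /
      (2 * Real.sqrt ω *
        (Real.cosh (σ * Real.sqrt (4 * ω - c ^ 2) * x) - c / (2 * Real.sqrt ω)))) ^ (1 / (2 * σ))

/-- The solitary wave profile
`Q_{ω,c}(x) = Φ_{ω,c}(x) exp (i c x / 2 - i / (2σ+2) ∫_{-∞}^x Φ_{ω,c}^{2σ})`. -/
def soliton (σ ω c : ℝ) (x : ℝ) : ℂ :=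
  ((profile σ ω c x : ℝ) : ℂ) *
    Complex.exp (Complex.I *
      ((c / 2 * x - 1 / (2 * σ + 2) * ∫ y in Iic x, profile σ ω c y ^ (2 * σ) : ℝ) : ℂ))

/-- The sum of two modulated solitary waves `∑_k Q_{ω_k,c_k}(· - x_k) e^{i γ_k}`. The two waves are
indexed by `0, 1 : Fin 2`. -/
def solitonSum (σ : ℝ) (ω c x γ : Fin 2 → ℝ) (y : ℝ) : ℂ :=
  ∑ k, soliton σ (ω k) (c k) (y - x k) * Complex.exp (Complex.I * ((γ k : ℝ) : ℂ))

/-- The tube of size `α` in `H¹` around the sums of two solitary waves with parameters `ω, c` and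
centres `x 0`, `x 1` with `x 1 - x 0 > L` (the infimum of the distances being `< α` means that some
distance is `< α`). -/
def tube (σ : ℝ) (ω c : Fin 2 → ℝ) (α L : ℝ) : Set (ℝ → ℂ) :=
  {v | MemH1 v ∧ ¬ v =ᵐ[volume] 0 ∧
    ∃ x γ : Fin 2 → ℝ, L < x 1 - x 0 ∧ h1Norm (fun y => v y - solitonSum σ ω c x γ y) < α}

/-- The function `F(z; σ)`, whose zero `z₀(σ)` separates the stable from the unstable solitary
waves. -/
def stabilityF (z σ : ℝ) : ℝ :=
  (σ - 1) ^ 2 * (∫ y in Ioi (0 : ℝ), (Real.cosh y - z) ^ (-1 / σ)) ^ 2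
    - (∫ y in Ioi (0 : ℝ), (Real.cosh y - z) ^ (-1 / σ - 1) * (z * Real.cosh y - 1)) ^ 2

/-! Localized mass and momentum -/

/-- A cutoff function: `C³`, nondecreasing, `0` on `(-∞,-1]` and `1` on `[1,∞)`. -/
structure IsCutoff (φ : ℝ → ℝ) : Prop where
  contDiff : ContDiff ℝ 3 φ
  monotone : Monotone φ
  eq_zero : ∀ x ≤ -1, φ x = 0
  eq_one : ∀ x, 1 ≤ x → φ x = 1

/-- The localized functional
`A ∫ |u(t)|² φ((x - x̄ - μ t)/√(t+a)) - B Im ∫ ū u_x (t) φ((x - x̄ - μ t)/√(t+a))`,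
whose cutoff moves along the line `x̄ + μ t`. -/
def locFunctional (φ : ℝ → ℝ) (a xbar : ℝ) (u : ℝ → ℝ → ℂ) (A B μ : ℝ) (t : ℝ) : ℝ :=
  A * (∫ x, ‖u t x‖ ^ 2 * φ ((x - xbar - μ * t) / Real.sqrt (t + a)))
    - B * (∫ x, starRingEnd ℂ (u t x) * weakDeriv (u t) x *
        ((φ ((x - xbar - μ * t) / Real.sqrt (t + a)) : ℝ) : ℂ)).im

end

end GDNLS

/-!
The localized mass and momentum satisfy an exact balance law. For a weight `w(t, x)` the time
derivative of `A ∫ w |u|² - B Im ∫ w ū u_x` is an integral of terms carrying a derivative of `w`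
(`IsSolution.hasDerivWithinAt_weightedDensity`); it is proved for the mollified solution, where it
is an integration by parts, and survives the removal of the mollifier because both sides only
involve `u`, `u_x` and `|u|^{2σ} u_x` in `L²`. For the cutoffs considered here all these terms live
in the transition region `|x - x̄ - ν t| ≤ √(t + a)`.

All five functionals satisfy `2 A = B ν`. With `w = u_x - i ν u / 2` the quadratic part of the flux
is then `-2 B |w|²` times the slope of the cutoff, the moving width and the third derivative of the
cutoff cost `(t + a)^{-3/2} |u|²`, and the nonlinear terms are absorbed by `|w|²` wherever
`|u|^{2σ} ≤ ν σ / (σ + 1)` (`fluxAt_le`). So the derivative of the functional is at most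
`C (t + a)^{-3/2}` times the mass of `u` in the transition region, provided `u` is small there
(`IsSolution.exists_hasDerivWithinAt_locFunctional`).

It remains to see that both waves stay away from the transition region. The parameters of the
decomposition are arbitrary functions of time, so no modulation equations are available, and the
separation is obtained from the mass alone. While `u` is in the tube, the mass `G` to the right of a
wide cutoff moving with velocity `ν` is nearly that of two point masses at the centres of the waves.
Each wave carries the mass flux `c_k |Q_k|²` (`soliton_flux`), so `G'` is nearly that of point
masses moving with velocities `c_k` (`exists_integral_massFlux`). If `c_0 < ν < c_1`, then `G`
cannot pass through the levels which it would have to cross for one of the masses to overtake the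
cutoff (`IsCutoff.barrier`, `exists_crossing_bound`). Lines with velocities slightly above `c_0` and
slightly below `c_1` thus separate the centres of the waves from the transition region, which
recedes from them linearly in time. The centres of the given decomposition are close to those given
by the tube, possibly in the other order, because both describe the same local mass
(`exists_centre_comparison`); the order is irrelevant for the estimates.

Consequently the mass in the transition region is at most a multiple of `‖ε‖²` plus an error which
is exponentially small in `L` and `t` (`exists_locFunctional_estimate`), and integration in time,
with `∫ (t + a)^{-3/2} dt ≤ 2 / √a` and `√a = L / 8`, gives almost monotonicity
(`sub_le_of_differential_inequality`).
-/

open scoped Convolution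

namespace GDNLS

noncomputable section

/-! ### Square integrable functions -/

theorem integrable_sq {f : ℝ → ℂ} (hf : MemLp f 2 volume) : Integrable (fun x => ‖f x‖ ^ 2) :=
  (memLp_two_iff_integrable_sq_norm hf.1).1 hf

theorem integrable_norm_mul {f g : ℝ → ℂ} (hf : MemLp f 2 volume) (hg : MemLp g 2 volume) :
    Integrable (fun x => ‖f x‖ * ‖g x‖) :=
  MemLp.integrable_mul hf.norm hg.norm

theorem sq_integral_mul_le {f g : ℝ → ℝ} (hf0 : ∀ x, 0 ≤ f x) (hg0 : ∀ x, 0 ≤ g x)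
    (hf : MemLp f 2 volume) (hg : MemLp g 2 volume) :
    (∫ x, f x * g x) ^ 2 ≤ (∫ x, f x ^ 2) * ∫ x, g x ^ 2 := by
  have h := integral_mul_le_Lp_mul_Lq_of_nonneg (μ := volume) Real.HolderConjugate.two_two
    (Eventually.of_forall hf0) (Eventually.of_forall hg0) (by simpa using hf) (by simpa using hg)
  have h0 : 0 ≤ ∫ x, f x * g x := integral_nonneg fun x => mul_nonneg (hf0 x) (hg0 x)
  have h1 : 0 ≤ ∫ x, f x ^ 2 := integral_nonneg fun x => sq_nonneg _
  have h2 : 0 ≤ ∫ x, g x ^ 2 := integral_nonneg fun x => sq_nonneg _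
  simp only [Real.rpow_two, ← Real.sqrt_eq_rpow] at h
  calc (∫ x, f x * g x) ^ 2 ≤ (√(∫ x, f x ^ 2) * √(∫ x, g x ^ 2)) ^ 2 := by gcongr
    _ = _ := by rw [mul_pow, Real.sq_sqrt h1, Real.sq_sqrt h2]

theorem sq_integral_norm_mul_le {f g : ℝ → ℂ} (hf : MemLp f 2 volume) (hg : MemLp g 2 volume) :
    (∫ x, ‖f x‖ * ‖g x‖) ^ 2 ≤ (∫ x, ‖f x‖ ^ 2) * ∫ x, ‖g x‖ ^ 2 :=
  sq_integral_mul_le (fun _ => norm_nonneg _) (fun _ => norm_nonneg _) hf.norm hg.norm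

theorem integral_sq_add_le {f g : ℝ → ℂ} (hf : MemLp f 2 volume) (hg : MemLp g 2 volume) :
    ∫ x, ‖f x + g x‖ ^ 2 ≤ 2 * (∫ x, ‖f x‖ ^ 2) + 2 * ∫ x, ‖g x‖ ^ 2 := by
  rw [← integral_const_mul, ← integral_const_mul, ← integral_add ((integrable_sq hf).const_mul 2)
    ((integrable_sq hg).const_mul 2)]
  refine integral_mono (integrable_sq (hf.add hg)) (((integrable_sq hf).const_mul 2).add
    ((integrable_sq hg).const_mul 2)) fun x => ?_
  have := norm_add_le (f x) (g x)
  have h2 := norm_nonneg (f x + g x)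
  dsimp only
  nlinarith [sq_nonneg (‖f x‖ - ‖g x‖)]

/-! ### The weighted pairing of two square integrable functions -/

/-- The sesquilinear pairing `∫ h f̄ g` with a real weight `h`. -/
def pair (h : ℝ → ℝ) (f g : ℝ → ℂ) : ℂ := ∫ x, ((h x : ℝ) : ℂ) * (starRingEnd ℂ (f x) * g x)

theorem integrable_pair {h : ℝ → ℝ} {f g : ℝ → ℂ} {C : ℝ} (hh : AEStronglyMeasurable h volume)
    (hC : ∀ x, |h x| ≤ C) (hf : MemLp f 2 volume) (hg : MemLp g 2 volume) :
    Integrable (fun x => ((h x : ℝ) : ℂ) * (starRingEnd ℂ (f x) * g x)) := by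
  have h1 : Integrable (fun x => starRingEnd ℂ (f x) * g x) := by
    refine (integrable_norm_mul hf hg).mono
      ((Complex.continuous_conj.comp_aestronglyMeasurable hf.1).mul hg.1) ?_
    refine Eventually.of_forall fun x => ?_
    simp
  refine h1.bdd_mul (c := C) (Complex.continuous_ofReal.comp_aestronglyMeasurable hh) ?_
  exact Eventually.of_forall fun x => by simpa using hC x

theorem norm_pair_le {h : ℝ → ℝ} {f g : ℝ → ℂ} {C : ℝ}
    (hC : ∀ x, |h x| ≤ C) (hf : MemLp f 2 volume) (hg : MemLp g 2 volume) :
    ‖pair h f g‖ ≤ C * ∫ x, ‖f x‖ * ‖g x‖ := by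
  rw [pair, ← integral_const_mul]
  refine norm_integral_le_of_norm_le ((integrable_norm_mul hf hg).const_mul C) ?_
  refine Eventually.of_forall fun x => ?_
  simp only [norm_mul, Complex.norm_real, Real.norm_eq_abs, RCLike.norm_conj]
  gcongr
  exact hC x

theorem norm_pair_le_sum {h : ℝ → ℝ} {f g : ℝ → ℂ} {C K : ℝ} (hC0 : 0 ≤ C)
    (hC : ∀ x, |h x| ≤ C) (hf : MemLp f 2 volume) (hg : MemLp g 2 volume)
    (hfK : ∫ x, ‖f x‖ ^ 2 ≤ K) (hgK : ∫ x, ‖g x‖ ^ 2 ≤ K) :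
    ‖pair h f g‖ ≤ C * K := by
  refine (norm_pair_le hC hf hg).trans (mul_le_mul_of_nonneg_left ?_ hC0)
  have h0 : 0 ≤ ∫ x, ‖f x‖ * ‖g x‖ := integral_nonneg fun x => by positivity
  have h1 : 0 ≤ ∫ x, ‖f x‖ ^ 2 := integral_nonneg fun x => by positivity
  have h2 : 0 ≤ ∫ x, ‖g x‖ ^ 2 := integral_nonneg fun x => by positivity
  refine abs_le_of_sq_le_sq' ?_ (h1.trans hfK) |>.2
  nlinarith [sq_integral_norm_mul_le hf hg, mul_le_mul hfK hgK h2 (h1.trans hfK)]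

theorem tendsto_integral_norm_mul_zero {F G : ℕ → ℝ → ℂ} {K : ℝ}
    (hF : ∀ n, MemLp (F n) 2 volume) (hG : ∀ n, MemLp (G n) 2 volume)
    (hF0 : Tendsto (fun n => ∫ x, ‖F n x‖ ^ 2) atTop (𝓝 0))
    (hGK : ∀ᶠ n in atTop, ∫ x, ‖G n x‖ ^ 2 ≤ K) :
    Tendsto (fun n => ∫ x, ‖F n x‖ * ‖G n x‖) atTop (𝓝 0) := by
  have h1 : Tendsto (fun n => √((∫ x, ‖F n x‖ ^ 2) * K)) atTop (𝓝 0) := by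
    have := (hF0.mul_const K).sqrt
    simpa using this
  refine squeeze_zero' (Eventually.of_forall fun n => integral_nonneg fun x => by positivity) ?_ h1
  filter_upwards [hGK] with n hn
  refine Real.le_sqrt_of_sq_le ((sq_integral_norm_mul_le (hF n) (hG n)).trans ?_)
  exact mul_le_mul_of_nonneg_left hn (integral_nonneg fun x => by positivity)

theorem eventually_integral_sq_le {F : ℕ → ℝ → ℂ} {f : ℝ → ℂ}
    (hF : ∀ n, MemLp (F n) 2 volume) (hf : MemLp f 2 volume)
    (hFf : Tendsto (fun n => ∫ x, ‖F n x - f x‖ ^ 2) atTop (𝓝 0)) :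
    ∀ᶠ n in atTop, ∫ x, ‖F n x‖ ^ 2 ≤ 2 + 2 * ∫ x, ‖f x‖ ^ 2 := by
  filter_upwards [hFf.eventually_le_const (show (0 : ℝ) < 1 by norm_num)] with n hn
  have := integral_sq_add_le ((hF n).sub hf) hf
  simp only [Pi.sub_apply, sub_add_cancel] at this
  linarith

/-- Weighted pairings are continuous under `L²` convergence of both factors and bounded pointwise
convergence of the weight. -/
theorem tendsto_pair {F G : ℕ → ℝ → ℂ} {f g : ℝ → ℂ} {H : ℕ → ℝ → ℝ} {h : ℝ → ℝ} {C : ℝ}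
    (hF : ∀ n, MemLp (F n) 2 volume) (hf : MemLp f 2 volume)
    (hG : ∀ n, MemLp (G n) 2 volume) (hg : MemLp g 2 volume)
    (hFf : Tendsto (fun n => ∫ x, ‖F n x - f x‖ ^ 2) atTop (𝓝 0))
    (hGg : Tendsto (fun n => ∫ x, ‖G n x - g x‖ ^ 2) atTop (𝓝 0))
    (hHm : ∀ n, AEStronglyMeasurable (H n) volume) (hHC : ∀ n x, |H n x| ≤ C)
    (hHh : ∀ᵐ x, Tendsto (fun n => H n x) atTop (𝓝 (h x))) :
    Tendsto (fun n => pair (H n) (F n) (G n)) atTop (𝓝 (pair h f g)) := by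
  have hfg : Integrable (fun x => ‖f x‖ * ‖g x‖) := integrable_norm_mul hf hg
  -- the three differences of a telescoping sum
  have h3 : Tendsto (fun n => pair (H n) f g) atTop (𝓝 (pair h f g)) := by
    refine tendsto_integral_of_dominated_convergence (fun x => C * (‖f x‖ * ‖g x‖)) ?_
      (hfg.const_mul C) ?_ ?_
    · intro n
      exact (integrable_pair (hHm n) (hHC n) hf hg).1
    · intro n
      refine Eventually.of_forall fun x => ?_
      simp only [norm_mul, Complex.norm_real, Real.norm_eq_abs, RCLike.norm_conj]
      gcongr
      exact hHC n x
    · filter_upwards [hHh] with x hx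
      exact ((Complex.continuous_ofReal.tendsto _).comp hx).mul_const _
  have h1 : Tendsto (fun n => pair (H n) (fun x => F n x - f x) (G n)) atTop (𝓝 0) := by
    refine squeeze_zero_norm (fun n => norm_pair_le (hHC n) ((hF n).sub hf) (hG n)) ?_
    simpa using (tendsto_integral_norm_mul_zero (fun n => (hF n).sub hf) hG hFf
      (eventually_integral_sq_le hG hg hGg)).const_mul C
  have h2 : Tendsto (fun n => pair (H n) f (fun x => G n x - g x)) atTop (𝓝 0) := by
    refine squeeze_zero_norm (fun n => norm_pair_le (hHC n) hf ((hG n).sub hg)) ?_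
    have := (tendsto_integral_norm_mul_zero (G := fun _ => f) (fun n => (hG n).sub hg)
      (fun _ => hf) hGg (Eventually.of_forall fun n => le_rfl)).const_mul C
    simpa [mul_comm] using this
  have h := (h1.add h2).add h3
  simp only [zero_add] at h
  refine h.congr fun n => ?_
  have i1 := integrable_pair (hHm n) (hHC n) ((hF n).sub hf) (hG n)
  have i2 := integrable_pair (hHm n) (hHC n) hf ((hG n).sub hg)
  have i3 := integrable_pair (hHm n) (hHC n) hf hg
  simp only [pair]
  rw [← integral_add, ← integral_add]
  · congr 1
    ext x
    simp only [map_sub]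
    ring
  · exact i1.add i2
  · exact i3
  · exact i1
  · exact i2

/-! ### Mollification -/

/-- Convolution `ρ * f` of a real kernel with a complex valued function. -/
def mol (ρ : ℝ → ℝ) (f : ℝ → ℂ) : ℝ → ℂ := ρ ⋆[ContinuousLinearMap.lsmul ℝ ℝ, volume] f

theorem mol_apply (ρ : ℝ → ℝ) (f : ℝ → ℂ) (x : ℝ) :
    mol ρ f x = ∫ y, ((ρ (x - y) : ℝ) : ℂ) * f y := by
  rw [mol, convolution_lsmul_swap]
  simp only [Complex.real_smul]

theorem locallyIntegrable_of_memLp {f : ℝ → ℂ} (hf : MemLp f 2 volume) :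
    LocallyIntegrable f volume :=
  hf.locallyIntegrable (by norm_num)

theorem hasDerivAt_mol {ρ : ℝ → ℝ} {f : ℝ → ℂ} (hρ : ContDiff ℝ 1 ρ) (hc : HasCompactSupport ρ)
    (hf : MemLp f 2 volume) (x : ℝ) : HasDerivAt (mol ρ f) (mol (deriv ρ) f x) x :=
  hc.hasDerivAt_convolution_left _ hρ (locallyIntegrable_of_memLp hf) x

theorem continuous_mol {ρ : ℝ → ℝ} {f : ℝ → ℂ} (hρ : Continuous ρ) (hc : HasCompactSupport ρ)
    (hf : MemLp f 2 volume) : Continuous (mol ρ f) :=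
  hc.continuous_convolution_left _ hρ (locallyIntegrable_of_memLp hf)

theorem memLp_kernel {ρ : ℝ → ℝ} (hρ : Continuous ρ) (hc : HasCompactSupport ρ) (x : ℝ) :
    MemLp (fun y => ((ρ (x - y) : ℝ) : ℂ)) 2 volume := by
  have h1 : MemLp ρ 2 volume := hρ.memLp_of_hasCompactSupport hc
  have h2 : MemLp (fun y => ρ (x - y)) 2 volume :=
    h1.comp_measurePreserving (Measure.measurePreserving_sub_left volume x)
  exact h2.ofReal

theorem integrable_kernel_mul {ρ : ℝ → ℝ} {f : ℝ → ℂ} (hρ : Continuous ρ)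
    (hc : HasCompactSupport ρ) (hf : MemLp f 2 volume) (x : ℝ) :
    Integrable (fun y => ((ρ (x - y) : ℝ) : ℂ) * f y) :=
  MemLp.integrable_mul (memLp_kernel hρ hc x) hf

theorem mol_sub {ρ : ℝ → ℝ} {f g : ℝ → ℂ} (hρ : Continuous ρ) (hc : HasCompactSupport ρ)
    (hf : MemLp f 2 volume) (hg : MemLp g 2 volume) (x : ℝ) :
    mol ρ (fun y => f y - g y) x = mol ρ f x - mol ρ g x := by
  rw [mol_apply, mol_apply, mol_apply, ← integral_sub (integrable_kernel_mul hρ hc hf x)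
    (integrable_kernel_mul hρ hc hg x)]
  simp only [mul_sub]

/-- A pointwise bound for a mollification by the `L²` norms of kernel and function. -/
theorem norm_mol_sq_le {ρ : ℝ → ℝ} {f : ℝ → ℂ} (hρ : Continuous ρ) (hc : HasCompactSupport ρ)
    (hf : MemLp f 2 volume) (x : ℝ) :
    ‖mol ρ f x‖ ^ 2 ≤ (∫ y, ρ y ^ 2) * ∫ y, ‖f y‖ ^ 2 := by
  have h1 : ‖mol ρ f x‖ ≤ ∫ y, ‖((ρ (x - y) : ℝ) : ℂ)‖ * ‖f y‖ := by
    rw [mol_apply]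
    refine (norm_integral_le_integral_norm _).trans (le_of_eq ?_)
    simp only [norm_mul]
  have h2 := sq_integral_norm_mul_le (memLp_kernel hρ hc x) hf
  have h3 : ∫ y, ‖((ρ (x - y) : ℝ) : ℂ)‖ ^ 2 = ∫ y, ρ y ^ 2 := by
    simp only [Complex.norm_real, Real.norm_eq_abs, sq_abs]
    exact integral_sub_left_eq_self (fun y => ρ y ^ 2) volume x
  rw [h3] at h2
  exact (pow_le_pow_left₀ (norm_nonneg _) h1 2).trans h2

/-- Young's inequality `‖ρ * f‖₂ ≤ ‖ρ‖₁ ‖f‖₂`, with membership in `L²`. -/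
theorem memLp_mol {ρ : ℝ → ℝ} {f : ℝ → ℂ} (hρ : Continuous ρ) (hc : HasCompactSupport ρ)
    (hf : MemLp f 2 volume) :
    MemLp (mol ρ f) 2 volume ∧
      ∫ x, ‖mol ρ f x‖ ^ 2 ≤ (∫ y, |ρ y|) ^ 2 * ∫ y, ‖f y‖ ^ 2 := by
  have hm := (continuous_mol hρ hc hf).aestronglyMeasurable (μ := volume)
  have iρ : Integrable (fun y => |ρ y|) := (hρ.integrable_of_hasCompactSupport hc).abs
  have ic : Integrable ((fun y => |ρ y|) ⋆[ContinuousLinearMap.lsmul ℝ ℝ, volume]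
      (fun y => ‖f y‖ ^ 2)) := iρ.integrable_convolution _ (integrable_sq hf)
  have hcv := integral_convolution (ContinuousLinearMap.lsmul ℝ ℝ) iρ (integrable_sq hf)
  have hpt : ∀ x, ‖mol ρ f x‖ ^ 2 ≤ (∫ y, |ρ y|) *
      ((fun y => |ρ y|) ⋆[ContinuousLinearMap.lsmul ℝ ℝ, volume] (fun y => ‖f y‖ ^ 2)) x := by
    intro x
    have hs : Continuous fun y => √|ρ y| := hρ.abs.sqrt
    have hsc : HasCompactSupport fun y => √|ρ y| := hc.comp_left (g := fun r => √|r|) (by simp)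
    have hb : MemLp (fun y => √|ρ (x - y)|) 2 volume :=
      (hs.memLp_of_hasCompactSupport hsc).comp_measurePreserving
        (Measure.measurePreserving_sub_left volume x)
    obtain ⟨B, hB⟩ := hs.bounded_above_of_compact_support hsc
    have hg : MemLp (fun y => √|ρ (x - y)| * ‖f y‖) 2 volume := by
      refine (hf.norm.const_mul B).mono (hb.1.mul hf.norm.1) (Eventually.of_forall fun y => ?_)
      have hB0 : 0 ≤ B := (norm_nonneg _).trans (hB 0)
      have := hB (x - y)
      rw [norm_mul, norm_mul, Real.norm_of_nonneg hB0]
      gcongr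
    have h2 := sq_integral_mul_le (fun y => Real.sqrt_nonneg _)
      (fun y => mul_nonneg (Real.sqrt_nonneg _) (norm_nonneg (f y))) hb hg
    have e1 : ∀ y, √|ρ (x - y)| * (√|ρ (x - y)| * ‖f y‖) = |ρ (x - y)| * ‖f y‖ := fun y => by
      rw [← mul_assoc, Real.mul_self_sqrt (abs_nonneg _)]
    simp only [e1, mul_pow, Real.sq_sqrt (abs_nonneg _)] at h2
    rw [integral_sub_left_eq_self (fun y => |ρ y|) volume x] at h2
    rw [convolution_lsmul_swap]
    refine le_trans (pow_le_pow_left₀ (norm_nonneg _) ?_ 2) h2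
    rw [mol_apply]
    refine (norm_integral_le_integral_norm _).trans (le_of_eq ?_)
    simp only [norm_mul, Complex.norm_real, Real.norm_eq_abs]
  have hint : Integrable (fun x => ‖mol ρ f x‖ ^ 2) := by
    refine (ic.const_mul (∫ y, |ρ y|)).mono' (hm.norm.pow 2) (Eventually.of_forall fun x => ?_)
    rw [Real.norm_of_nonneg (by positivity)]
    exact hpt x
  refine ⟨(memLp_two_iff_integrable_sq_norm hm).2 hint, ?_⟩
  refine (integral_mono hint (ic.const_mul _) hpt).trans (le_of_eq ?_)
  rw [integral_const_mul, hcv]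
  simp only [ContinuousLinearMap.lsmul_apply, smul_eq_mul]
  ring

/-- A sequence of smooth bump functions at the origin with shrinking supports. -/
def bump (n : ℕ) : ContDiffBump (0 : ℝ) where
  rIn := 1 / (2 * (n + 1))
  rOut := 1 / (n + 1)
  rIn_pos := by positivity
  rIn_lt_rOut := by
    rw [div_lt_div_iff₀ (by positivity) (by positivity)]
    have : (0 : ℝ) ≤ n := n.cast_nonneg
    linarith

/-- The standard mollifiers: smooth, nonnegative, of integral one, supported in shrinking balls. -/
def molKer (n : ℕ) : ℝ → ℝ := (bump n).normed volume

theorem molKer_contDiff (n : ℕ) : ContDiff ℝ (⊤ : ℕ∞) (molKer n) := (bump n).contDiff_normed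

theorem molKer_compact (n : ℕ) : HasCompactSupport (molKer n) := (bump n).hasCompactSupport_normed

theorem integral_abs_molKer (n : ℕ) : ∫ y, |molKer n y| = 1 := by
  have : ∀ y, |molKer n y| = molKer n y := fun y => abs_of_nonneg ((bump n).nonneg_normed y)
  simp only [this]
  exact (bump n).integral_normed

theorem tendsto_bump_rOut : Tendsto (fun n => (bump n).rOut) atTop (𝓝 0) :=
  tendsto_one_div_add_atTop_nhds_zero_nat

theorem ae_tendsto_mol {f : ℝ → ℂ} (hf : MemLp f 2 volume) :
    ∀ᵐ x, Tendsto (fun n => mol (molKer n) f x) atTop (𝓝 (f x)) := by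
  refine ContDiffBump.ae_convolution_tendsto_right_of_locallyIntegrable (K := 2)
    tendsto_bump_rOut (Eventually.of_forall fun n => ?_) (locallyIntegrable_of_memLp hf)
  simp only [bump]
  have : (0 : ℝ) < n + 1 := by positivity
  field_simp
  norm_num

theorem integral_mol_sq_le {f : ℝ → ℂ} (hf : MemLp f 2 volume) (n : ℕ) :
    ∫ x, ‖mol (molKer n) f x‖ ^ 2 ≤ ∫ y, ‖f y‖ ^ 2 := by
  have := (memLp_mol (molKer_contDiff n).continuous (molKer_compact n) hf).2
  rwa [integral_abs_molKer, one_pow, one_mul] at this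

theorem memLp_molKer {f : ℝ → ℂ} (hf : MemLp f 2 volume) (n : ℕ) :
    MemLp (mol (molKer n) f) 2 volume :=
  (memLp_mol (molKer_contDiff n).continuous (molKer_compact n) hf).1

/-- For a compactly supported continuous function the convergence is dominated: its mollifications
are uniformly bounded and supported in a fixed compact set. -/
theorem tendsto_mol_of_continuous {g : ℝ → ℂ} (hg : Continuous g) (hc : HasCompactSupport g) :
    Tendsto (fun n => ∫ x, ‖mol (molKer n) g x - g x‖ ^ 2) atTop (𝓝 0) := by
  have hgL : MemLp g 2 volume := hg.memLp_of_hasCompactSupport hc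
  obtain ⟨B, hB⟩ := hg.bounded_above_of_compact_support hc
  have hB0 : 0 ≤ B := (norm_nonneg _).trans (hB 0)
  obtain ⟨R, hR⟩ := hc.isCompact.isBounded.subset_closedBall 0
  have hz : ∀ x, R < |x| → g x = 0 := fun x hx => by
    by_contra hne
    have := hR (subset_tsupport _ hne)
    simp only [Metric.mem_closedBall, dist_zero_right, Real.norm_eq_abs] at this
    linarith
  have hbd : ∀ n x, ‖mol (molKer n) g x‖ ≤ B := fun n x => by
    rw [mol_apply]
    refine (norm_integral_le_integral_norm _).trans ?_
    have h1 : ∫ y, |molKer n (x - y)| * B = B := by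
      rw [integral_mul_const, integral_sub_left_eq_self (fun y => |molKer n y|) volume x,
        integral_abs_molKer, one_mul]
    refine le_trans (integral_mono_of_nonneg (Eventually.of_forall fun y => norm_nonneg _) ?_
      (Eventually.of_forall fun y => ?_)) h1.le
    · have h0 := ((molKer_contDiff n).continuous.integrable_of_hasCompactSupport
        (molKer_compact n) (μ := volume)).abs
      exact (h0.comp_sub_left x).mul_const B
    · simp only [norm_mul, Complex.norm_real, Real.norm_eq_abs]
      gcongr
      exact hB y
  have hz2 : ∀ n x, R + 1 < |x| → mol (molKer n) g x = 0 := fun n x hx => by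
    rw [mol_apply]
    refine integral_eq_zero_of_ae (Eventually.of_forall fun y => ?_)
    simp only [Pi.zero_apply, mul_eq_zero, Complex.ofReal_eq_zero]
    by_cases hy : R < |y|
    · exact Or.inr (hz y hy)
    · left
      by_contra hne
      have h1 : x - y ∈ Function.support ((bump n).normed volume) := hne
      rw [(bump n).support_normed_eq] at h1
      simp only [Metric.mem_ball, dist_zero_right, Real.norm_eq_abs] at h1
      have h2 : (bump n).rOut ≤ 1 := by
        simp only [bump]
        rw [div_le_one (by positivity)]
        have : (0 : ℝ) ≤ n := n.cast_nonneg
        linarith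
      have h3 : |x| ≤ |x - y| + |y| := by simpa using abs_add_le (x - y) y
      linarith
  have hlim : Tendsto (fun n => ∫ x, ‖mol (molKer n) g x - g x‖ ^ 2) atTop
      (𝓝 (∫ _ : ℝ, (0 : ℝ))) := by
    refine tendsto_integral_of_dominated_convergence
      ((Icc (-(R + 1)) (R + 1)).indicator fun _ => (2 * B) ^ 2) ?_ ?_ ?_ ?_
    · intro n
      exact (((memLp_molKer hgL n).1.sub hgL.1).norm.pow 2)
    · exact (integrable_indicator_iff measurableSet_Icc).2
        (integrableOn_const measure_Icc_lt_top.ne enorm_ne_top)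
    · intro n
      refine Eventually.of_forall fun x => ?_
      rw [Real.norm_of_nonneg (by positivity)]
      by_cases hx : x ∈ Icc (-(R + 1)) (R + 1)
      · rw [indicator_of_mem hx]
        have := norm_sub_le (mol (molKer n) g x) (g x)
        have h1 := hbd n x
        have h2 := hB x
        gcongr
        linarith
      · rw [indicator_of_notMem hx]
        have hx' : R + 1 < |x| := by
          rw [mem_Icc, ← abs_le] at hx
          exact not_le.1 hx
        rw [hz2 n x hx', hz x (by linarith)]
        simp
    · filter_upwards [ae_tendsto_mol hgL] with x hx
      have h1 : Tendsto (fun n => mol (molKer n) g x - g x) atTop (𝓝 0) := by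
        simpa using hx.sub_const (g x)
      simpa using (h1.norm.pow 2)
  simpa using hlim

/-- Mollifications converge in `L²`, by density of `C_c` and Young's inequality. -/
theorem tendsto_mol {f : ℝ → ℂ} (hf : MemLp f 2 volume) :
    Tendsto (fun n => ∫ x, ‖mol (molKer n) f x - f x‖ ^ 2) atTop (𝓝 0) := by
  rw [Metric.tendsto_atTop]
  intro δ hδ
  obtain ⟨g, hgc, hfg, hg, hgL⟩ := MemLp.exists_hasCompactSupport_integral_rpow_sub_le
    (p := 2) (by norm_num) (by simpa using hf) (show 0 < δ / 12 by positivity)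
  have hgL2 : MemLp g 2 volume := by simpa using hgL
  simp only [Real.rpow_two] at hfg
  obtain ⟨n₀, hn₀⟩ := Metric.tendsto_atTop.1 (tendsto_mol_of_continuous hg hgc) (δ / 12)
    (by positivity)
  refine ⟨n₀, fun n hn => ?_⟩
  have hk := (molKer_contDiff n).continuous
  have hkc := molKer_compact n
  have h1 := hn₀ n hn
  rw [Real.dist_eq, sub_zero, abs_of_nonneg (integral_nonneg fun x => by positivity)] at h1 ⊢
  have h2 : ∫ x, ‖mol (molKer n) (fun y => f y - g y) x‖ ^ 2 ≤ δ / 12 :=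
    (integral_mol_sq_le (hf.sub hgL2) n).trans hfg
  have hgf : ∫ x, ‖g x - f x‖ ^ 2 ≤ δ / 12 := by
    simpa only [norm_sub_rev] using hfg
  have a1 : MemLp (fun x => mol (molKer n) g x - g x) 2 volume := (memLp_molKer hgL2 n).sub hgL2
  have a2 : MemLp (fun x => g x - f x) 2 volume := hgL2.sub hf
  have e1 := integral_sq_add_le (memLp_molKer (hf.sub hgL2) n) (a1.add a2)
  have e2 := integral_sq_add_le a1 a2
  have e3 : ∀ x, mol (molKer n) (f - g) x + ((fun x => mol (molKer n) g x - g x) +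
      fun x => g x - f x) x = mol (molKer n) f x - f x := fun x => by
    have := mol_sub hk hkc hf hgL2 x
    simp only [Pi.add_apply]
    change mol (molKer n) (fun y => f y - g y) x + _ = _
    rw [this]
    ring
  simp only [e3] at e1
  have h2' : ∫ x, ‖mol (molKer n) (f - g) x‖ ^ 2 ≤ δ / 12 := h2
  simp only [Pi.add_apply] at e1
  linarith

/-! ### Sobolev functions and their weak derivatives -/

/-- `u` and its weak derivative `v` are both square integrable. -/
structure SobolevPair (u v : ℝ → ℂ) : Prop where
  memLp : MemLp u 2 volume
  memLp_deriv : MemLp v 2 volume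
  weak : IsWeakDeriv u v

theorem MemH1.sobolevPair {u : ℝ → ℂ} (hu : MemH1 u) : SobolevPair u (weakDeriv u) :=
  ⟨hu.1, hu.weakDeriv_spec.1, hu.weakDeriv_spec.2⟩

theorem SobolevPair.memH1 {u v : ℝ → ℂ} (h : SobolevPair u v) : MemH1 u :=
  ⟨h.memLp, v, h.memLp_deriv, h.weak⟩

theorem integrable_test_mul {ψ : ℝ → ℝ} {f : ℝ → ℂ} (hψ : Continuous ψ) (hc : HasCompactSupport ψ)
    (hf : MemLp f 2 volume) : Integrable (fun x => ((ψ x : ℝ) : ℂ) * f x) :=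
  MemLp.integrable_mul ((hψ.memLp_of_hasCompactSupport hc (p := 2)).ofReal (K := ℂ)) hf

theorem SobolevPair.sub {u v u' v' : ℝ → ℂ} (h : SobolevPair u v) (h' : SobolevPair u' v') :
    SobolevPair (fun x => u x - u' x) (fun x => v x - v' x) := by
  refine ⟨h.memLp.sub h'.memLp, h.memLp_deriv.sub h'.memLp_deriv, fun ψ hψ hc => ?_⟩
  have hd : Continuous (deriv ψ) := hψ.continuous_deriv (by simp)
  simp only [mul_sub]
  rw [integral_sub (integrable_test_mul hd hc.deriv h.memLp)
    (integrable_test_mul hd hc.deriv h'.memLp),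
    integral_sub (integrable_test_mul hψ.continuous hc h.memLp_deriv)
    (integrable_test_mul hψ.continuous hc h'.memLp_deriv), h.weak ψ hψ hc, h'.weak ψ hψ hc]
  ring

theorem SobolevPair.ae_unique {u v w : ℝ → ℂ} (h : SobolevPair u v) (h' : SobolevPair u w) :
    v =ᵐ[volume] w := by
  refine ae_eq_of_integral_contDiff_smul_eq (locallyIntegrable_of_memLp h.memLp_deriv)
    (locallyIntegrable_of_memLp h'.memLp_deriv) fun ψ hψ hc => ?_
  simp only [Complex.real_smul]
  have h1 := h.weak ψ hψ hc
  rw [h'.weak ψ hψ hc] at h1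
  exact (neg_injective h1).symm

theorem SobolevPair.weakDeriv_ae {u v : ℝ → ℂ} (h : SobolevPair u v) :
    weakDeriv u =ᵐ[volume] v := h.memH1.sobolevPair.ae_unique h

theorem SobolevPair.h1Norm_sq {u v : ℝ → ℂ} (h : SobolevPair u v) :
    h1Norm u ^ 2 = (∫ x, ‖u x‖ ^ 2) + ∫ x, ‖v x‖ ^ 2 := by
  have h1 : ∫ x, ‖weakDeriv u x‖ ^ 2 = ∫ x, ‖v x‖ ^ 2 := by
    refine integral_congr_ae ?_
    filter_upwards [h.weakDeriv_ae] with x hx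
    rw [hx]
  rw [h1Norm, Real.sq_sqrt (add_nonneg (integral_nonneg fun x => by positivity)
    (integral_nonneg fun x => by positivity)), h1]

theorem h1Norm_nonneg (u : ℝ → ℂ) : 0 ≤ h1Norm u := Real.sqrt_nonneg _

/-- The `L²` norm is bounded by the `H¹` norm, without any regularity assumption. -/
theorem integral_sq_le_h1Norm_sq (u : ℝ → ℂ) : ∫ x, ‖u x‖ ^ 2 ≤ h1Norm u ^ 2 := by
  have h1 : 0 ≤ ∫ x, ‖u x‖ ^ 2 := integral_nonneg fun x => by positivity
  have h2 : 0 ≤ ∫ x, ‖weakDeriv u x‖ ^ 2 := integral_nonneg fun x => by positivity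
  rw [h1Norm, Real.sq_sqrt (add_nonneg h1 h2)]
  linarith

theorem SobolevPair.integral_deriv_sq_le {u v : ℝ → ℂ} (h : SobolevPair u v) :
    ∫ x, ‖v x‖ ^ 2 ≤ h1Norm u ^ 2 := by
  rw [h.h1Norm_sq]
  have h1 : 0 ≤ ∫ x, ‖u x‖ ^ 2 := integral_nonneg fun x => by positivity
  linarith

/-- The weak equation tested with a translated and reflected kernel. -/
theorem test_kernel {ρ : ℝ → ℝ} (hρ : ContDiff ℝ (⊤ : ℕ∞) ρ) (hc : HasCompactSupport ρ) (x : ℝ) :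
    ContDiff ℝ (⊤ : ℕ∞) (fun y => ρ (x - y)) ∧ HasCompactSupport (fun y => ρ (x - y)) ∧
      ∀ y, deriv (fun y => ρ (x - y)) y = -deriv ρ (x - y) := by
  refine ⟨hρ.comp (contDiff_const.sub contDiff_id), ?_, fun y => ?_⟩
  · exact hc.comp_homeomorph (Homeomorph.subLeft x)
  · rw [deriv_comp_const_sub]

/-- The definition of the weak derivative, tested with a translate of the reflected kernel. -/
theorem SobolevPair.mol_deriv {u v : ℝ → ℂ} (h : SobolevPair u v) {ρ : ℝ → ℝ}
    (hρ : ContDiff ℝ (⊤ : ℕ∞) ρ) (hc : HasCompactSupport ρ) : mol (deriv ρ) u = mol ρ v := by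
  ext x
  obtain ⟨h1, h2, h3⟩ := test_kernel hρ hc x
  have h4 := h.weak _ h1 h2
  simp only [h3, Complex.ofReal_neg, neg_mul, integral_neg] at h4
  rw [mol_apply, mol_apply]
  exact neg_injective h4

theorem SobolevPair.hasDerivAt_mol {u v : ℝ → ℂ} (h : SobolevPair u v) {ρ : ℝ → ℝ}
    (hρ : ContDiff ℝ (⊤ : ℕ∞) ρ) (hc : HasCompactSupport ρ) (x : ℝ) :
    HasDerivAt (mol ρ u) (mol ρ v x) x := by
  have h1 := GDNLS.hasDerivAt_mol (hρ.of_le (by exact_mod_cast le_top)) hc h.memLp x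
  rwa [h.mol_deriv hρ hc] at h1

/-- The one-dimensional Sobolev inequality in differentiable form: `(|g|²)'` is at most `|g|² +
|g'|²`, and is integrated from `-∞` to `x`. -/
theorem norm_sq_le_of_hasDerivAt {g g' : ℝ → ℂ} (hd : ∀ x, HasDerivAt g (g' x) x)
    (hg : MemLp g 2 volume) (hg' : MemLp g' 2 volume) (x : ℝ) :
    ‖g x‖ ^ 2 ≤ (∫ y, ‖g y‖ ^ 2) + ∫ y, ‖g' y‖ ^ 2 := by
  have hsum : Integrable (fun y => ‖g y‖ ^ 2 + ‖g' y‖ ^ 2) :=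
    (integrable_sq hg).add (integrable_sq hg')
  have hd2 : ∀ y, HasDerivAt (fun y => ‖g y‖ ^ 2) (2 * inner ℝ (g y) (g' y)) y :=
    fun y => (hd y).norm_sq
  have hb : ∀ y, |2 * inner ℝ (g y) (g' y)| ≤ ‖g y‖ ^ 2 + ‖g' y‖ ^ 2 := fun y => by
    have := abs_real_inner_le_norm (g y) (g' y)
    rw [abs_mul, abs_two]
    nlinarith [sq_nonneg (‖g y‖ - ‖g' y‖)]
  have hint : Integrable (fun y => 2 * inner ℝ (g y) (g' y)) :=
    hsum.mono' ((hg.1.inner hg'.1).const_mul 2) (Eventually.of_forall hb)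
  have ht := tendsto_zero_of_hasDerivAt_of_integrableOn_Iic (a := x) (fun y _ => hd2 y)
    hint.integrableOn (integrable_sq hg).integrableOn
  have h1 := integral_Iic_of_hasDerivAt_of_tendsto (a := x)
    (hd2 x).continuousAt.continuousWithinAt (fun y _ => hd2 y) hint.integrableOn ht
  rw [sub_zero] at h1
  rw [← h1, ← integral_add (integrable_sq hg) (integrable_sq hg')]
  refine le_trans ?_ (setIntegral_le_integral (s := Iic x) hsum
    (Eventually.of_forall fun y => by positivity))
  exact integral_mono hint.integrableOn hsum.integrableOn fun y => (le_abs_self _).trans (hb y)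

theorem SobolevPair.norm_mol_le {u v : ℝ → ℂ} (h : SobolevPair u v) (n : ℕ) (x : ℝ) :
    ‖mol (molKer n) u x‖ ≤ h1Norm u := by
  have h1 := norm_sq_le_of_hasDerivAt (h.hasDerivAt_mol (molKer_contDiff n) (molKer_compact n))
    (memLp_molKer h.memLp n) (memLp_molKer h.memLp_deriv n) x
  have h2 := integral_mol_sq_le h.memLp n
  have h3 := integral_mol_sq_le h.memLp_deriv n
  refine abs_le_of_sq_le_sq' ?_ (h1Norm_nonneg u) |>.2
  rw [h.h1Norm_sq]
  linarith

/-- The Sobolev embedding `H¹ ⊂ L^∞` with constant one. -/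
theorem SobolevPair.ae_norm_le {u v : ℝ → ℂ} (h : SobolevPair u v) :
    ∀ᵐ x, ‖u x‖ ≤ h1Norm u := by
  filter_upwards [ae_tendsto_mol h.memLp] with x hx
  exact le_of_tendsto hx.norm (Eventually.of_forall fun n => h.norm_mol_le n x)

/-! ### The nonlinearity -/

theorem abs_rpow_sub_rpow_le {a b M p : ℝ} (hp : 1 ≤ p) (ha : 0 ≤ a) (hb : 0 ≤ b) (haM : a ≤ M)
    (hbM : b ≤ M) : |a ^ p - b ^ p| ≤ p * M ^ (p - 1) * |a - b| := by
  have := Convex.norm_image_sub_le_of_norm_hasDerivWithin_le (f := fun x : ℝ => x ^ p)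
    (f' := fun x => p * x ^ (p - 1)) (s := Icc 0 M) (C := p * M ^ (p - 1)) (x := b) (y := a)
    (fun x _ => (Real.hasDerivAt_rpow_const (Or.inr hp)).hasDerivWithinAt) ?_ (convex_Icc 0 M)
    ⟨hb, hbM⟩ ⟨ha, haM⟩
  · simpa only [Real.norm_eq_abs] using this
  · intro x hx
    rw [Real.norm_of_nonneg (by have := Real.rpow_nonneg hx.1 (p - 1); positivity)]
    have := Real.rpow_le_rpow hx.1 hx.2 (show 0 ≤ p - 1 by linarith)
    gcongr

/-- The nonlinearity `|u|^{2σ} v`. -/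
def nonlin (σ : ℝ) (u v : ℝ → ℂ) (x : ℝ) : ℂ := ((‖u x‖ ^ (2 * σ) : ℝ) : ℂ) * v x

theorem aestronglyMeasurable_rpow {u : ℝ → ℂ} {p : ℝ} (hp : 0 ≤ p)
    (hu : AEStronglyMeasurable u volume) : AEStronglyMeasurable (fun x => ‖u x‖ ^ p) volume :=
  (Real.continuous_rpow_const hp).comp_aestronglyMeasurable hu.norm

theorem aestronglyMeasurable_nonlin {σ : ℝ} (hσ : 0 ≤ σ) {u v : ℝ → ℂ}
    (hu : AEStronglyMeasurable u volume) (hv : AEStronglyMeasurable v volume) :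
    AEStronglyMeasurable (nonlin σ u v) volume :=
  (Complex.continuous_ofReal.comp_aestronglyMeasurable
    (aestronglyMeasurable_rpow (by positivity) hu)).mul hv

theorem norm_nonlin (σ : ℝ) (u v : ℝ → ℂ) (x : ℝ) :
    ‖nonlin σ u v x‖ = ‖u x‖ ^ (2 * σ) * ‖v x‖ := by
  rw [nonlin, norm_mul, Complex.norm_real, Real.norm_of_nonneg (by positivity)]

theorem memLp_nonlin {σ K : ℝ} (hσ : 0 ≤ σ) {u v : ℝ → ℂ} (hu : AEStronglyMeasurable u volume)
    (hv : MemLp v 2 volume) (hK : ∀ᵐ x, ‖u x‖ ≤ K) :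
    MemLp (nonlin σ u v) 2 volume ∧
      ∫ x, ‖nonlin σ u v x‖ ^ 2 ≤ (K ^ (2 * σ)) ^ 2 * ∫ x, ‖v x‖ ^ 2 := by
  have hb : ∀ᵐ x, ‖nonlin σ u v x‖ ≤ ‖((K ^ (2 * σ) : ℝ) : ℂ) * v x‖ := by
    filter_upwards [hK] with x hx
    have h0 : 0 ≤ K := (norm_nonneg _).trans hx
    rw [norm_nonlin, norm_mul, Complex.norm_real, Real.norm_of_nonneg (by positivity)]
    gcongr
  have hm : MemLp (nonlin σ u v) 2 volume :=
    (hv.const_mul _).mono (aestronglyMeasurable_nonlin hσ hu hv.1) hb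
  refine ⟨hm, ?_⟩
  rw [← integral_const_mul]
  refine integral_mono_ae (integrable_sq hm) ((integrable_sq hv).const_mul _) ?_
  filter_upwards [hb] with x hx
  rw [← sq_abs (K ^ (2 * σ)), ← mul_pow]
  rw [norm_mul, Complex.norm_real, Real.norm_eq_abs] at hx
  gcongr

/-- Continuity of the nonlinearity in `L²` under uniform convergence of the first argument. -/
theorem tendsto_nonlin {σ K : ℝ} (hσ : 1 ≤ σ) {U V : ℕ → ℝ → ℂ} {u v : ℝ → ℂ} {δ : ℕ → ℝ}
    (hU : ∀ n, AEStronglyMeasurable (U n) volume) (hu : AEStronglyMeasurable u volume)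
    (hV : ∀ n, MemLp (V n) 2 volume) (hv : MemLp v 2 volume)
    (hUK : ∀ n, ∀ᵐ x, ‖U n x‖ ≤ K) (huK : ∀ᵐ x, ‖u x‖ ≤ K)
    (hUu : ∀ n, ∀ᵐ x, ‖U n x - u x‖ ≤ δ n) (hδ : Tendsto δ atTop (𝓝 0))
    (hVv : Tendsto (fun n => ∫ x, ‖V n x - v x‖ ^ 2) atTop (𝓝 0)) :
    Tendsto (fun n => ∫ x, ‖nonlin σ (U n) (V n) x - nonlin σ u v x‖ ^ 2) atTop (𝓝 0) := by
  have hσ0 : 0 ≤ σ := by linarith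
  set c := 2 * σ * K ^ (2 * σ - 1) with hc
  have hlim : Tendsto (fun n => 2 * ((K ^ (2 * σ)) ^ 2 * ∫ x, ‖V n x - v x‖ ^ 2) +
      2 * ((c * δ n) ^ 2 * ∫ x, ‖v x‖ ^ 2)) atTop (𝓝 0) := by
    have h1 := (hVv.const_mul ((K ^ (2 * σ)) ^ 2)).const_mul 2
    have h2 := ((((hδ.const_mul c).pow 2).mul_const (∫ x, ‖v x‖ ^ 2))).const_mul 2
    simpa using h1.add h2
  refine squeeze_zero (fun n => integral_nonneg fun x => by positivity) (fun n => ?_) hlim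
  have a1 := memLp_nonlin hσ0 (hU n) ((hV n).sub hv) (hUK n)
  have a2m : AEStronglyMeasurable
      (fun x => (((‖U n x‖ ^ (2 * σ) - ‖u x‖ ^ (2 * σ) : ℝ)) : ℂ) * v x) volume :=
    (Complex.continuous_ofReal.comp_aestronglyMeasurable
      ((aestronglyMeasurable_rpow (by positivity) (hU n)).sub
        (aestronglyMeasurable_rpow (by positivity) hu))).mul hv.1
  have hb : ∀ᵐ x, ‖(((‖U n x‖ ^ (2 * σ) - ‖u x‖ ^ (2 * σ) : ℝ)) : ℂ) * v x‖ ≤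
      ‖((c * δ n : ℝ) : ℂ) * v x‖ := by
    filter_upwards [hUK n, huK, hUu n] with x h1 h2 h3
    rw [norm_mul, norm_mul, Complex.norm_real, Complex.norm_real, Real.norm_eq_abs,
      Real.norm_eq_abs]
    have h4 := abs_rpow_sub_rpow_le (p := 2 * σ) (by linarith) (norm_nonneg _) (norm_nonneg _) h1 h2
    have h5 : |‖U n x‖ - ‖u x‖| ≤ δ n := (abs_norm_sub_norm_le _ _).trans h3
    have hK0 : 0 ≤ K := (norm_nonneg _).trans h1
    refine mul_le_mul_of_nonneg_right ?_ (norm_nonneg _)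
    refine (h4.trans ?_).trans (le_abs_self _)
    rw [hc]
    gcongr
  have a2 : MemLp (fun x => (((‖U n x‖ ^ (2 * σ) - ‖u x‖ ^ (2 * σ) : ℝ)) : ℂ) * v x) 2 volume :=
    (hv.const_mul _).mono a2m hb
  have a3 : ∫ x, ‖(((‖U n x‖ ^ (2 * σ) - ‖u x‖ ^ (2 * σ) : ℝ)) : ℂ) * v x‖ ^ 2 ≤
      (c * δ n) ^ 2 * ∫ x, ‖v x‖ ^ 2 := by
    rw [← integral_const_mul]
    refine integral_mono_ae (integrable_sq a2) ((integrable_sq hv).const_mul _) ?_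
    filter_upwards [hb] with x hx
    rw [← sq_abs (c * δ n), ← mul_pow]
    rw [norm_mul ((c * δ n : ℝ) : ℂ), Complex.norm_real, Real.norm_eq_abs] at hx
    gcongr
  have h := integral_sq_add_le a1.1 a2
  have he : ∀ x, nonlin σ (U n) (V n - v) x +
      (((‖U n x‖ ^ (2 * σ) - ‖u x‖ ^ (2 * σ) : ℝ)) : ℂ) * v x =
      nonlin σ (U n) (V n) x - nonlin σ u v x := fun x => by
    simp only [nonlin, Pi.sub_apply]
    push_cast
    ring
  simp only [he] at h
  have h1 := a1.2
  simp only [Pi.sub_apply] at h1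
  linarith

/-- Integration by parts for the mass flux of the nonlinearity:
`2 Re ∫ h ū |u|^{2σ} u' = - (σ+1)⁻¹ ∫ h' |u|^{2σ+2}`. -/
theorem SobolevPair.re_pair_nonlin {σ C : ℝ} (hσ : 1 ≤ σ) {u v : ℝ → ℂ} (h : SobolevPair u v)
    {w w' : ℝ → ℝ} (hw : ∀ x, HasDerivAt w (w' x) x) (hw' : Continuous w')
    (hwC : ∀ x, |w x| ≤ C) (hwC' : ∀ x, |w' x| ≤ C) :
    2 * (pair w u (nonlin σ u v)).re =
      -(1 / (σ + 1)) * (pair (fun x => ‖u x‖ ^ (2 * σ) * w' x) u u).re := by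
  set K := h1Norm u with hK
  have hK0 : 0 ≤ K := h1Norm_nonneg u
  have hC0 : 0 ≤ C := (abs_nonneg _).trans (hwC 0)
  set U := fun n => mol (molKer n) u with hUdef
  set V := fun n => mol (molKer n) v with hVdef
  have hU2 : ∀ n, MemLp (U n) 2 volume := fun n => memLp_molKer h.memLp n
  have hV2 : ∀ n, MemLp (V n) 2 volume := fun n => memLp_molKer h.memLp_deriv n
  have hwc : Continuous w := continuous_iff_continuousAt.2 fun x => (hw x).continuousAt
  have hpow : ∀ r : ℝ, 0 ≤ r → r ≤ K → r ^ (2 * σ) ≤ K ^ (2 * σ) := fun r h0 h1 => by gcongr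
  have hbd : ∀ n (g : ℝ → ℝ), (∀ x, |g x| ≤ C) → ∀ x, |‖U n x‖ ^ (2 * σ) * g x| ≤ K ^ (2 * σ) * C := by
    intro n g hg x
    rw [abs_mul, abs_of_nonneg (by positivity)]
    exact mul_le_mul (hpow _ (norm_nonneg _) (h.norm_mol_le n x)) (hg x) (abs_nonneg _)
      (by positivity)
  have hms : ∀ n (g : ℝ → ℝ), Continuous g →
      AEStronglyMeasurable (fun x => ‖U n x‖ ^ (2 * σ) * g x) volume := fun n g hg =>
    (aestronglyMeasurable_rpow (by positivity) (hU2 n).1).mul hg.aestronglyMeasurable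
  have hlim : ∀ g : ℝ → ℝ, ∀ᵐ x, Tendsto (fun n => ‖U n x‖ ^ (2 * σ) * g x) atTop
      (𝓝 (‖u x‖ ^ (2 * σ) * g x)) := fun g => by
    filter_upwards [ae_tendsto_mol h.memLp] with x hx
    exact (((Real.continuous_rpow_const (by positivity)).tendsto _).comp hx.norm).mul_const _
  -- the identity for the mollified functions
  have hn : ∀ n, 2 * (σ + 1) * (pair (fun x => ‖U n x‖ ^ (2 * σ) * w x) (U n) (V n)).re +
      (pair (fun x => ‖U n x‖ ^ (2 * σ) * w' x) (U n) (U n)).re = 0 := by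
    intro n
    have i1 := integrable_pair (hms n w hwc) (hbd n w hwC) (hU2 n) (hV2 n)
    have i2 := integrable_pair (hms n w' hw') (hbd n w' hwC') (hU2 n) (hU2 n)
    have i3 := integrable_pair (hms n w hwc) (hbd n w hwC) (hU2 n) (hU2 n)
    have hsq : ∀ z : ℂ, (‖z‖ ^ 2) ^ (σ + 1) = ‖z‖ ^ (2 * σ) * ‖z‖ ^ 2 := fun z => by
      have e : (2 : ℝ) * σ = (2 : ℕ) * σ := by norm_num
      rw [Real.rpow_add_one' (by positivity) (by linarith), e, Real.rpow_mul (norm_nonneg _),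
        Real.rpow_natCast]
    have hsq' : ∀ z : ℂ, (‖z‖ ^ 2) ^ (σ + 1 - 1) = ‖z‖ ^ (2 * σ) := fun z => by
      have e : (2 : ℝ) * σ = (2 : ℕ) * σ := by norm_num
      rw [add_sub_cancel_right, e, Real.rpow_mul (norm_nonneg _), Real.rpow_natCast]
    have hd : ∀ x, HasDerivAt (fun x => (‖U n x‖ ^ 2) ^ (σ + 1) * w x)
        (2 * (σ + 1) * ((((‖U n x‖ ^ (2 * σ) * w x : ℝ)) : ℂ) *
          (starRingEnd ℂ (U n x) * V n x)).re +
          ((((‖U n x‖ ^ (2 * σ) * w' x : ℝ)) : ℂ) * (starRingEnd ℂ (U n x) * U n x)).re) x := by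
      intro x
      have d1 := (h.hasDerivAt_mol (molKer_contDiff n) (molKer_compact n) x).norm_sq
      have d2 := (d1.rpow_const (p := σ + 1) (Or.inr (by linarith))).mul (hw x)
      refine d2.congr_deriv ?_
      rw [hsq, hsq', Complex.re_ofReal_mul, Complex.re_ofReal_mul, Complex.inner,
        mul_comm (starRingEnd ℂ (U n x)) (U n x), Complex.mul_conj, Complex.normSq_eq_norm_sq,
        Complex.ofReal_re]
      simp only [hUdef, hVdef]
      rw [mul_comm (mol (molKer n) v x)]
      ring
    have j1 := i1.re
    have j2 := i2.re
    simp only [RCLike.re_to_complex] at j1 j2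
    have hz := integral_eq_zero_of_hasDerivAt_of_integrable hd
      ((j1.const_mul (2 * (σ + 1))).add j2) ?_
    · rw [integral_add (j1.const_mul (2 * (σ + 1))) j2, integral_const_mul] at hz
      have e1 : ∀ {f : ℝ → ℂ}, Integrable f → ∫ x, (f x).re = (∫ x, f x).re :=
        fun hf => integral_re hf
      rw [pair, pair, ← e1 i1, ← e1 i2]
      exact hz
    · refine i3.re.congr (Eventually.of_forall fun x => ?_)
      simp only [RCLike.re_to_complex]
      rw [Complex.re_ofReal_mul, mul_comm (starRingEnd ℂ (U n x)) (U n x), Complex.mul_conj,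
        Complex.normSq_eq_norm_sq, Complex.ofReal_re, hsq]
      ring
  have t1 := tendsto_pair hU2 h.memLp hV2 h.memLp_deriv (tendsto_mol h.memLp)
    (tendsto_mol h.memLp_deriv) (fun n => hms n w hwc) (fun n => hbd n w hwC) (hlim w)
  have t2 := tendsto_pair hU2 h.memLp hU2 h.memLp (tendsto_mol h.memLp)
    (tendsto_mol h.memLp) (fun n => hms n w' hw') (fun n => hbd n w' hwC') (hlim w')
  have t3 := (((Complex.continuous_re.tendsto _).comp t1).const_mul (2 * (σ + 1))).add
    ((Complex.continuous_re.tendsto _).comp t2)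
  have t4 : Tendsto (fun n => 2 * (σ + 1) *
      (pair (fun x => ‖U n x‖ ^ (2 * σ) * w x) (U n) (V n)).re +
      (pair (fun x => ‖U n x‖ ^ (2 * σ) * w' x) (U n) (U n)).re) atTop (𝓝 0) := by
    simp only [hn]
    exact tendsto_const_nhds
  have h0 := tendsto_nhds_unique t3 t4
  have e : pair w u (nonlin σ u v) = pair (fun x => ‖u x‖ ^ (2 * σ) * w x) u v := by
    simp only [pair, nonlin]
    congr 1
    ext x
    push_cast
    ring
  rw [e]
  have : σ + 1 ≠ 0 := by linarith
  field_simp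
  linarith

/-! ### Differentiating space integrals in time -/

/-- Integrated form of differentiation under the integral sign: the time derivative only has to be
bounded, and bounded in `L¹` uniformly in time, instead of being dominated by an integrable
function. -/
theorem integral_sub_integral_eq {T c : ℝ} {q q' : ℝ → ℝ → ℝ}
    (hq : ∀ t ∈ Icc 0 T, ∀ x, HasDerivWithinAt (fun s => q s x) (q' t x) (Icc 0 T) t)
    (hqc : ∀ t ∈ Icc 0 T, Continuous (q t)) (hqc' : ∀ t ∈ Icc 0 T, Continuous (q' t))
    (hb : ∀ t ∈ Icc 0 T, ∀ x, |q t x| ≤ c) (hb' : ∀ t ∈ Icc 0 T, ∀ x, |q' t x| ≤ c)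
    (hi : ∀ t ∈ Icc 0 T, Integrable (q t)) (hi' : ∀ t ∈ Icc 0 T, Integrable (q' t))
    (hc : ∀ t ∈ Icc 0 T, ∫ x, |q' t x| ≤ c) {t : ℝ} (ht : t ∈ Icc 0 T) :
    AEStronglyMeasurable (fun τ => ∫ x, q' τ x) (volume.restrict (uIoc 0 t)) ∧
      (∫ x, q t x) - ∫ x, q 0 x = ∫ τ in (0 : ℝ)..t, ∫ x, q' τ x := by
  have ht0 : 0 ≤ t := ht.1
  have hsub : Icc 0 t ⊆ Icc 0 T := Icc_subset_Icc_right ht.2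
  have h0 : (0 : ℝ) ∈ Icc 0 T := ⟨le_rfl, ht0.trans ht.2⟩
  set μ := fun R : ℕ => volume.restrict (Icc (-(R : ℝ)) R) with hμ
  have hfin : ∀ R : ℕ, Integrable (fun _ : ℝ => c) (μ R) := fun R =>
    integrableOn_const measure_Icc_lt_top.ne enorm_ne_top
  set F := fun (R : ℕ) (τ : ℝ) => ∫ x, q τ x ∂μ R with hF
  set F' := fun (R : ℕ) (τ : ℝ) => ∫ x, q' τ x ∂μ R with hF'
  have hFc : ∀ R, ContinuousOn (F R) (Icc 0 t) := fun R τ hτ => by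
    refine (continuousWithinAt_of_dominated (s := Icc 0 T) (bound := fun _ => c) ?_ ?_ (hfin R)
      ?_).mono hsub
    · filter_upwards [self_mem_nhdsWithin] with s hs
      exact (hqc s hs).aestronglyMeasurable
    · filter_upwards [self_mem_nhdsWithin] with s hs
      exact Eventually.of_forall fun x => hb s hs x
    · exact Eventually.of_forall fun x => (hq τ (hsub hτ) x).continuousWithinAt
  have hFd : ∀ R, ∀ τ ∈ Ioo 0 t, HasDerivAt (F R) (F' R τ) τ := fun R τ hτ => by
    have hmem : Ioo 0 T ∈ 𝓝 τ := Ioo_mem_nhds hτ.1 (hτ.2.trans_le ht.2)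
    have hτT : τ ∈ Icc 0 T := hsub (Ioo_subset_Icc_self hτ)
    refine (hasDerivAt_integral_of_dominated_loc_of_deriv_le (s := Ioo 0 T) (bound := fun _ => c)
      hmem ?_ (hi τ hτT).integrableOn (hqc' τ hτT).aestronglyMeasurable ?_ (hfin R) ?_).2
    · filter_upwards [hmem] with s hs
      exact (hqc s (Ioo_subset_Icc_self hs)).aestronglyMeasurable
    · exact Eventually.of_forall fun x s hs => hb' s (Ioo_subset_Icc_self hs) x
    · exact Eventually.of_forall fun x s hs =>
        (hq s (Ioo_subset_Icc_self hs) x).hasDerivAt (Icc_mem_nhds hs.1 hs.2)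
  have hae : ∀ᵐ τ ∂(volume.restrict (uIoc 0 t)), τ ∈ Ioo 0 t := by
    rw [uIoc_of_le ht0, ← restrict_Ioo_eq_restrict_Ioc]
    exact ae_restrict_mem measurableSet_Ioo
  have hFm : ∀ R, AEStronglyMeasurable (F' R) (volume.restrict (uIoc 0 t)) := fun R => by
    refine ((measurable_deriv (F R)).aestronglyMeasurable).congr ?_
    filter_upwards [hae] with τ hτ
    exact (hFd R τ hτ).deriv
  have hFb : ∀ R, ∀ τ ∈ Icc 0 T, ‖F' R τ‖ ≤ c := fun R τ hτ => by
    refine (norm_integral_le_integral_norm _).trans (le_trans ?_ (hc τ hτ))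
    exact setIntegral_le_integral (hi' τ hτ).norm (Eventually.of_forall fun x => norm_nonneg _)
  have hFi : ∀ R, IntervalIntegrable (F' R) volume 0 t := fun R => by
    rw [intervalIntegrable_iff]
    refine Integrable.mono' (g := fun _ => c) (integrableOn_const (by simp) enorm_ne_top)
      (hFm R) ?_
    filter_upwards [hae] with τ hτ
    exact hFb R τ (hsub (Ioo_subset_Icc_self hτ))
  have hFTC : ∀ R, ∫ τ in (0 : ℝ)..t, F' R τ = F R t - F R 0 := fun R =>
    intervalIntegral.integral_eq_sub_of_hasDerivAt_of_le ht0 (hFc R) (hFd R) (hFi R)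
  have hcov : AECover (volume : Measure ℝ) atTop fun R : ℕ => Icc (-(R : ℝ)) R :=
    aecover_Icc (tendsto_neg_atTop_atBot.comp tendsto_natCast_atTop_atTop)
      tendsto_natCast_atTop_atTop
  have hl1 : ∀ f : ℝ → ℝ, Integrable f → Tendsto (fun R => ∫ x, f x ∂μ R) atTop (𝓝 (∫ x, f x)) :=
    fun f hf => hcov.integral_tendsto_of_countably_generated hf
  have hlim : ∀ᵐ τ ∂(volume.restrict (uIoc 0 t)), Tendsto (fun R => F' R τ) atTop
      (𝓝 (∫ x, q' τ x)) := by
    filter_upwards [hae] with τ hτ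
    exact hl1 _ (hi' τ (hsub (Ioo_subset_Icc_self hτ)))
  refine ⟨aestronglyMeasurable_of_tendsto_ae atTop hFm hlim, ?_⟩
  have hL := ((hl1 _ (hi t ht)).sub (hl1 _ (hi 0 h0)))
  have hRlim : Tendsto (fun R => ∫ τ in (0 : ℝ)..t, F' R τ) atTop
      (𝓝 (∫ τ in (0 : ℝ)..t, ∫ x, q' τ x)) := by
    refine intervalIntegral.tendsto_integral_filter_of_dominated_convergence (fun _ => c)
      (Eventually.of_forall hFm) (Eventually.of_forall fun R => ?_) (by simp)
      ((ae_restrict_iff' measurableSet_uIoc).1 hlim)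
    refine (ae_restrict_iff' measurableSet_uIoc).1 ?_
    filter_upwards [hae] with τ hτ
    exact hFb R τ (hsub (Ioo_subset_Icc_self hτ))
  simp only [hFTC] at hRlim
  exact tendsto_nhds_unique hL hRlim

/-! ### Weighted mass and momentum and their fluxes -/

/-- The weighted combination `A ∫ w |u|² - B Im ∫ w ū v` of mass and momentum. -/
def weightedDensity (A B : ℝ) (w : ℝ → ℝ) (u v : ℝ → ℂ) : ℝ :=
  A * (pair w u u).re - B * (pair w u v).im

/-- The time derivative of `weightedDensity` along `u_t = i u_xx - N`, where `v = u_x`. The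
functions `w₁`, `w₃` are the first and third space derivatives of the weight `w`, and `wt` is its
time derivative. -/
def weightedFlux (A B : ℝ) (w w₁ w₃ wt : ℝ → ℝ) (u v N : ℝ → ℂ) : ℝ :=
  A * (2 * (pair w₁ u v).im - 2 * (pair w u N).re + (pair wt u u).re)
    - B * (2 * (pair w₁ v v).re - 1 / 2 * (pair w₃ u u).re + 2 * (pair w v N).im
      + (pair w₁ u N).im + (pair wt u v).im)

/-- A bounded time dependent weight on `[0,T]`, with its space derivatives up to order three and its
time derivative. -/
structure IsWeight (T C : ℝ) (w w₁ w₂ w₃ wt : ℝ → ℝ → ℝ) : Prop where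
  d₀ : ∀ t ∈ Icc 0 T, ∀ x, HasDerivAt (w t) (w₁ t x) x
  d₁ : ∀ t ∈ Icc 0 T, ∀ x, HasDerivAt (w₁ t) (w₂ t x) x
  d₂ : ∀ t ∈ Icc 0 T, ∀ x, HasDerivAt (w₂ t) (w₃ t x) x
  dt : ∀ t ∈ Icc 0 T, ∀ x, HasDerivWithinAt (fun s => w s x) (wt t x) (Icc 0 T) t
  cont₃ : ∀ t ∈ Icc 0 T, Continuous (w₃ t)
  contt : ∀ t ∈ Icc 0 T, Continuous (wt t)
  time₁ : ∀ x, ContinuousOn (fun t => w₁ t x) (Icc 0 T)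
  time₃ : ∀ x, ContinuousOn (fun t => w₃ t x) (Icc 0 T)
  timet : ∀ x, ContinuousOn (fun t => wt t x) (Icc 0 T)
  b₀ : ∀ t ∈ Icc 0 T, ∀ x, |w t x| ≤ C
  b₁ : ∀ t ∈ Icc 0 T, ∀ x, |w₁ t x| ≤ C
  b₂ : ∀ t ∈ Icc 0 T, ∀ x, |w₂ t x| ≤ C
  b₃ : ∀ t ∈ Icc 0 T, ∀ x, |w₃ t x| ≤ C
  bt : ∀ t ∈ Icc 0 T, ∀ x, |wt t x| ≤ C

theorem continuous_of_hasDerivAt {f f' : ℝ → ℝ} (h : ∀ x, HasDerivAt f (f' x) x) : Continuous f :=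
  continuous_iff_continuousAt.2 fun x => (h x).continuousAt

theorem tendsto_weightedDensity {A B C : ℝ} {F G : ℕ → ℝ → ℂ} {f g : ℝ → ℂ} {W : ℕ → ℝ → ℝ}
    {w : ℝ → ℝ} (hF : ∀ n, MemLp (F n) 2 volume) (hf : MemLp f 2 volume)
    (hG : ∀ n, MemLp (G n) 2 volume) (hg : MemLp g 2 volume)
    (hFf : Tendsto (fun n => ∫ x, ‖F n x - f x‖ ^ 2) atTop (𝓝 0))
    (hGg : Tendsto (fun n => ∫ x, ‖G n x - g x‖ ^ 2) atTop (𝓝 0))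
    (hm : ∀ n, AEStronglyMeasurable (W n) volume) (hb : ∀ n x, |W n x| ≤ C)
    (hl : ∀ᵐ x, Tendsto (fun n => W n x) atTop (𝓝 (w x))) :
    Tendsto (fun n => weightedDensity A B (W n) (F n) (G n)) atTop
      (𝓝 (weightedDensity A B w f g)) :=
  (((Complex.continuous_re.tendsto _).comp
    (tendsto_pair hF hf hF hf hFf hFf hm hb hl)).const_mul A).sub
  (((Complex.continuous_im.tendsto _).comp
    (tendsto_pair hF hf hG hg hFf hGg hm hb hl)).const_mul B)

theorem tendsto_weightedFlux {A B C : ℝ} {F G M : ℕ → ℝ → ℂ} {f g m : ℝ → ℂ}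
    {W W₁ W₃ Wt : ℕ → ℝ → ℝ} {w w₁ w₃ wt : ℝ → ℝ}
    (hF : ∀ n, MemLp (F n) 2 volume) (hf : MemLp f 2 volume)
    (hG : ∀ n, MemLp (G n) 2 volume) (hg : MemLp g 2 volume)
    (hM : ∀ n, MemLp (M n) 2 volume) (hm : MemLp m 2 volume)
    (hFf : Tendsto (fun n => ∫ x, ‖F n x - f x‖ ^ 2) atTop (𝓝 0))
    (hGg : Tendsto (fun n => ∫ x, ‖G n x - g x‖ ^ 2) atTop (𝓝 0))
    (hMm : Tendsto (fun n => ∫ x, ‖M n x - m x‖ ^ 2) atTop (𝓝 0))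
    (m₀ : ∀ n, AEStronglyMeasurable (W n) volume) (b₀ : ∀ n x, |W n x| ≤ C)
    (l₀ : ∀ᵐ x, Tendsto (fun n => W n x) atTop (𝓝 (w x)))
    (m₁ : ∀ n, AEStronglyMeasurable (W₁ n) volume) (b₁ : ∀ n x, |W₁ n x| ≤ C)
    (l₁ : ∀ᵐ x, Tendsto (fun n => W₁ n x) atTop (𝓝 (w₁ x)))
    (m₃ : ∀ n, AEStronglyMeasurable (W₃ n) volume) (b₃ : ∀ n x, |W₃ n x| ≤ C)
    (l₃ : ∀ᵐ x, Tendsto (fun n => W₃ n x) atTop (𝓝 (w₃ x)))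
    (mt : ∀ n, AEStronglyMeasurable (Wt n) volume) (bt : ∀ n x, |Wt n x| ≤ C)
    (lt : ∀ᵐ x, Tendsto (fun n => Wt n x) atTop (𝓝 (wt x))) :
    Tendsto (fun n => weightedFlux A B (W n) (W₁ n) (W₃ n) (Wt n) (F n) (G n) (M n)) atTop
      (𝓝 (weightedFlux A B w w₁ w₃ wt f g m)) := by
  have re : ∀ {z : ℕ → ℂ} {y : ℂ}, Tendsto z atTop (𝓝 y) →
      Tendsto (fun n => (z n).re) atTop (𝓝 y.re) := fun h =>
    (Complex.continuous_re.tendsto _).comp h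
  have im : ∀ {z : ℕ → ℂ} {y : ℂ}, Tendsto z atTop (𝓝 y) →
      Tendsto (fun n => (z n).im) atTop (𝓝 y.im) := fun h =>
    (Complex.continuous_im.tendsto _).comp h
  have t1 := im (tendsto_pair hF hf hG hg hFf hGg m₁ b₁ l₁)
  have t2 := re (tendsto_pair hF hf hM hm hFf hMm m₀ b₀ l₀)
  have t3 := re (tendsto_pair hF hf hF hf hFf hFf mt bt lt)
  have t4 := re (tendsto_pair hG hg hG hg hGg hGg m₁ b₁ l₁)
  have t5 := re (tendsto_pair hF hf hF hf hFf hFf m₃ b₃ l₃)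
  have t6 := im (tendsto_pair hG hg hM hm hGg hMm m₀ b₀ l₀)
  have t7 := im (tendsto_pair hF hf hM hm hFf hMm m₁ b₁ l₁)
  have t8 := im (tendsto_pair hF hf hG hg hFf hGg mt bt lt)
  exact ((((t1.const_mul 2).sub (t2.const_mul 2)).add t3).const_mul A).sub
    ((((((t4.const_mul 2).sub (t5.const_mul (1 / 2))).add (t6.const_mul 2)).add t7).add
      t8).const_mul B)

theorem abs_weightedFlux_le {A B C K : ℝ} {w w₁ w₃ wt : ℝ → ℝ} {u v N : ℝ → ℂ} (hC : 0 ≤ C)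
    (hu : MemLp u 2 volume) (hv : MemLp v 2 volume) (hN : MemLp N 2 volume)
    (uK : ∫ x, ‖u x‖ ^ 2 ≤ K) (vK : ∫ x, ‖v x‖ ^ 2 ≤ K) (NK : ∫ x, ‖N x‖ ^ 2 ≤ K)
    (b₀ : ∀ x, |w x| ≤ C) (b₁ : ∀ x, |w₁ x| ≤ C) (b₃ : ∀ x, |w₃ x| ≤ C) (bt : ∀ x, |wt x| ≤ C) :
    |weightedFlux A B w w₁ w₃ wt u v N| ≤ (|A| + |B|) * (7 * (C * K)) := by
  have re : ∀ {z : ℂ} {k : ℝ}, ‖z‖ ≤ k → |z.re| ≤ k := fun h => (Complex.abs_re_le_norm _).trans h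
  have im : ∀ {z : ℂ} {k : ℝ}, ‖z‖ ≤ k → |z.im| ≤ k := fun h => (Complex.abs_im_le_norm _).trans h
  have t1 := im (norm_pair_le_sum hC b₁ hu hv uK vK)
  have t2 := re (norm_pair_le_sum hC b₀ hu hN uK NK)
  have t3 := re (norm_pair_le_sum hC bt hu hu uK uK)
  have t4 := re (norm_pair_le_sum hC b₁ hv hv vK vK)
  have t5 := re (norm_pair_le_sum hC b₃ hu hu uK uK)
  have t6 := im (norm_pair_le_sum hC b₀ hv hN vK NK)
  have t7 := im (norm_pair_le_sum hC b₁ hu hN uK NK)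
  have t8 := im (norm_pair_le_sum hC bt hu hv uK vK)
  have hk : 0 ≤ C * K := (abs_nonneg _).trans t1
  rw [abs_le] at t1 t2 t3 t4 t5 t6 t7 t8
  rw [weightedFlux, add_mul]
  refine (abs_sub _ _).trans (add_le_add ?_ ?_)
  · rw [abs_mul]
    refine mul_le_mul_of_nonneg_left (abs_le.2 ⟨?_, ?_⟩) (abs_nonneg _) <;> linarith
  · rw [abs_mul]
    refine mul_le_mul_of_nonneg_left (abs_le.2 ⟨?_, ?_⟩) (abs_nonneg _) <;> linarith

/-! ### The localized conservation laws for smooth functions -/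

theorem hasDerivAt_weighted {w : ℝ → ℝ} {f g : ℝ → ℂ} {w' x : ℝ} {f' g' : ℂ} {s : Set ℝ}
    (hw : HasDerivWithinAt w w' s x) (hf : HasDerivWithinAt f f' s x)
    (hg : HasDerivWithinAt g g' s x) :
    HasDerivWithinAt (fun y => ((w y : ℝ) : ℂ) * (starRingEnd ℂ (f y) * g y))
      ((w' : ℂ) * (starRingEnd ℂ (f x) * g x) +
        (w x : ℂ) * (starRingEnd ℂ f' * g x + starRingEnd ℂ (f x) * g')) s x := by
  have h1 : HasDerivWithinAt (fun y => starRingEnd ℂ (f y)) (starRingEnd ℂ f') s x := hf.star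
  have h2 : HasDerivWithinAt (fun y => ((w y : ℝ) : ℂ)) (w' : ℂ) s x :=
    Complex.ofRealCLM.hasFDerivAt.comp_hasDerivWithinAt x hw
  exact h2.mul (h1.mul hg)

theorem HasDerivWithinAt.complex_re {f : ℝ → ℂ} {f' : ℂ} {s : Set ℝ} {x : ℝ}
    (h : HasDerivWithinAt f f' s x) : HasDerivWithinAt (fun y => (f y).re) f'.re s x :=
  Complex.reCLM.hasFDerivAt.comp_hasDerivWithinAt x h

theorem HasDerivWithinAt.complex_im {f : ℝ → ℂ} {f' : ℂ} {s : Set ℝ} {x : ℝ}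
    (h : HasDerivWithinAt f f' s x) : HasDerivWithinAt (fun y => (f y).im) f'.im s x :=
  Complex.imCLM.hasFDerivAt.comp_hasDerivWithinAt x h

/-- The integrand of `weightedDensity`. -/
def densityAt (A B w : ℝ) (u v : ℂ) : ℝ :=
  A * ((w : ℂ) * (starRingEnd ℂ u * u)).re - B * ((w : ℂ) * (starRingEnd ℂ u * v)).im

/-- The time derivative of `densityAt` when `w`, `u`, `v` have time derivatives `wt`, `ut`,
`vt`. -/
def densityDeriv (A B w wt : ℝ) (u v ut vt : ℂ) : ℝ :=
  A * ((wt : ℂ) * (starRingEnd ℂ u * u) +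
      (w : ℂ) * (starRingEnd ℂ ut * u + starRingEnd ℂ u * ut)).re
    - B * ((wt : ℂ) * (starRingEnd ℂ u * v) +
      (w : ℂ) * (starRingEnd ℂ ut * v + starRingEnd ℂ u * vt)).im

theorem abs_densityAt_le {A B w C : ℝ} {u v : ℂ} (hw : |w| ≤ C) :
    |densityAt A B w u v| ≤ (|A| + |B|) * C * (‖u‖ ^ 2 + ‖v‖ ^ 2) := by
  have hC : 0 ≤ C := (abs_nonneg _).trans hw
  have h1 : |((w : ℂ) * (starRingEnd ℂ u * u)).re| ≤ C * (‖u‖ ^ 2 + ‖v‖ ^ 2) := by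
    refine (Complex.abs_re_le_norm _).trans ?_
    simp only [norm_mul, Complex.norm_real, Real.norm_eq_abs, RCLike.norm_conj]
    gcongr
    nlinarith [sq_nonneg ‖v‖]
  have h2 : |((w : ℂ) * (starRingEnd ℂ u * v)).im| ≤ C * (‖u‖ ^ 2 + ‖v‖ ^ 2) := by
    refine (Complex.abs_im_le_norm _).trans ?_
    simp only [norm_mul, Complex.norm_real, Real.norm_eq_abs, RCLike.norm_conj]
    gcongr
    nlinarith [sq_nonneg (‖u‖ - ‖v‖), sq_nonneg ‖v‖, sq_nonneg ‖u‖]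
  rw [densityAt]
  refine (abs_sub _ _).trans ?_
  rw [abs_mul, abs_mul, mul_assoc, add_mul]
  gcongr

theorem abs_densityDeriv_le {A B w wt C : ℝ} {u v ut vt : ℂ} (hw : |w| ≤ C) (hwt : |wt| ≤ C) :
    |densityDeriv A B w wt u v ut vt| ≤
      (|A| + |B|) * (2 * C) * (‖u‖ ^ 2 + ‖v‖ ^ 2 + ‖ut‖ ^ 2 + ‖vt‖ ^ 2) := by
  have hC : 0 ≤ C := (abs_nonneg _).trans hw
  have key : ∀ f g f' g' : ℂ, ‖(wt : ℂ) * (starRingEnd ℂ f * g) +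
      (w : ℂ) * (starRingEnd ℂ f' * g + starRingEnd ℂ f * g')‖ ≤
      C * (‖f‖ * ‖g‖) + C * (‖f'‖ * ‖g‖ + ‖f‖ * ‖g'‖) := fun f g f' g' => by
    refine (norm_add_le _ _).trans (add_le_add ?_ ?_)
    · simp only [norm_mul, Complex.norm_real, Real.norm_eq_abs, RCLike.norm_conj]
      gcongr
    · rw [norm_mul, Complex.norm_real, Real.norm_eq_abs]
      refine mul_le_mul hw ((norm_add_le _ _).trans (le_of_eq ?_)) (norm_nonneg _) hC
      simp only [norm_mul, RCLike.norm_conj]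
  have h1 := (Complex.abs_re_le_norm _).trans (key u u ut ut)
  have h2 := (Complex.abs_im_le_norm _).trans (key u v ut vt)
  have e1 : C * (‖u‖ * ‖u‖) + C * (‖ut‖ * ‖u‖ + ‖u‖ * ‖ut‖) ≤
      2 * C * (‖u‖ ^ 2 + ‖v‖ ^ 2 + ‖ut‖ ^ 2 + ‖vt‖ ^ 2) := by
    rw [← mul_add, mul_comm 2 C, mul_assoc]
    refine mul_le_mul_of_nonneg_left ?_ hC
    nlinarith [sq_nonneg (‖u‖ - ‖ut‖), sq_nonneg ‖v‖, sq_nonneg ‖vt‖, sq_nonneg ‖ut‖]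
  have e2 : C * (‖u‖ * ‖v‖) + C * (‖ut‖ * ‖v‖ + ‖u‖ * ‖vt‖) ≤
      2 * C * (‖u‖ ^ 2 + ‖v‖ ^ 2 + ‖ut‖ ^ 2 + ‖vt‖ ^ 2) := by
    rw [← mul_add, mul_comm 2 C, mul_assoc]
    refine mul_le_mul_of_nonneg_left ?_ hC
    nlinarith [sq_nonneg (‖u‖ - ‖v‖), sq_nonneg (‖ut‖ - ‖v‖), sq_nonneg (‖u‖ - ‖vt‖),
      sq_nonneg ‖v‖, sq_nonneg ‖vt‖, sq_nonneg ‖ut‖, sq_nonneg ‖u‖]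
  rw [densityDeriv]
  refine (abs_sub _ _).trans ?_
  rw [abs_mul, abs_mul, mul_assoc, add_mul]
  have := h1.trans e1
  have := h2.trans e2
  gcongr

/-- The localized conservation law for smooth `u` with `u_t = i u_xx - N`: the density and its flux
differ by an exact space derivative. Here `V = U'`, `W = V'`, `Z = W'` and `M = N'`. -/
theorem integral_densityDeriv {A B C : ℝ} {w w₁ w₂ w₃ wt : ℝ → ℝ} {U V W Z N M : ℝ → ℂ}
    (d₀ : ∀ x, HasDerivAt w (w₁ x) x) (d₁ : ∀ x, HasDerivAt w₁ (w₂ x) x)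
    (d₂ : ∀ x, HasDerivAt w₂ (w₃ x) x) (c₃ : Continuous w₃) (ct : Continuous wt)
    (b₀ : ∀ x, |w x| ≤ C) (b₁ : ∀ x, |w₁ x| ≤ C) (b₂ : ∀ x, |w₂ x| ≤ C) (b₃ : ∀ x, |w₃ x| ≤ C)
    (bt : ∀ x, |wt x| ≤ C)
    (dU : ∀ x, HasDerivAt U (V x) x) (dV : ∀ x, HasDerivAt V (W x) x)
    (dW : ∀ x, HasDerivAt W (Z x) x) (dN : ∀ x, HasDerivAt N (M x) x)
    (lU : MemLp U 2 volume) (lV : MemLp V 2 volume) (lW : MemLp W 2 volume)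
    (lZ : MemLp Z 2 volume) (lN : MemLp N 2 volume) (lM : MemLp M 2 volume) :
    Integrable (fun x => densityDeriv A B (w x) (wt x) (U x) (V x)
        (Complex.I * W x - N x) (Complex.I * Z x - M x)) ∧
      ∫ x, densityDeriv A B (w x) (wt x) (U x) (V x)
        (Complex.I * W x - N x) (Complex.I * Z x - M x) = weightedFlux A B w w₁ w₃ wt U V N := by
  have m₀ : AEStronglyMeasurable w volume := (continuous_of_hasDerivAt d₀).aestronglyMeasurable
  have m₁ : AEStronglyMeasurable w₁ volume := (continuous_of_hasDerivAt d₁).aestronglyMeasurable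
  have m₂ : AEStronglyMeasurable w₂ volume := (continuous_of_hasDerivAt d₂).aestronglyMeasurable
  have m₃ : AEStronglyMeasurable w₃ volume := c₃.aestronglyMeasurable
  have mt : AEStronglyMeasurable wt volume := ct.aestronglyMeasurable
  have re : ∀ {f : ℝ → ℂ}, Integrable f → Integrable (fun x => (f x).re) := fun h => h.re
  have im : ∀ {f : ℝ → ℂ}, Integrable f → Integrable (fun x => (f x).im) := fun h => h.im
  have ere : ∀ {f : ℝ → ℂ}, Integrable f → ∫ x, (f x).re = (∫ x, f x).re :=
    fun hf => integral_re hf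
  have eim : ∀ {f : ℝ → ℂ}, Integrable f → ∫ x, (f x).im = (∫ x, f x).im :=
    fun hf => integral_im hf
  have lUt : MemLp (fun x => Complex.I * W x - N x) 2 volume := (lW.const_mul _).sub lN
  have lVt : MemLp (fun x => Complex.I * Z x - M x) 2 volume := (lZ.const_mul _).sub lM
  -- integrability of the time derivative
  have q1 := re (integrable_pair mt bt lU lU)
  have q2 := re (integrable_pair m₀ b₀ lUt lU)
  have q3 := re (integrable_pair m₀ b₀ lU lUt)
  have q4 := im (integrable_pair mt bt lU lV)
  have q5 := im (integrable_pair m₀ b₀ lUt lV)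
  have q6 := im (integrable_pair m₀ b₀ lU lVt)
  have hq : Integrable (fun x => densityDeriv A B (w x) (wt x) (U x) (V x)
      (Complex.I * W x - N x) (Complex.I * Z x - M x)) := by
    refine (((q1.add (q2.add q3)).const_mul A).sub ((q4.add (q5.add q6)).const_mul B)).congr
      (Eventually.of_forall fun x => ?_)
    simp only [densityDeriv, mul_add, Complex.add_re, Complex.add_im, Pi.add_apply, Pi.sub_apply]
  -- integrability of the flux density
  have i1 := integrable_pair m₁ b₁ lU lV
  have i2 := integrable_pair m₀ b₀ lU lN
  have i3 := integrable_pair mt bt lU lU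
  have i4 := integrable_pair m₁ b₁ lV lV
  have i5 := integrable_pair m₃ b₃ lU lU
  have i6 := integrable_pair m₀ b₀ lV lN
  have i7 := integrable_pair m₁ b₁ lU lN
  have i8 := integrable_pair mt bt lU lV
  have k1 := (im i1).const_mul 2
  have k2 := (re i2).const_mul 2
  have k3 := re i3
  have k4 := (re i4).const_mul 2
  have k5 := (re i5).const_mul (1 / 2)
  have k6 := (im i6).const_mul 2
  have k7 := im i7
  have k8 := im i8
  have kA := ((k1.sub k2).add k3).const_mul A
  have kB := ((((k4.sub k5).add k6).add k7).add k8).const_mul B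
  have hflux := integral_sub kA kB
  rw [integral_const_mul, integral_const_mul, integral_add' (k1.sub k2) k3, integral_sub' k1 k2,
    integral_add' (((k4.sub k5).add k6).add k7) k8, integral_add' ((k4.sub k5).add k6) k7,
    integral_add' (k4.sub k5) k6, integral_sub' k4 k5, integral_const_mul, integral_const_mul,
    integral_const_mul, integral_const_mul, integral_const_mul, eim i1, ere i2, ere i3, ere i4,
    ere i5, eim i6, eim i7, eim i8] at hflux
  refine ⟨hq, ?_⟩
  -- the exact derivative
  have hE := integral_eq_zero_of_hasDerivAt_of_integrable
    (f := fun x => -(2 * A) * (((w x : ℝ) : ℂ) * (starRingEnd ℂ (U x) * V x)).im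
      - B * ((((w x : ℝ) : ℂ) * (starRingEnd ℂ (U x) * W x)).re
        - (((w x : ℝ) : ℂ) * (starRingEnd ℂ (V x) * V x)).re
        - (((w₁ x : ℝ) : ℂ) * (starRingEnd ℂ (U x) * V x)).re
        + 1 / 2 * (((w₂ x : ℝ) : ℂ) * (starRingEnd ℂ (U x) * U x)).re
        - (((w x : ℝ) : ℂ) * (starRingEnd ℂ (U x) * N x)).im))
    (f' := fun x => densityDeriv A B (w x) (wt x) (U x) (V x)
        (Complex.I * W x - N x) (Complex.I * Z x - M x) -
      (A * (2 * (((w₁ x : ℝ) : ℂ) * (starRingEnd ℂ (U x) * V x)).im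
          - 2 * (((w x : ℝ) : ℂ) * (starRingEnd ℂ (U x) * N x)).re
          + (((wt x : ℝ) : ℂ) * (starRingEnd ℂ (U x) * U x)).re)
        - B * (2 * (((w₁ x : ℝ) : ℂ) * (starRingEnd ℂ (V x) * V x)).re
          - 1 / 2 * (((w₃ x : ℝ) : ℂ) * (starRingEnd ℂ (U x) * U x)).re
          + 2 * (((w x : ℝ) : ℂ) * (starRingEnd ℂ (V x) * N x)).im
          + (((w₁ x : ℝ) : ℂ) * (starRingEnd ℂ (U x) * N x)).im
          + (((wt x : ℝ) : ℂ) * (starRingEnd ℂ (U x) * V x)).im)))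
    ?_ ?_ ?_
  · exact (sub_eq_zero.1 ((integral_sub hq (kA.sub kB)).symm.trans hE)).trans hflux
  · intro x
    rw [← hasDerivWithinAt_univ]
    have e0 := (d₀ x).hasDerivWithinAt (s := univ)
    have e1 := (d₁ x).hasDerivWithinAt (s := univ)
    have e2 := (d₂ x).hasDerivWithinAt (s := univ)
    have eU := (dU x).hasDerivWithinAt (s := univ)
    have eV := (dV x).hasDerivWithinAt (s := univ)
    have eW := (dW x).hasDerivWithinAt (s := univ)
    have eN := (dN x).hasDerivWithinAt (s := univ)
    have g1 := (HasDerivWithinAt.complex_im (hasDerivAt_weighted e0 eU eV)).const_mul (-(2 * A))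
    have g2 := HasDerivWithinAt.complex_re (hasDerivAt_weighted e0 eU eW)
    have g3 := HasDerivWithinAt.complex_re (hasDerivAt_weighted e0 eV eV)
    have g4 := HasDerivWithinAt.complex_re (hasDerivAt_weighted e1 eU eV)
    have g5 := (HasDerivWithinAt.complex_re (hasDerivAt_weighted e2 eU eU)).const_mul (1 / 2)
    have g6 := HasDerivWithinAt.complex_im (hasDerivAt_weighted e0 eU eN)
    refine (g1.sub (((((g2.sub g3).sub g4).add g5).sub g6).const_mul B)).congr_deriv ?_
    simp only [densityDeriv, Complex.mul_re, Complex.mul_im, Complex.add_re, Complex.add_im,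
      Complex.sub_re, Complex.sub_im, Complex.conj_re, Complex.conj_im, Complex.ofReal_re,
      Complex.ofReal_im, Complex.I_re, Complex.I_im]
    ring
  · exact hq.sub (kA.sub kB)
  · have j1 := im (integrable_pair m₀ b₀ lU lV)
    have j2 := re (integrable_pair m₀ b₀ lU lW)
    have j3 := re (integrable_pair m₀ b₀ lV lV)
    have j4 := re (integrable_pair m₁ b₁ lU lV)
    have j5 := re (integrable_pair m₂ b₂ lU lU)
    have j6 := im (integrable_pair m₀ b₀ lU lN)
    exact (j1.const_mul _).sub (((((j2.sub j3).sub j4).add (j5.const_mul _)).sub j6).const_mul B)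

/-! ### The localized conservation laws for `H¹` solutions -/

/-- `u` is a curve of Sobolev functions, with weak space derivative `v`, solving
`u_t = i u_xx - N` in the sense of distributions in space at every time. -/
structure WeakEvolution (T : ℝ) (u v N : ℝ → ℝ → ℂ) : Prop where
  sobolev : ∀ t ∈ Icc 0 T, SobolevPair (u t) (v t)
  memLp_force : ∀ t ∈ Icc 0 T, MemLp (N t) 2 volume
  equation : ∀ ψ : ℝ → ℝ, ContDiff ℝ (⊤ : ℕ∞) ψ → HasCompactSupport ψ → ∀ t ∈ Icc 0 T,
    HasDerivWithinAt (fun s => ∫ x, u s x * ((ψ x : ℝ) : ℂ))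
      (-Complex.I * (∫ x, v t x * ((deriv ψ x : ℝ) : ℂ)) - ∫ x, N t x * ((ψ x : ℝ) : ℂ))
      (Icc 0 T) t

/-- Mollifying in space amounts to testing the equation with a translated kernel, so the mollified
curve is differentiable in time at every point. -/
theorem WeakEvolution.hasDerivWithinAt_mol {T : ℝ} {u v N : ℝ → ℝ → ℂ} (h : WeakEvolution T u v N)
    {ρ : ℝ → ℝ} (hρ : ContDiff ℝ (⊤ : ℕ∞) ρ) (hc : HasCompactSupport ρ) {t : ℝ}
    (ht : t ∈ Icc 0 T) (x : ℝ) :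
    HasDerivWithinAt (fun s => mol ρ (u s) x)
      (Complex.I * mol (deriv ρ) (v t) x - mol ρ (N t) x) (Icc 0 T) t := by
  obtain ⟨h1, h2, h3⟩ := test_kernel hρ hc x
  have h4 := h.equation _ h1 h2 t ht
  simp only [h3, Complex.ofReal_neg, mul_neg, integral_neg, neg_mul, neg_neg] at h4
  simp only [mol_apply]
  simpa only [mul_comm] using h4

theorem contDiff_deriv_top {ρ : ℝ → ℝ} (hρ : ContDiff ℝ (⊤ : ℕ∞) ρ) :
    ContDiff ℝ (⊤ : ℕ∞) (deriv ρ) := (contDiff_infty_iff_deriv.1 hρ).2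

theorem integral_densityAt {A B C : ℝ} {w : ℝ → ℝ} {u v : ℝ → ℂ}
    (hm : AEStronglyMeasurable w volume) (hb : ∀ x, |w x| ≤ C)
    (hu : MemLp u 2 volume) (hv : MemLp v 2 volume) :
    Integrable (fun x => densityAt A B (w x) (u x) (v x)) ∧
      ∫ x, densityAt A B (w x) (u x) (v x) = weightedDensity A B w u v := by
  have i1 := integrable_pair hm hb hu hu
  have i2 := integrable_pair hm hb hu hv
  have j1 : Integrable (fun x => (((w x : ℝ) : ℂ) * (starRingEnd ℂ (u x) * u x)).re) := i1.re
  have j2 : Integrable (fun x => (((w x : ℝ) : ℂ) * (starRingEnd ℂ (u x) * v x)).im) := i2.im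
  refine ⟨(j1.const_mul A).sub (j2.const_mul B), ?_⟩
  simp only [densityAt]
  rw [integral_sub (j1.const_mul A) (j2.const_mul B), integral_const_mul, integral_const_mul]
  have e1 : ∫ x, (((w x : ℝ) : ℂ) * (starRingEnd ℂ (u x) * u x)).re = (pair w u u).re :=
    integral_re i1
  have e2 : ∫ x, (((w x : ℝ) : ℂ) * (starRingEnd ℂ (u x) * v x)).im = (pair w u v).im :=
    integral_im i2
  rw [e1, e2, weightedDensity]

/-- The balance law, integrated in time, for the mollified curve. The latter is smooth in space and
pointwise differentiable in time, with derivative `Ut = i ρ' * v - ρ * N`, and `ρ * v` has the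
derivative `Vt = i ρ'' * v - ρ' * N`. -/
theorem WeakEvolution.mollified_balance {T C K A B : ℝ} {u v N : ℝ → ℝ → ℂ}
    (h : WeakEvolution T u v N) {w w₁ w₂ w₃ wt : ℝ → ℝ → ℝ} (hw : IsWeight T C w w₁ w₂ w₃ wt)
    (uK : ∀ t ∈ Icc 0 T, ∫ x, ‖u t x‖ ^ 2 ≤ K) (vK : ∀ t ∈ Icc 0 T, ∫ x, ‖v t x‖ ^ 2 ≤ K)
    (NK : ∀ t ∈ Icc 0 T, ∫ x, ‖N t x‖ ^ 2 ≤ K) {ρ : ℝ → ℝ} (hρ : ContDiff ℝ (⊤ : ℕ∞) ρ)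
    (hc : HasCompactSupport ρ) {t : ℝ} (ht : t ∈ Icc 0 T) :
    AEStronglyMeasurable (fun τ => weightedFlux A B (w τ) (w₁ τ) (w₃ τ) (wt τ)
        (mol ρ (u τ)) (mol ρ (v τ)) (mol ρ (N τ))) (volume.restrict (uIoc 0 t)) ∧
      weightedDensity A B (w t) (mol ρ (u t)) (mol ρ (v t))
        - weightedDensity A B (w 0) (mol ρ (u 0)) (mol ρ (v 0)) =
      ∫ τ in (0 : ℝ)..t, weightedFlux A B (w τ) (w₁ τ) (w₃ τ) (wt τ)
        (mol ρ (u τ)) (mol ρ (v τ)) (mol ρ (N τ)) := by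
  have h0 : (0 : ℝ) ∈ Icc 0 T := ⟨le_rfl, ht.1.trans ht.2⟩
  have hK0 : 0 ≤ K := (integral_nonneg fun x => by positivity).trans (uK t ht)
  have hC0 : 0 ≤ C := (abs_nonneg _).trans (hw.b₀ t ht 0)
  have hρ' := contDiff_deriv_top hρ
  have hρ'' := contDiff_deriv_top hρ'
  have c0 := hρ.continuous
  have c1 := hρ'.continuous
  have c2 := hρ''.continuous
  have hc' := hc.deriv
  have hc'' := hc'.deriv
  have lu : ∀ τ ∈ Icc 0 T, MemLp (u τ) 2 volume := fun τ hτ => (h.sobolev τ hτ).memLp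
  have lv : ∀ τ ∈ Icc 0 T, MemLp (v τ) 2 volume := fun τ hτ => (h.sobolev τ hτ).memLp_deriv
  have lN := h.memLp_force
  have one : ((1 : ℕ∞) : WithTop ℕ∞) ≤ ((⊤ : ℕ∞) : WithTop ℕ∞) := by exact_mod_cast le_top
  set Ut := fun τ x => Complex.I * mol (deriv ρ) (v τ) x - mol ρ (N τ) x with hUt
  set Vt := fun τ x => Complex.I * mol (deriv (deriv ρ)) (v τ) x - mol (deriv ρ) (N τ) x with hVt
  -- pointwise and `L²` bounds
  set p := (∫ y, ρ y ^ 2) + (∫ y, deriv ρ y ^ 2) + ∫ y, deriv (deriv ρ) y ^ 2 with hp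
  set r := (∫ y, |ρ y|) ^ 2 + (∫ y, |deriv ρ y|) ^ 2 + (∫ y, |deriv (deriv ρ) y|) ^ 2 with hr
  have p0 : 0 ≤ ∫ y, ρ y ^ 2 := integral_nonneg fun x => by positivity
  have p1 : 0 ≤ ∫ y, deriv ρ y ^ 2 := integral_nonneg fun x => by positivity
  have p2 : 0 ≤ ∫ y, deriv (deriv ρ) y ^ 2 := integral_nonneg fun x => by positivity
  have hsub : ∀ a b : ℂ, ‖Complex.I * a - b‖ ^ 2 ≤ 2 * ‖a‖ ^ 2 + 2 * ‖b‖ ^ 2 := fun a b => by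
    have := norm_sub_le (Complex.I * a) b
    rw [norm_mul, Complex.norm_I, one_mul] at this
    nlinarith [norm_nonneg (Complex.I * a - b), sq_nonneg (‖a‖ - ‖b‖)]
  set S := fun τ x => ‖mol ρ (u τ) x‖ ^ 2 + ‖mol ρ (v τ) x‖ ^ 2 + ‖Ut τ x‖ ^ 2 + ‖Vt τ x‖ ^ 2
    with hS
  have hSp : ∀ τ ∈ Icc 0 T, ∀ x, S τ x ≤ 4 * (p * K) := fun τ hτ x => by
    have a1 := (norm_mol_sq_le c0 hc (lu τ hτ) x).trans (mul_le_mul_of_nonneg_left (uK τ hτ) p0)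
    have a2 := (norm_mol_sq_le c0 hc (lv τ hτ) x).trans (mul_le_mul_of_nonneg_left (vK τ hτ) p0)
    have a3 := (norm_mol_sq_le c1 hc' (lv τ hτ) x).trans (mul_le_mul_of_nonneg_left (vK τ hτ) p1)
    have a4 := (norm_mol_sq_le c0 hc (lN τ hτ) x).trans (mul_le_mul_of_nonneg_left (NK τ hτ) p0)
    have a5 := (norm_mol_sq_le c2 hc'' (lv τ hτ) x).trans (mul_le_mul_of_nonneg_left (vK τ hτ) p2)
    have a6 := (norm_mol_sq_le c1 hc' (lN τ hτ) x).trans (mul_le_mul_of_nonneg_left (NK τ hτ) p1)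
    have b1 := hsub (mol (deriv ρ) (v τ) x) (mol ρ (N τ) x)
    have b2 := hsub (mol (deriv (deriv ρ)) (v τ) x) (mol (deriv ρ) (N τ) x)
    have k0 := mul_nonneg p0 hK0
    have k1 := mul_nonneg p1 hK0
    have k2 := mul_nonneg p2 hK0
    simp only [hS, hUt, hVt, hp, add_mul]
    linarith
  have lUt : ∀ τ ∈ Icc 0 T, MemLp (Ut τ) 2 volume := fun τ hτ =>
    ((memLp_mol c1 hc' (lv τ hτ)).1.const_mul _).sub (memLp_mol c0 hc (lN τ hτ)).1
  have lVt : ∀ τ ∈ Icc 0 T, MemLp (Vt τ) 2 volume := fun τ hτ =>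
    ((memLp_mol c2 hc'' (lv τ hτ)).1.const_mul _).sub (memLp_mol c1 hc' (lN τ hτ)).1
  have hSint : ∀ τ ∈ Icc 0 T, Integrable (S τ) := fun τ hτ =>
    (((integrable_sq (memLp_mol c0 hc (lu τ hτ)).1).add
      (integrable_sq (memLp_mol c0 hc (lv τ hτ)).1)).add (integrable_sq (lUt τ hτ))).add
      (integrable_sq (lVt τ hτ))
  have hSi : ∀ τ ∈ Icc 0 T, ∫ x, S τ x ≤ 4 * (r * K) := fun τ hτ => by
    have i1 := integrable_sq (memLp_mol c0 hc (lu τ hτ)).1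
    have i2 := integrable_sq (memLp_mol c0 hc (lv τ hτ)).1
    have i3 := integrable_sq (memLp_mol c1 hc' (lv τ hτ)).1
    have i4 := integrable_sq (memLp_mol c0 hc (lN τ hτ)).1
    have i5 := integrable_sq (memLp_mol c2 hc'' (lv τ hτ)).1
    have i6 := integrable_sq (memLp_mol c1 hc' (lN τ hτ)).1
    have a1 := (memLp_mol c0 hc (lu τ hτ)).2.trans
      (mul_le_mul_of_nonneg_left (uK τ hτ) (sq_nonneg _))
    have a2 := (memLp_mol c0 hc (lv τ hτ)).2.trans
      (mul_le_mul_of_nonneg_left (vK τ hτ) (sq_nonneg _))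
    have a3 := (memLp_mol c1 hc' (lv τ hτ)).2.trans
      (mul_le_mul_of_nonneg_left (vK τ hτ) (sq_nonneg _))
    have a4 := (memLp_mol c0 hc (lN τ hτ)).2.trans
      (mul_le_mul_of_nonneg_left (NK τ hτ) (sq_nonneg _))
    have a5 := (memLp_mol c2 hc'' (lv τ hτ)).2.trans
      (mul_le_mul_of_nonneg_left (vK τ hτ) (sq_nonneg _))
    have a6 := (memLp_mol c1 hc' (lN τ hτ)).2.trans
      (mul_le_mul_of_nonneg_left (NK τ hτ) (sq_nonneg _))
    have b1 : ∫ x, ‖Ut τ x‖ ^ 2 ≤ 2 * (∫ x, ‖mol (deriv ρ) (v τ) x‖ ^ 2) +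
        2 * ∫ x, ‖mol ρ (N τ) x‖ ^ 2 := by
      rw [← integral_const_mul, ← integral_const_mul, ← integral_add (i3.const_mul 2)
        (i4.const_mul 2)]
      exact integral_mono (integrable_sq (lUt τ hτ)) ((i3.const_mul 2).add (i4.const_mul 2))
        fun x => hsub _ _
    have b2 : ∫ x, ‖Vt τ x‖ ^ 2 ≤ 2 * (∫ x, ‖mol (deriv (deriv ρ)) (v τ) x‖ ^ 2) +
        2 * ∫ x, ‖mol (deriv ρ) (N τ) x‖ ^ 2 := by
      rw [← integral_const_mul, ← integral_const_mul, ← integral_add (i5.const_mul 2)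
        (i6.const_mul 2)]
      exact integral_mono (integrable_sq (lVt τ hτ)) ((i5.const_mul 2).add (i6.const_mul 2))
        fun x => hsub _ _
    have k0 := mul_nonneg (sq_nonneg (∫ y, |ρ y|)) hK0
    have k1 := mul_nonneg (sq_nonneg (∫ y, |deriv ρ y|)) hK0
    have k2 := mul_nonneg (sq_nonneg (∫ y, |deriv (deriv ρ) y|)) hK0
    have e : ∫ x, S τ x = (∫ x, ‖mol ρ (u τ) x‖ ^ 2) + (∫ x, ‖mol ρ (v τ) x‖ ^ 2) +
        (∫ x, ‖Ut τ x‖ ^ 2) + ∫ x, ‖Vt τ x‖ ^ 2 := by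
      have s1 := integral_add i1 i2
      have s2 := integral_add (i1.add i2) (integrable_sq (lUt τ hτ))
      have s3 := integral_add ((i1.add i2).add (integrable_sq (lUt τ hτ)))
        (integrable_sq (lVt τ hτ))
      exact s3.trans (by rw [← s1]; exact congrArg (· + _) s2)
    rw [e, hr, add_mul, add_mul]
    linarith
  set a := (|A| + |B|) * (2 * C) with ha
  have ha0 : 0 ≤ a := by positivity
  have hpK : 0 ≤ p * K := by positivity
  have hrK : 0 ≤ r * K := by positivity
  set c := a * (4 * (p * K)) + a * (4 * (r * K)) with hcdef
  set q := fun τ x => densityAt A B (w τ x) (mol ρ (u τ) x) (mol ρ (v τ) x) with hq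
  set q' := fun τ x => densityDeriv A B (w τ x) (wt τ x) (mol ρ (u τ) x) (mol ρ (v τ) x)
    (Ut τ x) (Vt τ x) with hq'
  have hdq : ∀ τ ∈ Icc 0 T, ∀ x, HasDerivWithinAt (fun s => q s x) (q' τ x) (Icc 0 T) τ := by
    intro τ hτ x
    have d1 := h.hasDerivWithinAt_mol hρ hc hτ x
    have d2 : HasDerivWithinAt (fun s => mol ρ (v s) x) (Vt τ x) (Icc 0 T) τ := by
      refine (h.hasDerivWithinAt_mol hρ' hc' hτ x).congr (fun s hs => ?_) ?_
      · rw [(h.sobolev s hs).mol_deriv hρ hc]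
      · rw [(h.sobolev τ hτ).mol_deriv hρ hc]
    exact ((HasDerivWithinAt.complex_re (hasDerivAt_weighted (hw.dt τ hτ x) d1 d1)).const_mul
      A).sub ((HasDerivWithinAt.complex_im (hasDerivAt_weighted (hw.dt τ hτ x) d1 d2)).const_mul B)
  have hbal : ∀ τ ∈ Icc 0 T, Integrable (q' τ) ∧ ∫ x, q' τ x =
      weightedFlux A B (w τ) (w₁ τ) (w₃ τ) (wt τ) (mol ρ (u τ)) (mol ρ (v τ)) (mol ρ (N τ)) :=
    fun τ hτ => integral_densityDeriv (hw.d₀ τ hτ) (hw.d₁ τ hτ) (hw.d₂ τ hτ) (hw.cont₃ τ hτ)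
      (hw.contt τ hτ) (hw.b₀ τ hτ) (hw.b₁ τ hτ) (hw.b₂ τ hτ) (hw.b₃ τ hτ) (hw.bt τ hτ)
      ((h.sobolev τ hτ).hasDerivAt_mol hρ hc) (GDNLS.hasDerivAt_mol (hρ.of_le one) hc (lv τ hτ))
      (GDNLS.hasDerivAt_mol (hρ'.of_le one) hc' (lv τ hτ))
      (GDNLS.hasDerivAt_mol (hρ.of_le one) hc (lN τ hτ))
      (memLp_mol c0 hc (lu τ hτ)).1 (memLp_mol c0 hc (lv τ hτ)).1 (memLp_mol c1 hc' (lv τ hτ)).1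
      (memLp_mol c2 hc'' (lv τ hτ)).1 (memLp_mol c0 hc (lN τ hτ)).1 (memLp_mol c1 hc' (lN τ hτ)).1
  have hdens : ∀ τ ∈ Icc 0 T, Integrable (q τ) ∧ ∫ x, q τ x =
      weightedDensity A B (w τ) (mol ρ (u τ)) (mol ρ (v τ)) := fun τ hτ =>
    integral_densityAt (continuous_of_hasDerivAt (hw.d₀ τ hτ)).aestronglyMeasurable (hw.b₀ τ hτ)
      (memLp_mol c0 hc (lu τ hτ)).1 (memLp_mol c0 hc (lv τ hτ)).1
  have cU : ∀ τ ∈ Icc 0 T, Continuous (mol ρ (u τ)) := fun τ hτ => continuous_mol c0 hc (lu τ hτ)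
  have cV : ∀ τ ∈ Icc 0 T, Continuous (mol ρ (v τ)) := fun τ hτ => continuous_mol c0 hc (lv τ hτ)
  have cUt : ∀ τ ∈ Icc 0 T, Continuous (Ut τ) := fun τ hτ =>
    (continuous_const.mul (continuous_mol c1 hc' (lv τ hτ))).sub (continuous_mol c0 hc (lN τ hτ))
  have cVt : ∀ τ ∈ Icc 0 T, Continuous (Vt τ) := fun τ hτ =>
    (continuous_const.mul (continuous_mol c2 hc'' (lv τ hτ))).sub
      (continuous_mol c1 hc' (lN τ hτ))
  have habs' : ∀ τ ∈ Icc 0 T, ∀ x, |q' τ x| ≤ a * S τ x := fun τ hτ x =>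
    abs_densityDeriv_le (hw.b₀ τ hτ x) (hw.bt τ hτ x)
  have hmain := integral_sub_integral_eq (T := T) (c := c) (q := q) (q' := q') hdq ?_ ?_ ?_ ?_
    (fun τ hτ => (hdens τ hτ).1) (fun τ hτ => (hbal τ hτ).1) ?_ ht
  · have hsubI : uIoc 0 t ⊆ Icc 0 T := by
      rw [uIoc_of_le ht.1]
      exact fun s hs => ⟨hs.1.le, hs.2.trans ht.2⟩
    rw [(hdens t ht).2, (hdens 0 h0).2] at hmain
    refine ⟨hmain.1.congr ?_, hmain.2.trans ?_⟩
    · filter_upwards [ae_restrict_mem measurableSet_uIoc] with τ hτ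
      exact (hbal τ (hsubI hτ)).2
    · refine intervalIntegral.integral_congr_ae (Eventually.of_forall fun τ hτ => ?_)
      exact (hbal τ (hsubI hτ)).2
  · intro τ hτ
    have := cU τ hτ
    have := cV τ hτ
    have := continuous_of_hasDerivAt (hw.d₀ τ hτ)
    simp only [hq, densityAt]
    fun_prop
  · intro τ hτ
    have := cU τ hτ
    have := cV τ hτ
    have := cUt τ hτ
    have := cVt τ hτ
    have := continuous_of_hasDerivAt (hw.d₀ τ hτ)
    have := hw.contt τ hτ
    simp only [hq', densityDeriv]
    fun_prop
  · intro τ hτ x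
    have h1 := abs_densityAt_le (A := A) (B := B) (u := mol ρ (u τ) x) (v := mol ρ (v τ) x)
      (hw.b₀ τ hτ x)
    have h2 := hSp τ hτ x
    have h3 : ‖mol ρ (u τ) x‖ ^ 2 + ‖mol ρ (v τ) x‖ ^ 2 ≤ 4 * (p * K) := by
      refine le_trans ?_ h2
      simp only [hS]
      nlinarith [sq_nonneg ‖Ut τ x‖, sq_nonneg ‖Vt τ x‖]
    have h4 : (|A| + |B|) * C ≤ a := by
      rw [ha]
      gcongr
      linarith
    calc |q τ x| ≤ _ := h1
      _ ≤ a * (4 * (p * K)) := mul_le_mul h4 h3 (by positivity) ha0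
      _ ≤ c := by rw [hcdef]; linarith [mul_nonneg ha0 hrK]
  · intro τ hτ x
    refine (habs' τ hτ x).trans ?_
    have := mul_le_mul_of_nonneg_left (hSp τ hτ x) ha0
    rw [hcdef]
    linarith [mul_nonneg ha0 hrK]
  · intro τ hτ
    refine (integral_mono (hbal τ hτ).1.abs ((hSint τ hτ).const_mul a) (habs' τ hτ)).trans ?_
    rw [integral_const_mul]
    have := mul_le_mul_of_nonneg_left (hSi τ hτ) ha0
    rw [hcdef]
    linarith [mul_nonneg ha0 hpK]

/-- The balance law for a weak evolution. The mollifier is removed in the integrated form by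
dominated convergence in time; the continuity of the flux then gives the derivative. -/
theorem WeakEvolution.hasDerivWithinAt_weightedDensity {T C K A B : ℝ} {u v N : ℝ → ℝ → ℂ}
    (h : WeakEvolution T u v N) {w w₁ w₂ w₃ wt : ℝ → ℝ → ℝ} (hw : IsWeight T C w w₁ w₂ w₃ wt)
    (uK : ∀ t ∈ Icc 0 T, ∫ x, ‖u t x‖ ^ 2 ≤ K) (vK : ∀ t ∈ Icc 0 T, ∫ x, ‖v t x‖ ^ 2 ≤ K)
    (NK : ∀ t ∈ Icc 0 T, ∫ x, ‖N t x‖ ^ 2 ≤ K)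
    (hcont : ContinuousOn (fun τ => weightedFlux A B (w τ) (w₁ τ) (w₃ τ) (wt τ) (u τ) (v τ) (N τ))
      (Icc 0 T)) {t : ℝ} (ht : t ∈ Icc 0 T) :
    HasDerivWithinAt (fun s => weightedDensity A B (w s) (u s) (v s))
      (weightedFlux A B (w t) (w₁ t) (w₃ t) (wt t) (u t) (v t) (N t)) (Icc 0 T) t := by
  have h0 : (0 : ℝ) ∈ Icc 0 T := ⟨le_rfl, ht.1.trans ht.2⟩
  have hC0 : 0 ≤ C := (abs_nonneg _).trans (hw.b₀ t ht 0)
  have lu : ∀ τ ∈ Icc 0 T, MemLp (u τ) 2 volume := fun τ hτ => (h.sobolev τ hτ).memLp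
  have lv : ∀ τ ∈ Icc 0 T, MemLp (v τ) 2 volume := fun τ hτ => (h.sobolev τ hτ).memLp_deriv
  have lN := h.memLp_force
  have m₀ : ∀ τ ∈ Icc 0 T, AEStronglyMeasurable (w τ) volume := fun τ hτ =>
    (continuous_of_hasDerivAt (hw.d₀ τ hτ)).aestronglyMeasurable
  have m₁ : ∀ τ ∈ Icc 0 T, AEStronglyMeasurable (w₁ τ) volume := fun τ hτ =>
    (continuous_of_hasDerivAt (hw.d₁ τ hτ)).aestronglyMeasurable
  have key : ∀ s ∈ Icc 0 T, weightedDensity A B (w s) (u s) (v s) =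
      weightedDensity A B (w 0) (u 0) (v 0) +
      ∫ τ in (0 : ℝ)..s, weightedFlux A B (w τ) (w₁ τ) (w₃ τ) (wt τ) (u τ) (v τ) (N τ) := by
    intro s hs
    have hsubI : uIoc 0 s ⊆ Icc 0 T := by
      rw [uIoc_of_le hs.1]
      exact fun r hr => ⟨hr.1.le, hr.2.trans hs.2⟩
    have hbal := fun n => h.mollified_balance (A := A) (B := B) hw uK vK NK (molKer_contDiff n)
      (molKer_compact n) hs
    have dens : ∀ τ ∈ Icc 0 T, Tendsto (fun n => weightedDensity A B (w τ)
        (mol (molKer n) (u τ)) (mol (molKer n) (v τ))) atTop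
        (𝓝 (weightedDensity A B (w τ) (u τ) (v τ))) := fun τ hτ =>
      tendsto_weightedDensity (fun n => memLp_molKer (lu τ hτ) n) (lu τ hτ)
        (fun n => memLp_molKer (lv τ hτ) n) (lv τ hτ) (tendsto_mol (lu τ hτ))
        (tendsto_mol (lv τ hτ)) (fun _ => m₀ τ hτ) (fun _ => hw.b₀ τ hτ)
        (Eventually.of_forall fun x => tendsto_const_nhds)
    have flux : ∀ τ ∈ Icc 0 T, Tendsto (fun n => weightedFlux A B (w τ) (w₁ τ) (w₃ τ) (wt τ)
        (mol (molKer n) (u τ)) (mol (molKer n) (v τ)) (mol (molKer n) (N τ))) atTop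
        (𝓝 (weightedFlux A B (w τ) (w₁ τ) (w₃ τ) (wt τ) (u τ) (v τ) (N τ))) := fun τ hτ =>
      tendsto_weightedFlux (fun n => memLp_molKer (lu τ hτ) n) (lu τ hτ)
        (fun n => memLp_molKer (lv τ hτ) n) (lv τ hτ) (fun n => memLp_molKer (lN τ hτ) n)
        (lN τ hτ) (tendsto_mol (lu τ hτ)) (tendsto_mol (lv τ hτ)) (tendsto_mol (lN τ hτ))
        (fun _ => m₀ τ hτ) (fun _ => hw.b₀ τ hτ) (Eventually.of_forall fun x => tendsto_const_nhds)
        (fun _ => m₁ τ hτ) (fun _ => hw.b₁ τ hτ) (Eventually.of_forall fun x => tendsto_const_nhds)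
        (fun _ => (hw.cont₃ τ hτ).aestronglyMeasurable) (fun _ => hw.b₃ τ hτ)
        (Eventually.of_forall fun x => tendsto_const_nhds)
        (fun _ => (hw.contt τ hτ).aestronglyMeasurable) (fun _ => hw.bt τ hτ)
        (Eventually.of_forall fun x => tendsto_const_nhds)
    have hRlim := intervalIntegral.tendsto_integral_filter_of_dominated_convergence
      (μ := volume) (a := 0) (b := s) (l := atTop)
      (fun _ => (|A| + |B|) * (7 * (C * K)))
      (Eventually.of_forall fun n => (hbal n).1)
      (Eventually.of_forall fun n => Eventually.of_forall fun τ hτ => by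
        have hτ' := hsubI hτ
        exact abs_weightedFlux_le hC0 (memLp_molKer (lu τ hτ') n) (memLp_molKer (lv τ hτ') n)
          (memLp_molKer (lN τ hτ') n) ((integral_mol_sq_le (lu τ hτ') n).trans (uK τ hτ'))
          ((integral_mol_sq_le (lv τ hτ') n).trans (vK τ hτ'))
          ((integral_mol_sq_le (lN τ hτ') n).trans (NK τ hτ'))
          (hw.b₀ τ hτ') (hw.b₁ τ hτ') (hw.b₃ τ hτ') (hw.bt τ hτ'))
      (by simp) (Eventually.of_forall fun τ hτ => flux τ (hsubI hτ))
    have hL := (dens s hs).sub (dens 0 h0)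
    have := tendsto_nhds_unique (hL.congr fun n => (hbal n).2) hRlim
    linarith
  -- this makes the fundamental theorem of calculus available within `Icc 0 T`, end points included
  have : Fact (t ∈ Icc 0 T) := ⟨ht⟩
  have hI : IntervalIntegrable (fun τ => weightedFlux A B (w τ) (w₁ τ) (w₃ τ) (wt τ) (u τ) (v τ)
      (N τ)) volume 0 t :=
    (hcont.mono (Icc_subset_Icc_right ht.2)).intervalIntegrable_of_Icc ht.1
  have hd := intervalIntegral.integral_hasDerivWithinAt_right hI (s := Icc 0 T) (t := Icc 0 T)
    (hcont.stronglyMeasurableAtFilter_nhdsWithin measurableSet_Icc t) (hcont t ht)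
  exact (hd.const_add (weightedDensity A B (w 0) (u 0) (v 0))).congr key (key t ht)

/-! ### Solutions of the equation -/

theorem IsSolution.tendsto_of_seq {σ T : ℝ} {u : ℝ → ℝ → ℂ} (hu : IsSolution σ T u) {t : ℝ}
    (ht : t ∈ Icc 0 T) {s : ℕ → ℝ} (hs : ∀ n, s n ∈ Icc 0 T) (hst : Tendsto s atTop (𝓝 t)) :
    Tendsto (fun n => h1Norm (fun x => u (s n) x - u t x)) atTop (𝓝 0) ∧
    Tendsto (fun n => ∫ x, ‖u (s n) x - u t x‖ ^ 2) atTop (𝓝 0) ∧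
    Tendsto (fun n => ∫ x, ‖weakDeriv (u (s n)) x - weakDeriv (u t) x‖ ^ 2) atTop (𝓝 0) := by
  have h1 : Tendsto (fun n => h1Norm (fun x => u (s n) x - u t x)) atTop (𝓝 0) :=
    (hu.continuous_h1 t ht).comp
      (tendsto_nhdsWithin_iff.2 ⟨hst, Eventually.of_forall hs⟩)
  have h2 : Tendsto (fun n => h1Norm (fun x => u (s n) x - u t x) ^ 2) atTop (𝓝 0) := by
    simpa using h1.pow 2
  have hp := fun n => (hu.memH1 (s n) (hs n)).sobolevPair.sub (hu.memH1 t ht).sobolevPair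
  refine ⟨h1, ?_, ?_⟩
  · exact squeeze_zero (fun n => integral_nonneg fun x => by positivity)
      (fun n => integral_sq_le_h1Norm_sq _) h2
  · exact squeeze_zero (fun n => integral_nonneg fun x => by positivity)
      (fun n => (hp n).integral_deriv_sq_le) h2

/-- Sequential continuity on a closed interval. -/
theorem continuousOn_Icc_of_seq {T : ℝ} {f : ℝ → ℝ}
    (h : ∀ t ∈ Icc 0 T, ∀ s : ℕ → ℝ, (∀ n, s n ∈ Icc 0 T) → Tendsto s atTop (𝓝 t) →
      Tendsto (fun n => f (s n)) atTop (𝓝 (f t))) : ContinuousOn f (Icc 0 T) := by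
  rw [continuousOn_iff_continuous_domRestrict, continuous_iff_seqContinuous]
  intro s t hst
  exact h t t.2 (fun n => s n) (fun n => (s n).2) ((continuous_subtype_val.tendsto _).comp hst)

/-- A solution is bounded in `H¹` on the compact time interval. -/
theorem IsSolution.exists_h1Norm_le {σ T : ℝ} {u : ℝ → ℝ → ℂ} (hu : IsSolution σ T u) :
    ∃ K, 0 ≤ K ∧ ∀ t ∈ Icc 0 T, h1Norm (u t) ≤ K := by
  have hc : ContinuousOn (fun t => (pair (fun _ => 1) (u t) (u t)).re +
      (pair (fun _ => 1) (weakDeriv (u t)) (weakDeriv (u t))).re) (Icc 0 T) := by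
    refine continuousOn_Icc_of_seq fun t ht s hs hst => ?_
    obtain ⟨-, h2, h3⟩ := hu.tendsto_of_seq ht hs hst
    have p1 := fun n => (hu.memH1 (s n) (hs n)).sobolevPair
    have p2 := (hu.memH1 t ht).sobolevPair
    have t1 := tendsto_pair (H := fun _ _ => 1) (h := fun _ => 1) (C := 1)
      (fun n => (p1 n).memLp) p2.memLp (fun n => (p1 n).memLp)
      p2.memLp h2 h2 (fun _ => aestronglyMeasurable_const) (by simp)
      (Eventually.of_forall fun x => tendsto_const_nhds)
    have t2 := tendsto_pair (H := fun _ _ => 1) (h := fun _ => 1) (C := 1)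
      (fun n => (p1 n).memLp_deriv) p2.memLp_deriv (fun n => (p1 n).memLp_deriv)
      p2.memLp_deriv h3 h3 (fun _ => aestronglyMeasurable_const) (by simp)
      (Eventually.of_forall fun x => tendsto_const_nhds)
    exact ((Complex.continuous_re.tendsto _).comp t1).add
      ((Complex.continuous_re.tendsto _).comp t2)
  obtain ⟨K, hK⟩ := isCompact_Icc.exists_bound_of_continuousOn hc
  have e : ∀ f : ℝ → ℂ, MemLp f 2 volume → (pair (fun _ => 1) f f).re = ∫ x, ‖f x‖ ^ 2 :=
    fun f hf => by
      have i := integrable_pair (h := fun _ => 1) (C := 1) aestronglyMeasurable_const (by simp)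
        hf hf
      have h1 : ∫ x, (((1 : ℝ) : ℂ) * (starRingEnd ℂ (f x) * f x)).re =
        (pair (fun _ => 1) f f).re := integral_re i
      rw [← h1]
      congr 1
      ext x
      rw [Complex.ofReal_one, one_mul, mul_comm, Complex.mul_conj, Complex.normSq_eq_norm_sq,
        Complex.ofReal_re]
  refine ⟨√K, Real.sqrt_nonneg _, fun t ht => Real.le_sqrt_of_sq_le ?_⟩
  have p := (hu.memH1 t ht).sobolevPair
  have := (le_abs_self _).trans (hK t ht)
  rwa [e _ p.memLp, e _ p.memLp_deriv, ← p.h1Norm_sq] at this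

/-- The localized conservation law for solutions of the derivative Schrödinger equation. -/
theorem IsSolution.hasDerivWithinAt_weightedDensity {σ T C A B : ℝ} (hσ : 1 ≤ σ)
    {u : ℝ → ℝ → ℂ} (hu : IsSolution σ T u)
    {w w₁ w₂ w₃ wt : ℝ → ℝ → ℝ} (hw : IsWeight T C w w₁ w₂ w₃ wt) {t : ℝ} (ht : t ∈ Icc 0 T) :
    HasDerivWithinAt (fun s => weightedDensity A B (w s) (u s) (weakDeriv (u s)))
      (weightedFlux A B (w t) (w₁ t) (w₃ t) (wt t) (u t) (weakDeriv (u t))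
        (nonlin σ (u t) (weakDeriv (u t)))) (Icc 0 T) t := by
  have hσ0 : 0 ≤ σ := by linarith
  obtain ⟨K, hK0, hK⟩ := hu.exists_h1Norm_le
  have p := fun τ hτ => (hu.memH1 τ hτ).sobolevPair
  have hsup : ∀ τ ∈ Icc 0 T, ∀ᵐ x, ‖u τ x‖ ≤ K := fun τ hτ => by
    filter_upwards [(p τ hτ).ae_norm_le] with x hx
    exact hx.trans (hK τ hτ)
  have hN := fun τ hτ => memLp_nonlin hσ0 (p τ hτ).memLp.1 (p τ hτ).memLp_deriv (hsup τ hτ)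
  have hev : WeakEvolution T u (fun τ => weakDeriv (u τ))
      (fun τ => nonlin σ (u τ) (weakDeriv (u τ))) :=
    ⟨p, fun τ hτ => (hN τ hτ).1, hu.equation⟩
  have hsq : ∀ τ ∈ Icc 0 T, h1Norm (u τ) ^ 2 ≤ K ^ 2 := fun τ hτ =>
    pow_le_pow_left₀ (h1Norm_nonneg _) (hK τ hτ) 2
  have hv : ∀ τ ∈ Icc 0 T, ∫ x, ‖weakDeriv (u τ) x‖ ^ 2 ≤ K ^ 2 := fun τ hτ =>
    (p τ hτ).integral_deriv_sq_le.trans (hsq τ hτ)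
  set K' := K ^ 2 + (K ^ (2 * σ)) ^ 2 * K ^ 2 with hK'
  have hle : K ^ 2 ≤ K' := by rw [hK']; linarith [show 0 ≤ (K ^ (2 * σ)) ^ 2 * K ^ 2 by positivity]
  have hle' : (K ^ (2 * σ)) ^ 2 * K ^ 2 ≤ K' := by rw [hK']; linarith [sq_nonneg K]
  refine hev.hasDerivWithinAt_weightedDensity (K := K') hw
    (fun τ hτ => ((integral_sq_le_h1Norm_sq _).trans (hsq τ hτ)).trans hle)
    (fun τ hτ => (hv τ hτ).trans hle)
    (fun τ hτ => ((hN τ hτ).2.trans (mul_le_mul_of_nonneg_left (hv τ hτ) (sq_nonneg _))).trans hle')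
    (continuousOn_Icc_of_seq fun τ hτ s hs hsτ => ?_) ht
  obtain ⟨h1, h2, h3⟩ := hu.tendsto_of_seq hτ hs hsτ
  have hseq : ∀ g : ℝ → ℝ → ℝ, (∀ x, ContinuousOn (fun r => g r x) (Icc 0 T)) →
      ∀ᵐ x, Tendsto (fun n => g (s n) x) atTop (𝓝 (g τ x)) := fun g hg =>
    Eventually.of_forall fun x => (hg x τ hτ).tendsto.comp
      (tendsto_nhdsWithin_iff.2 ⟨hsτ, Eventually.of_forall hs⟩)
  have hNl := tendsto_nonlin hσ (fun n => (p _ (hs n)).memLp.1) (p τ hτ).memLp.1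
    (fun n => (p _ (hs n)).memLp_deriv) (p τ hτ).memLp_deriv (fun n => hsup _ (hs n)) (hsup τ hτ)
    (fun n => ((p _ (hs n)).sub (p τ hτ)).ae_norm_le) h1 h3
  exact tendsto_weightedFlux (fun n => (p _ (hs n)).memLp) (p τ hτ).memLp
    (fun n => (p _ (hs n)).memLp_deriv) (p τ hτ).memLp_deriv (fun n => (hN _ (hs n)).1)
    (hN τ hτ).1 h2 h3 hNl
    (fun n => (continuous_of_hasDerivAt (hw.d₀ _ (hs n))).aestronglyMeasurable)
    (fun n => hw.b₀ _ (hs n)) (hseq w fun x r hr => (hw.dt r hr x).continuousWithinAt)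
    (fun n => (continuous_of_hasDerivAt (hw.d₁ _ (hs n))).aestronglyMeasurable)
    (fun n => hw.b₁ _ (hs n)) (hseq w₁ hw.time₁)
    (fun n => (hw.cont₃ _ (hs n)).aestronglyMeasurable)
    (fun n => hw.b₃ _ (hs n)) (hseq w₃ hw.time₃)
    (fun n => (hw.contt _ (hs n)).aestronglyMeasurable)
    (fun n => hw.bt _ (hs n)) (hseq wt hw.timet)

/-! ### Moving cutoffs -/

theorem IsCutoff.nonneg {φ : ℝ → ℝ} (h : IsCutoff φ) (x : ℝ) : 0 ≤ φ x := by
  rw [← h.eq_zero (min x (-1)) (min_le_right _ _)]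
  exact h.monotone (min_le_left _ _)

theorem IsCutoff.le_one {φ : ℝ → ℝ} (h : IsCutoff φ) (x : ℝ) : φ x ≤ 1 := by
  rw [← h.eq_one (max x 1) (le_max_right _ _)]
  exact h.monotone (le_max_left _ _)

theorem IsCutoff.deriv_nonneg {φ : ℝ → ℝ} (h : IsCutoff φ) (x : ℝ) : 0 ≤ deriv φ x :=
  h.monotone.deriv_nonneg

theorem IsCutoff.deriv_eq_zero {φ : ℝ → ℝ} (h : IsCutoff φ) {x : ℝ} (hx : x ≤ -1 ∨ 1 ≤ x) :
    deriv φ x = 0 := by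
  rcases hx with hx | hx
  · refine IsLocalMin.deriv_eq_zero (Eventually.of_forall fun y => ?_)
    rw [h.eq_zero x hx]
    exact h.nonneg y
  · refine IsLocalMax.deriv_eq_zero (Eventually.of_forall fun y => ?_)
    rw [h.eq_one x hx]
    exact h.le_one y

theorem IsCutoff.hasCompactSupport_deriv {φ : ℝ → ℝ} (h : IsCutoff φ) :
    HasCompactSupport (deriv φ) := by
  refine HasCompactSupport.intro (K := Icc (-1) 1) isCompact_Icc fun x hx => h.deriv_eq_zero ?_
  rw [mem_Icc, not_and_or, not_le, not_le] at hx
  exact hx.imp le_of_lt le_of_lt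

theorem IsCutoff.contDiff_deriv {φ : ℝ → ℝ} (h : IsCutoff φ) : ContDiff ℝ 2 (deriv φ) :=
  ContDiff.deriv' (n := 2) (by simpa [show (2 : WithTop ℕ∞) + 1 = 3 by norm_num] using h.contDiff)

theorem IsCutoff.contDiff_deriv₂ {φ : ℝ → ℝ} (h : IsCutoff φ) :
    ContDiff ℝ 1 (deriv (deriv φ)) :=
  ContDiff.deriv' (n := 1)
    (by simpa [show (1 : WithTop ℕ∞) + 1 = 2 by norm_num] using h.contDiff_deriv)

theorem IsCutoff.continuous_deriv₃ {φ : ℝ → ℝ} (h : IsCutoff φ) :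
    Continuous (deriv (deriv (deriv φ))) := h.contDiff_deriv₂.continuous_deriv le_rfl

theorem IsCutoff.hasDerivAt {φ : ℝ → ℝ} (h : IsCutoff φ) (x : ℝ) :
    HasDerivAt φ (deriv φ x) x :=
  (h.contDiff.differentiable (by norm_num) x).hasDerivAt

theorem IsCutoff.hasDerivAt_deriv {φ : ℝ → ℝ} (h : IsCutoff φ) (x : ℝ) :
    HasDerivAt (deriv φ) (deriv (deriv φ) x) x :=
  (h.contDiff_deriv.differentiable (by norm_num) x).hasDerivAt

theorem IsCutoff.hasDerivAt_deriv₂ {φ : ℝ → ℝ} (h : IsCutoff φ) (x : ℝ) :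
    HasDerivAt (deriv (deriv φ)) (deriv (deriv (deriv φ)) x) x :=
  (h.contDiff_deriv₂.differentiable (by norm_num) x).hasDerivAt

theorem IsCutoff.deriv₃_eq_zero {φ : ℝ → ℝ} (h : IsCutoff φ) {x : ℝ} (hx : 1 < |x|) :
    deriv (deriv (deriv φ)) x = 0 := by
  have hev : deriv φ =ᶠ[𝓝 x] fun _ => 0 := by
    filter_upwards [(isOpen_lt continuous_const continuous_abs).mem_nhds hx] with y hy
    rcases lt_abs.1 hy with h1 | h1
    · exact h.deriv_eq_zero (Or.inr h1.le)
    · exact h.deriv_eq_zero (Or.inl (by linarith))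
  have h2 : deriv (deriv φ) =ᶠ[𝓝 x] fun _ => 0 := by
    refine hev.deriv.trans (Eventually.of_forall fun y => ?_)
    simp
  rw [h2.deriv_eq]
  simp

theorem IsCutoff.exists_deriv_bound {φ : ℝ → ℝ} (h : IsCutoff φ) :
    ∃ M, 1 ≤ M ∧ (∀ x, |deriv φ x| ≤ M) ∧ (∀ x, |deriv (deriv φ) x| ≤ M) ∧
      ∀ x, |deriv (deriv (deriv φ)) x| ≤ M := by
  have hc := h.hasCompactSupport_deriv
  obtain ⟨M₁, h1⟩ := h.contDiff_deriv.continuous.bounded_above_of_compact_support hc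
  obtain ⟨M₂, h2⟩ := h.contDiff_deriv₂.continuous.bounded_above_of_compact_support hc.deriv
  obtain ⟨M₃, h3⟩ := h.continuous_deriv₃.bounded_above_of_compact_support hc.deriv.deriv
  refine ⟨max 1 (max M₁ (max M₂ M₃)), le_max_left _ _, fun x => ?_, fun x => ?_, fun x => ?_⟩
  · exact (h1 x).trans (by simp)
  · exact (h2 x).trans (by simp)
  · exact (h3 x).trans (by simp)

/-- The cutoff along the line `X + ν t`, of width `s t`, is an admissible weight. -/
theorem IsCutoff.isWeight {φ : ℝ → ℝ} (h : IsCutoff φ) {T X ν s₀ b : ℝ} {s s' : ℝ → ℝ}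
    (hs : ∀ t ∈ Icc 0 T, HasDerivWithinAt s (s' t) (Icc 0 T) t) (hs' : ContinuousOn s' (Icc 0 T))
    (h0 : 0 < s₀) (hs₀ : ∀ t ∈ Icc 0 T, s₀ ≤ s t) (hb : ∀ t ∈ Icc 0 T, |s' t| ≤ b) :
    ∃ C, IsWeight T C (fun t x => φ ((x - X - ν * t) / s t))
      (fun t x => deriv φ ((x - X - ν * t) / s t) / s t)
      (fun t x => deriv (deriv φ) ((x - X - ν * t) / s t) / s t ^ 2)
      (fun t x => deriv (deriv (deriv φ)) ((x - X - ν * t) / s t) / s t ^ 3)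
      (fun t x => -(deriv φ ((x - X - ν * t) / s t)) *
        (ν + (x - X - ν * t) / s t * s' t) / s t) := by
  obtain ⟨M, hM1, m1, m2, m3⟩ := h.exists_deriv_bound
  have hpos : ∀ t ∈ Icc 0 T, 0 < s t := fun t ht => h0.trans_le (hs₀ t ht)
  have hy : ∀ t ∈ Icc 0 T, ∀ x, HasDerivAt (fun x => (x - X - ν * t) / s t) (1 / s t) x :=
    fun t _ x => (((hasDerivAt_id x).sub_const X).sub_const (ν * t)).div_const (s t)
  have hct : ∀ x, ContinuousOn (fun t => (x - X - ν * t) / s t) (Icc 0 T) := fun x =>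
    ContinuousOn.div (by fun_prop) (fun t ht => (hs t ht).continuousWithinAt)
      fun t ht => (hpos t ht).ne'
  have hsc : ContinuousOn s (Icc 0 T) := fun t ht => (hs t ht).continuousWithinAt
  have hdiv : ∀ (n : ℕ) (r : ℝ), |r| ≤ M → ∀ t ∈ Icc 0 T, |r / s t ^ n| ≤ M / s₀ ^ n :=
    fun n r hr t ht => by
      rw [abs_div, abs_of_pos (pow_pos (hpos t ht) n)]
      have := hs₀ t ht
      gcongr
  refine ⟨1 + M / s₀ ^ 1 + M / s₀ ^ 2 + M / s₀ ^ 3 + M * (|ν| + |b|) / s₀, ?_⟩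
  have hM0 : 0 ≤ M := by linarith
  have p1 : 0 ≤ M / s₀ ^ 1 := by positivity
  have p2 : 0 ≤ M / s₀ ^ 2 := by positivity
  have p3 : 0 ≤ M / s₀ ^ 3 := by positivity
  have p4 : 0 ≤ M * (|ν| + |b|) / s₀ := by positivity
  constructor
  · intro t ht x
    exact ((h.hasDerivAt _).comp x (hy t ht x)).congr_deriv (by rw [mul_one_div])
  · intro t ht x
    refine (((h.hasDerivAt_deriv _).comp x (hy t ht x)).div_const (s t)).congr_deriv ?_
    have := (hpos t ht).ne'
    field_simp
  · intro t ht x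
    refine (((h.hasDerivAt_deriv₂ _).comp x (hy t ht x)).div_const (s t ^ 2)).congr_deriv ?_
    have := (hpos t ht).ne'
    field_simp
  · intro t ht x
    have d1 : HasDerivWithinAt (fun t => (x - X - ν * t) / s t)
        ((-ν * s t - (x - X - ν * t) * s' t) / s t ^ 2) (Icc 0 T) t := by
      have e : HasDerivWithinAt (fun t => x - X - ν * t) (-ν) (Icc 0 T) t := by
        simpa using (((hasDerivAt_id t).const_mul ν).const_sub (x - X)).hasDerivWithinAt
      exact e.div (hs t ht) (hpos t ht).ne'
    refine ((h.hasDerivAt _).comp_hasDerivWithinAt t d1).congr_deriv ?_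
    have := (hpos t ht).ne'
    field_simp
    ring
  · intro t ht
    have := h.continuous_deriv₃
    fun_prop
  · intro t ht
    have := h.contDiff_deriv.continuous
    fun_prop
  · intro x
    exact (h.contDiff_deriv.continuous.comp_continuousOn (hct x)).div hsc
      fun t ht => (hpos t ht).ne'
  · intro x
    exact (h.continuous_deriv₃.comp_continuousOn (hct x)).div (hsc.pow 3)
      fun t ht => (pow_pos (hpos t ht) 3).ne'
  · intro x
    exact (((h.contDiff_deriv.continuous.comp_continuousOn (hct x)).neg).mul
      (continuousOn_const.add ((hct x).mul hs'))).div hsc fun t ht => (hpos t ht).ne'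
  · intro t ht x
    rw [abs_of_nonneg (h.nonneg _)]
    linarith [h.le_one ((x - X - ν * t) / s t)]
  · intro t ht x
    have := hdiv 1 _ (m1 ((x - X - ν * t) / s t)) t ht
    rw [pow_one] at this
    linarith
  · intro t ht x
    linarith [hdiv 2 _ (m2 ((x - X - ν * t) / s t)) t ht]
  · intro t ht x
    linarith [hdiv 3 _ (m3 ((x - X - ν * t) / s t)) t ht]
  · intro t ht x
    set y := (x - X - ν * t) / s t with hydef
    have h1 : |deriv φ y * (ν + y * s' t)| ≤ M * (|ν| + |b|) := by
      by_cases hy1 : |y| ≤ 1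
      · rw [abs_mul]
        refine mul_le_mul (m1 y) ((abs_add_le _ _).trans (add_le_add le_rfl ?_)) (abs_nonneg _) hM0
        rw [abs_mul]
        calc |y| * |s' t| ≤ 1 * |b| := by
              have := (hb t ht).trans (le_abs_self b)
              gcongr
          _ = |b| := one_mul _
      · rw [h.deriv_eq_zero]
        · simp only [zero_mul, abs_zero]
          positivity
        · rcases lt_abs.1 (not_le.1 hy1) with h2 | h2
          · exact Or.inr h2.le
          · exact Or.inl (by linarith)
    have h2 : |(-deriv φ y) * (ν + y * s' t) / s t| ≤ M * (|ν| + |b|) / s₀ := by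
      rw [abs_div, abs_of_pos (hpos t ht), neg_mul, abs_neg]
      have := hs₀ t ht
      gcongr
    linarith

/-- A cutoff of constant width. In the time derivative the rate of change of the width is `0`. -/
theorem IsCutoff.isWeight_const {φ : ℝ → ℝ} (h : IsCutoff φ) (T X ν : ℝ) {W : ℝ} (hW : 0 < W) :
    ∃ C, IsWeight T C (fun t x => φ ((x - X - ν * t) / W))
      (fun t x => deriv φ ((x - X - ν * t) / W) / W)
      (fun t x => deriv (deriv φ) ((x - X - ν * t) / W) / W ^ 2)
      (fun t x => deriv (deriv (deriv φ)) ((x - X - ν * t) / W) / W ^ 3)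
      (fun t x => -(deriv φ ((x - X - ν * t) / W)) *
        (ν + (x - X - ν * t) / W * 0) / W) :=
  h.isWeight (s := fun _ => W) (s' := fun _ => 0) (fun t _ => hasDerivWithinAt_const _ _ _)
    continuousOn_const hW (fun _ _ => le_rfl) (b := 0) (fun _ _ => by simp)

theorem IsCutoff.isWeight_sqrt {φ : ℝ → ℝ} (h : IsCutoff φ) (T X ν : ℝ) {a : ℝ} (ha : 0 < a) :
    ∃ C, IsWeight T C (fun t x => φ ((x - X - ν * t) / √(t + a)))
      (fun t x => deriv φ ((x - X - ν * t) / √(t + a)) / √(t + a))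
      (fun t x => deriv (deriv φ) ((x - X - ν * t) / √(t + a)) / √(t + a) ^ 2)
      (fun t x => deriv (deriv (deriv φ)) ((x - X - ν * t) / √(t + a)) / √(t + a) ^ 3)
      (fun t x => -(deriv φ ((x - X - ν * t) / √(t + a))) *
        (ν + (x - X - ν * t) / √(t + a) * (1 / (2 * √(t + a)))) / √(t + a)) := by
  have hpos : ∀ t ∈ Icc 0 T, 0 < t + a := fun t ht => by linarith [ht.1]
  have hle : ∀ t ∈ Icc 0 T, √a ≤ √(t + a) := fun t ht => Real.sqrt_le_sqrt (by linarith [ht.1])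
  have h0 : 0 < √a := Real.sqrt_pos.2 ha
  refine h.isWeight (s := fun t => √(t + a)) (s' := fun t => 1 / (2 * √(t + a)))
    (fun t ht => ?_) ?_ h0 hle (b := 1 / (2 * √a)) (fun t ht => ?_)
  · exact (((hasDerivAt_id t).add_const a).sqrt (hpos t ht).ne').hasDerivWithinAt
  · refine continuousOn_const.div (by fun_prop) fun t ht => ?_
    have := Real.sqrt_pos.2 (hpos t ht)
    positivity
  · have := hle t ht
    rw [abs_of_nonneg (by positivity)]
    gcongr

/-- The localized functional is the weighted density for the moving cutoff of width `√(t + a)`. -/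
theorem locFunctional_eq {φ : ℝ → ℝ} (h : IsCutoff φ) {a X A B ν t : ℝ} {u : ℝ → ℝ → ℂ}
    (hu : MemH1 (u t)) :
    locFunctional φ a X u A B ν t =
      weightedDensity A B (fun x => φ ((x - X - ν * t) / √(t + a))) (u t) (weakDeriv (u t)) := by
  have hm : AEStronglyMeasurable (fun x => φ ((x - X - ν * t) / √(t + a))) volume := by
    have := h.contDiff.continuous
    exact Continuous.aestronglyMeasurable (by fun_prop)
  have hb : ∀ x, |φ ((x - X - ν * t) / √(t + a))| ≤ 1 := fun x => by
    rw [abs_of_nonneg (h.nonneg _)]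
    exact h.le_one _
  have hp := hu.sobolevPair
  have i1 := integrable_pair hm hb hp.memLp hp.memLp
  have e1 : (pair (fun x => φ ((x - X - ν * t) / √(t + a))) (u t) (u t)).re =
      ∫ x, ‖u t x‖ ^ 2 * φ ((x - X - ν * t) / √(t + a)) := by
    rw [pair]
    refine (integral_re i1).symm.trans (integral_congr_ae (Eventually.of_forall fun x => ?_))
    simp only [RCLike.re_to_complex]
    rw [Complex.re_ofReal_mul, mul_comm (starRingEnd ℂ (u t x)), Complex.mul_conj,
      Complex.normSq_eq_norm_sq, Complex.ofReal_re, mul_comm]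
  rw [locFunctional, weightedDensity, e1, pair]
  simp only [mul_comm (starRingEnd ℂ (u t _) * weakDeriv (u t) _)]

/-! ### The flux as a single integral -/

/-- The pointwise flux of the weighted mass and momentum at a value `z` with space derivative `z'`;
`w₁`, `w₃`, `wt` are the values of the derivatives of the weight. -/
def fluxAt (σ A B w₁ w₃ wt : ℝ) (z z' : ℂ) : ℝ :=
  A * (w₁ * (2 * (starRingEnd ℂ z * z').im + ‖z‖ ^ (2 * σ) * ‖z‖ ^ 2 / (σ + 1)) + wt * ‖z‖ ^ 2)
    - B * (2 * w₁ * ‖z'‖ ^ 2 - 1 / 2 * w₃ * ‖z‖ ^ 2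
      + w₁ * (‖z‖ ^ (2 * σ) * (starRingEnd ℂ z * z').im) + wt * (starRingEnd ℂ z * z').im)

theorem re_conj_mul_self (z : ℂ) : (starRingEnd ℂ z * z).re = ‖z‖ ^ 2 := by
  rw [mul_comm, Complex.mul_conj, Complex.normSq_eq_norm_sq, Complex.ofReal_re]

theorem im_conj_mul_self (z : ℂ) : (starRingEnd ℂ z * z).im = 0 := by
  rw [mul_comm, Complex.mul_conj, Complex.ofReal_im]

/-- For the nonlinearity `|u|^{2σ} u_x` the flux is the integral of `fluxAt`: the mass term `Re (ū
|u|^{2σ} u_x)` is an exact derivative, and `Im (ū_x |u|^{2σ} u_x)` vanishes. -/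
theorem SobolevPair.weightedFlux_eq {σ A B C : ℝ} (hσ : 1 ≤ σ) {u v : ℝ → ℂ}
    (h : SobolevPair u v) {w w₁ w₃ wt : ℝ → ℝ} (d₀ : ∀ x, HasDerivAt w (w₁ x) x)
    (c₁ : Continuous w₁) (m₃ : AEStronglyMeasurable w₃ volume)
    (mt : AEStronglyMeasurable wt volume) (b₀ : ∀ x, |w x| ≤ C) (b₁ : ∀ x, |w₁ x| ≤ C)
    (b₃ : ∀ x, |w₃ x| ≤ C) (bt : ∀ x, |wt x| ≤ C) :
    Integrable (fun x => fluxAt σ A B (w₁ x) (w₃ x) (wt x) (u x) (v x)) ∧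
    weightedFlux A B w w₁ w₃ wt u v (nonlin σ u v) =
      ∫ x, fluxAt σ A B (w₁ x) (w₃ x) (wt x) (u x) (v x) := by
  have hσ0 : 0 ≤ σ := by linarith
  have m₀ : AEStronglyMeasurable w volume := (continuous_of_hasDerivAt d₀).aestronglyMeasurable
  have m₁ : AEStronglyMeasurable w₁ volume := c₁.aestronglyMeasurable
  have lU := h.memLp
  have lV := h.memLp_deriv
  have lN := (memLp_nonlin hσ0 lU.1 lV h.ae_norm_le).1
  have lN' := (memLp_nonlin hσ0 lU.1 lU h.ae_norm_le).1
  have hIBP := h.re_pair_nonlin hσ d₀ c₁ b₀ b₁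
  have e1 : pair (fun x => ‖u x‖ ^ (2 * σ) * w₁ x) u u = pair w₁ u (nonlin σ u u) := by
    simp only [pair, nonlin]
    congr 1
    ext x
    push_cast
    ring
  have e2 : (pair w v (nonlin σ u v)).im = 0 := by
    have i := integrable_pair m₀ b₀ lV lN
    rw [pair]
    refine (integral_im i).symm.trans (integral_eq_zero_of_ae (Eventually.of_forall fun x => ?_))
    simp only [RCLike.im_to_complex, nonlin, Pi.zero_apply]
    rw [show starRingEnd ℂ (v x) * (((‖u x‖ ^ (2 * σ) : ℝ) : ℂ) * v x) =
      ((‖u x‖ ^ (2 * σ) : ℝ) : ℂ) * (starRingEnd ℂ (v x) * v x) by ring,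
      Complex.im_ofReal_mul, Complex.im_ofReal_mul, im_conj_mul_self]
    simp
  rw [e1] at hIBP
  have re : ∀ {f : ℝ → ℂ}, Integrable f → Integrable (fun x => (f x).re) := fun h => h.re
  have im : ∀ {f : ℝ → ℂ}, Integrable f → Integrable (fun x => (f x).im) := fun h => h.im
  have ere : ∀ {f : ℝ → ℂ}, Integrable f → ∫ x, (f x).re = (∫ x, f x).re :=
    fun hf => integral_re hf
  have eim : ∀ {f : ℝ → ℂ}, Integrable f → ∫ x, (f x).im = (∫ x, f x).im :=
    fun hf => integral_im hf
  have i1 := integrable_pair m₁ b₁ lU lV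
  have i2 := integrable_pair m₁ b₁ lU lN'
  have i3 := integrable_pair mt bt lU lU
  have i4 := integrable_pair m₁ b₁ lV lV
  have i5 := integrable_pair m₃ b₃ lU lU
  have i7 := integrable_pair m₁ b₁ lU lN
  have i8 := integrable_pair mt bt lU lV
  have k1 := (im i1).const_mul 2
  have k2 := (re i2).const_mul (1 / (σ + 1))
  have k3 := re i3
  have k4 := (re i4).const_mul 2
  have k5 := (re i5).const_mul (1 / 2)
  have k7 := im i7
  have k8 := im i8
  have kA := ((k1.add k2).add k3).const_mul A
  have kB := (((k4.sub k5).add k7).add k8).const_mul B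
  have hflux := integral_sub kA kB
  rw [integral_const_mul, integral_const_mul, integral_add' (k1.add k2) k3, integral_add' k1 k2,
    integral_add' ((k4.sub k5).add k7) k8, integral_add' (k4.sub k5) k7,
    integral_sub' k4 k5, integral_const_mul, integral_const_mul,
    integral_const_mul, integral_const_mul, eim i1, ere i2, ere i3, ere i4,
    ere i5, eim i7, eim i8] at hflux
  have hpt : ∀ x, fluxAt σ A B (w₁ x) (w₃ x) (wt x) (u x) (v x) =
      A * (2 * (((w₁ x : ℝ) : ℂ) * (starRingEnd ℂ (u x) * v x)).im
          + 1 / (σ + 1) * (((w₁ x : ℝ) : ℂ) * (starRingEnd ℂ (u x) * nonlin σ u u x)).re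
          + (((wt x : ℝ) : ℂ) * (starRingEnd ℂ (u x) * u x)).re)
        - B * (2 * (((w₁ x : ℝ) : ℂ) * (starRingEnd ℂ (v x) * v x)).re
          - 1 / 2 * (((w₃ x : ℝ) : ℂ) * (starRingEnd ℂ (u x) * u x)).re
          + (((w₁ x : ℝ) : ℂ) * (starRingEnd ℂ (u x) * nonlin σ u v x)).im
          + (((wt x : ℝ) : ℂ) * (starRingEnd ℂ (u x) * v x)).im) := fun x => by
    have n1 : ∀ z : ℂ, starRingEnd ℂ (u x) * (((‖u x‖ ^ (2 * σ) : ℝ) : ℂ) * z) =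
        ((‖u x‖ ^ (2 * σ) : ℝ) : ℂ) * (starRingEnd ℂ (u x) * z) := fun z => by ring
    simp only [fluxAt, nonlin, n1, Complex.re_ofReal_mul, Complex.im_ofReal_mul, re_conj_mul_self]
    ring
  have hpt' : (fun x => fluxAt σ A B (w₁ x) (w₃ x) (wt x) (u x) (v x)) = _ := funext hpt
  rw [hpt']
  refine ⟨kA.sub kB, ?_⟩
  refine Eq.trans ?_ hflux.symm
  rw [weightedFlux, e2]
  simp only [pair] at hIBP ⊢
  linear_combination (-A) * hIBP

/-! ### Solitary waves -/

section Profile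

variable {σ ω c : ℝ}

theorem abs_speed_lt_one (hω : 0 < ω) (hc : c ^ 2 < 4 * ω) : |c / (2 * √ω)| < 1 := by
  have h1 : 0 < √ω := Real.sqrt_pos.2 hω
  rw [abs_div, abs_of_pos (show 0 < 2 * √ω by positivity), div_lt_one (by positivity)]
  refine abs_lt_of_sq_lt_sq ?_ (by positivity)
  rw [mul_pow, Real.sq_sqrt hω.le]
  linarith

theorem cosh_sub_ge (z s : ℝ) : (1 - |z|) * Real.cosh s ≤ Real.cosh s - z := by
  nlinarith [Real.one_le_cosh s, abs_nonneg z, le_abs_self z]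

theorem exp_abs_le_two_cosh (s : ℝ) : Real.exp |s| ≤ 2 * Real.cosh s := by
  rw [← Real.cosh_abs, Real.cosh_eq]
  linarith [Real.exp_pos (-|s|)]

/-- The power `Φ_{ω,c}^{2σ}` of the profile. -/
def profilePow (σ ω c x : ℝ) : ℝ :=
  (σ + 1) * (4 * ω - c ^ 2) /
      (2 * √ω * (Real.cosh (σ * √(4 * ω - c ^ 2) * x) - c / (2 * √ω)))

/-- An upper bound for `Φ_{ω,c}^{2σ}`, continuous in the parameters. -/
def profileBound (σ ω c : ℝ) : ℝ :=
  (σ + 1) * (4 * ω - c ^ 2) / (√ω * (1 - |c / (2 * √ω)|))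

theorem cosh_sub_pos (hω : 0 < ω) (hc : c ^ 2 < 4 * ω) (s : ℝ) :
    0 < Real.cosh s - c / (2 * √ω) :=
  lt_of_lt_of_le (mul_pos (by linarith [abs_speed_lt_one hω hc]) (Real.cosh_pos s))
    (cosh_sub_ge _ s)

theorem profilePow_pos (hσ : 0 < σ) (hω : 0 < ω) (hc : c ^ 2 < 4 * ω) (x : ℝ) :
    0 < profilePow σ ω c x := by
  have h1 : 0 < √ω := Real.sqrt_pos.2 hω
  have h2 := cosh_sub_pos hω hc (σ * √(4 * ω - c ^ 2) * x)
  have h3 : 0 < 4 * ω - c ^ 2 := by linarith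
  unfold profilePow
  positivity

theorem profileBound_pos (hσ : 0 < σ) (hω : 0 < ω) (hc : c ^ 2 < 4 * ω) :
    0 < profileBound σ ω c := by
  have h1 : 0 < √ω := Real.sqrt_pos.2 hω
  have h2 := abs_speed_lt_one hω hc
  have h3 : 0 < 4 * ω - c ^ 2 := by linarith
  have h4 : 0 < 1 - |c / (2 * √ω)| := by linarith
  unfold profileBound
  positivity

theorem profile_eq (x : ℝ) : profile σ ω c x = profilePow σ ω c x ^ (1 / (2 * σ)) := rfl

theorem profile_pos (hσ : 0 < σ) (hω : 0 < ω) (hc : c ^ 2 < 4 * ω) (x : ℝ) :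
    0 < profile σ ω c x := Real.rpow_pos_of_pos (profilePow_pos hσ hω hc x) _

theorem profile_rpow (hσ : 0 < σ) (hω : 0 < ω) (hc : c ^ 2 < 4 * ω) (x : ℝ) :
    profile σ ω c x ^ (2 * σ) = profilePow σ ω c x := by
  rw [profile_eq, ← Real.rpow_mul (profilePow_pos hσ hω hc x).le,
    one_div_mul_cancel (by positivity), Real.rpow_one]

theorem profilePow_le (hσ : 0 < σ) (hω : 0 < ω) (hc : c ^ 2 < 4 * ω) (x : ℝ) :
    profilePow σ ω c x ≤ profileBound σ ω c * Real.exp (-(σ * √(4 * ω - c ^ 2) * |x|)) := by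
  have h1 : 0 < √ω := Real.sqrt_pos.2 hω
  have h2 := abs_speed_lt_one hω hc
  have h3 : 0 < 4 * ω - c ^ 2 := by linarith
  have h4 : 0 < 1 - |c / (2 * √ω)| := by linarith
  set s := σ * √(4 * ω - c ^ 2) * x with hs
  have h5 : |s| = σ * √(4 * ω - c ^ 2) * |x| := by
    rw [hs, abs_mul, abs_of_nonneg (by positivity)]
  have h6 : (1 - |c / (2 * √ω)|) * (Real.exp |s| / 2) ≤ Real.cosh s - c / (2 * √ω) := by
    refine le_trans ?_ (cosh_sub_ge _ s)
    have := exp_abs_le_two_cosh s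
    refine mul_le_mul_of_nonneg_left ?_ h4.le
    linarith
  rw [← h5, Real.exp_neg, profilePow, profileBound, ← div_eq_mul_inv, div_div]
  refine div_le_div_of_nonneg_left (by positivity) (by positivity) ?_
  nlinarith

theorem profile_le (hσ : 0 < σ) (hω : 0 < ω) (hc : c ^ 2 < 4 * ω) (x : ℝ) :
    profile σ ω c x ≤ profileBound σ ω c ^ (1 / (2 * σ)) *
      Real.exp (-(√(4 * ω - c ^ 2) / 2 * |x|)) := by
  have h := Real.rpow_le_rpow (profilePow_pos hσ hω hc x).le (profilePow_le hσ hω hc x)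
    (show 0 ≤ 1 / (2 * σ) by positivity)
  rw [Real.mul_rpow (profileBound_pos hσ hω hc).le (Real.exp_pos _).le, ← Real.exp_mul] at h
  refine h.trans (le_of_eq ?_)
  congr 2
  field_simp

/-- The space derivative of the profile. -/
def profileDeriv (σ ω c x : ℝ) : ℝ :=
  -(√(4 * ω - c ^ 2) / 2) * profile σ ω c x *
    (Real.sinh (σ * √(4 * ω - c ^ 2) * x) /
      (Real.cosh (σ * √(4 * ω - c ^ 2) * x) - c / (2 * √ω)))

theorem continuous_profilePow (hω : 0 < ω) (hc : c ^ 2 < 4 * ω) :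
    Continuous (profilePow σ ω c) := by
  have h1 : 0 < √ω := Real.sqrt_pos.2 hω
  unfold profilePow
  refine Continuous.div (by fun_prop) (by fun_prop) fun x => ?_
  have h2 := cosh_sub_pos hω hc (σ * √(4 * ω - c ^ 2) * x)
  positivity

theorem hasDerivAt_profile (hσ : 0 < σ) (hω : 0 < ω) (hc : c ^ 2 < 4 * ω) (x : ℝ) :
    HasDerivAt (profile σ ω c) (profileDeriv σ ω c x) x := by
  have h1 : 0 < √ω := Real.sqrt_pos.2 hω
  set κ := √(4 * ω - c ^ 2) with hκ
  have h2 := cosh_sub_pos hω hc (σ * κ * x)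
  have hp := profilePow_pos hσ hω hc x
  have d1 : HasDerivAt (fun x => Real.cosh (σ * κ * x)) (Real.sinh (σ * κ * x) * (σ * κ)) x := by
    simpa using ((hasDerivAt_id x).const_mul (σ * κ)).cosh
  have d2 := (d1.sub_const (c / (2 * √ω))).const_mul (2 * √ω)
  have d3 := (hasDerivAt_const x ((σ + 1) * (4 * ω - c ^ 2))).div d2 (by positivity)
  have d4 : HasDerivAt (profilePow σ ω c)
      (-(profilePow σ ω c x) * (σ * κ) * (Real.sinh (σ * κ * x) /
        (Real.cosh (σ * κ * x) - c / (2 * √ω)))) x := by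
    refine d3.congr_deriv ?_
    rw [profilePow, ← hκ]
    generalize Real.cosh (σ * κ * x) - c / (2 * √ω) = D at h2 ⊢
    field_simp
    ring
  refine (d4.rpow_const (p := 1 / (2 * σ)) (Or.inl hp.ne')).congr_deriv ?_
  rw [profileDeriv, profile_eq, ← hκ, Real.rpow_sub_one hp.ne']
  generalize Real.sinh (σ * κ * x) / (Real.cosh (σ * κ * x) - c / (2 * √ω)) = q
  field_simp

theorem abs_profileDeriv_le (hσ : 0 < σ) (hω : 0 < ω) (hc : c ^ 2 < 4 * ω) (x : ℝ) :
    |profileDeriv σ ω c x| ≤ √(4 * ω - c ^ 2) / 2 / (1 - |c / (2 * √ω)|) * profile σ ω c x := by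
  have hp := (profile_pos hσ hω hc x).le
  have h4 : 0 < 1 - |c / (2 * √ω)| := by linarith [abs_speed_lt_one hω hc]
  rw [profileDeriv, abs_mul, abs_mul, abs_neg, abs_of_nonneg hp,
    abs_of_nonneg (show 0 ≤ √(4 * ω - c ^ 2) / 2 by positivity)]
  set s := σ * √(4 * ω - c ^ 2) * x
  have h2 := cosh_sub_pos hω hc s
  have h5 : |Real.sinh s / (Real.cosh s - c / (2 * √ω))| ≤ 1 / (1 - |c / (2 * √ω)|) := by
    rw [abs_div, abs_of_pos h2, div_le_div_iff₀ h2 h4]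
    have h6 : |Real.sinh s| ≤ Real.cosh s := by
      rw [abs_le]
      constructor <;> rw [Real.sinh_eq, Real.cosh_eq] <;>
        linarith [Real.exp_pos s, Real.exp_pos (-s)]
    have := cosh_sub_ge (c / (2 * √ω)) s
    nlinarith
  calc √(4 * ω - c ^ 2) / 2 * profile σ ω c x * _
      ≤ √(4 * ω - c ^ 2) / 2 * profile σ ω c x * (1 / (1 - |c / (2 * √ω)|)) := by gcongr
    _ = _ := by ring

theorem integrable_exp_neg_abs {b : ℝ} (hb : 0 < b) (X : ℝ) :
    Integrable (fun x => Real.exp (-(b * |x - X|))) ∧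
      ∫ x, Real.exp (-(b * |x - X|)) = 2 / b := by
  have h0 : Integrable (fun x : ℝ => Real.exp (-(b * |x|))) ∧
      ∫ x : ℝ, Real.exp (-(b * |x|)) = 2 / b := by
    have h1 : ∫ x : ℝ, Real.exp (-(b * |x|)) = 2 / b := by
      rw [integral_comp_abs (f := fun x => Real.exp (-(b * x)))]
      have := integral_exp_mul_Ioi (neg_lt_zero.2 hb) 0
      simp only [neg_mul, mul_zero, Real.exp_zero] at this
      rw [this]
      ring
    refine ⟨?_, h1⟩
    -- a function with nonzero Bochner integral is integrable
    by_contra hn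
    rw [integral_undef hn] at h1
    have : 0 < 2 / b := by positivity
    linarith
  refine ⟨h0.1.comp_sub_right X, ?_⟩
  rw [← h0.2]
  exact integral_sub_right_eq_self (fun x => Real.exp (-(b * |x|))) X

/-- The phase of the solitary wave. -/
def phase (σ ω c x : ℝ) : ℝ :=
  c / 2 * x - 1 / (2 * σ + 2) * ∫ y in Iic x, profile σ ω c y ^ (2 * σ)

theorem soliton_eq (x : ℝ) : soliton σ ω c x =
    ((profile σ ω c x : ℝ) : ℂ) * Complex.exp (Complex.I * ((phase σ ω c x : ℝ) : ℂ)) := rfl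

theorem hasDerivAt_phase (hσ : 0 < σ) (hω : 0 < ω) (hc : c ^ 2 < 4 * ω) (x : ℝ) :
    HasDerivAt (phase σ ω c) (c / 2 - 1 / (2 * σ + 2) * profilePow σ ω c x) x := by
  have hcont := continuous_profilePow (σ := σ) hω hc
  have hκ : 0 < √(4 * ω - c ^ 2) := Real.sqrt_pos.2 (by linarith)
  have hint : Integrable (profilePow σ ω c) := by
    have h1 := (integrable_exp_neg_abs (mul_pos hσ hκ) 0).1
    simp only [sub_zero] at h1
    refine (h1.const_mul (profileBound σ ω c)).mono' hcont.aestronglyMeasurable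
      (Eventually.of_forall fun y => ?_)
    rw [Real.norm_of_nonneg (profilePow_pos hσ hω hc y).le]
    exact profilePow_le hσ hω hc y
  have e : (fun x => ∫ y in Iic x, profile σ ω c y ^ (2 * σ)) =
      fun x => (∫ y in Iic (0 : ℝ), profilePow σ ω c y) + ∫ y in (0 : ℝ)..x, profilePow σ ω c y := by
    ext x
    simp only [profile_rpow hσ hω hc]
    rw [intervalIntegral.integral_Iic_sub_Iic hint.integrableOn hint.integrableOn |>.symm]
    ring
  have d1 : HasDerivAt (fun x => ∫ y in Iic x, profile σ ω c y ^ (2 * σ))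
      (profilePow σ ω c x) x := by
    rw [e]
    exact (intervalIntegral.integral_hasDerivAt_right hint.intervalIntegrable
      (hcont.stronglyMeasurableAtFilter _ _) hcont.continuousAt).const_add _
  have d2 : HasDerivAt (fun x => c / 2 * x) (c / 2) x := by
    simpa using (hasDerivAt_id x).const_mul (c / 2)
  exact d2.sub (d1.const_mul _)

/-- The space derivative of the solitary wave. -/
def solitonDeriv (σ ω c x : ℝ) : ℂ :=
  (((profileDeriv σ ω c x : ℝ) : ℂ) + Complex.I *
    ((profile σ ω c x * (c / 2 - 1 / (2 * σ + 2) * profilePow σ ω c x) : ℝ) : ℂ)) *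
    Complex.exp (Complex.I * ((phase σ ω c x : ℝ) : ℂ))

theorem norm_exp_I_mul (r : ℝ) : ‖Complex.exp (Complex.I * (r : ℂ))‖ = 1 := by
  rw [mul_comm, Complex.norm_exp_ofReal_mul_I]

theorem hasDerivAt_soliton (hσ : 0 < σ) (hω : 0 < ω) (hc : c ^ 2 < 4 * ω) (x : ℝ) :
    HasDerivAt (soliton σ ω c) (solitonDeriv σ ω c x) x := by
  have d1 := (hasDerivAt_profile hσ hω hc x).ofReal_comp
  have d2 := ((hasDerivAt_phase hσ hω hc x).ofReal_comp.const_mul Complex.I).cexp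
  refine (d1.mul d2).congr_deriv ?_
  rw [solitonDeriv]
  push_cast
  ring

theorem norm_soliton (hσ : 0 < σ) (hω : 0 < ω) (hc : c ^ 2 < 4 * ω) (x : ℝ) :
    ‖soliton σ ω c x‖ = profile σ ω c x := by
  rw [soliton_eq, norm_mul, norm_exp_I_mul, mul_one, Complex.norm_real,
    Real.norm_of_nonneg (profile_pos hσ hω hc x).le]

theorem norm_solitonDeriv_le (hσ : 0 < σ) (hω : 0 < ω) (hc : c ^ 2 < 4 * ω) (x : ℝ) :
    ‖solitonDeriv σ ω c x‖ ≤ (√(4 * ω - c ^ 2) / 2 / (1 - |c / (2 * √ω)|) +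
      (|c| / 2 + 1 / (2 * σ + 2) * profileBound σ ω c)) * profile σ ω c x := by
  have hp := (profile_pos hσ hω hc x).le
  rw [solitonDeriv, norm_mul, norm_exp_I_mul, mul_one, add_mul]
  refine (norm_add_le _ _).trans (add_le_add ?_ ?_)
  · rw [Complex.norm_real]
    exact abs_profileDeriv_le hσ hω hc x
  · rw [norm_mul, Complex.norm_I, one_mul, Complex.norm_real, Real.norm_eq_abs, abs_mul,
      abs_of_nonneg hp, mul_comm]
    refine mul_le_mul_of_nonneg_right ((abs_sub _ _).trans (add_le_add ?_ ?_)) hp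
    · rw [abs_div, abs_two]
    · rw [abs_of_nonneg (mul_nonneg (by positivity) (profilePow_pos hσ hω hc x).le)]
      refine mul_le_mul_of_nonneg_left ((profilePow_le hσ hω hc x).trans ?_) (by positivity)
      have h1 : Real.exp (-(σ * √(4 * ω - c ^ 2) * |x|)) ≤ 1 := by
        rw [Real.exp_le_one_iff, neg_nonpos]
        positivity
      have := (profileBound_pos hσ hω hc).le
      nlinarith

/-- The mass flux of a solitary wave is its speed times its mass density. -/
theorem soliton_flux (hσ : 0 < σ) (hω : 0 < ω) (hc : c ^ 2 < 4 * ω) (x : ℝ) :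
    2 * (starRingEnd ℂ (soliton σ ω c x) * solitonDeriv σ ω c x).im +
      ‖soliton σ ω c x‖ ^ (2 * σ) * ‖soliton σ ω c x‖ ^ 2 / (σ + 1) =
      c * ‖soliton σ ω c x‖ ^ 2 := by
  rw [norm_soliton hσ hω hc, profile_rpow hσ hω hc, soliton_eq, solitonDeriv]
  set E := Complex.exp (Complex.I * ((phase σ ω c x : ℝ) : ℂ)) with hE
  have hEE : starRingEnd ℂ E * E = 1 := by
    rw [mul_comm, Complex.mul_conj, Complex.normSq_eq_norm_sq, hE, norm_exp_I_mul]
    simp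
  have e : starRingEnd ℂ (((profile σ ω c x : ℝ) : ℂ) * E) *
      ((((profileDeriv σ ω c x : ℝ) : ℂ) + Complex.I *
      ((profile σ ω c x * (c / 2 - 1 / (2 * σ + 2) * profilePow σ ω c x) : ℝ) : ℂ)) * E) =
      ((profile σ ω c x : ℝ) : ℂ) * (((profileDeriv σ ω c x : ℝ) : ℂ) + Complex.I *
      ((profile σ ω c x * (c / 2 - 1 / (2 * σ + 2) * profilePow σ ω c x) : ℝ) : ℂ)) := by
    rw [map_mul, Complex.conj_ofReal]
    linear_combination ((profile σ ω c x : ℝ) : ℂ) * (((profileDeriv σ ω c x : ℝ) : ℂ) +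
      Complex.I * ((profile σ ω c x * (c / 2 - 1 / (2 * σ + 2) * profilePow σ ω c x) : ℝ) : ℂ)) *
      hEE
  rw [e, Complex.im_ofReal_mul, Complex.add_im, Complex.ofReal_im, Complex.I_mul_im,
    Complex.ofReal_re]
  have : σ + 1 ≠ 0 := by linarith
  have h2 : 2 * σ + 2 ≠ 0 := by linarith
  field_simp
  ring

end Profile

/-- A smooth function centred at `X`, exponentially localized together with its derivative, whose
mass flux is `c` times its mass density. -/
structure IsWave (σ c K δ X : ℝ) (R R' : ℝ → ℂ) : Prop where
  hasDerivAt : ∀ x, HasDerivAt R (R' x) x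
  continuous_deriv : Continuous R'
  decay : ∀ x, ‖R x‖ ≤ K * Real.exp (-(δ * |x - X|))
  decay_deriv : ∀ x, ‖R' x‖ ≤ K * Real.exp (-(δ * |x - X|))
  flux : ∀ x, 2 * (starRingEnd ℂ (R x) * R' x).im + ‖R x‖ ^ (2 * σ) * ‖R x‖ ^ 2 / (σ + 1) =
    c * ‖R x‖ ^ 2

theorem continuous_solitonDeriv {σ ω c : ℝ} (hσ : 0 < σ) (hω : 0 < ω) (hc : c ^ 2 < 4 * ω) :
    Continuous (solitonDeriv σ ω c) := by
  have h1 : Continuous (profile σ ω c) :=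
    continuous_of_hasDerivAt (hasDerivAt_profile hσ hω hc)
  have h2 := continuous_profilePow (σ := σ) hω hc
  have h3 : Continuous (phase σ ω c) := continuous_of_hasDerivAt (hasDerivAt_phase hσ hω hc)
  have h4 : Continuous (profileDeriv σ ω c) := by
    unfold profileDeriv
    refine (continuous_const.mul h1).mul (Continuous.div (by fun_prop) (by fun_prop) fun x => ?_)
    exact (cosh_sub_pos hω hc _).ne'
  unfold solitonDeriv
  fun_prop

/-- The modulated and translated solitary waves are waves, with a constant independent of position
and phase and any decay rate up to half of `√(4 ω - c²)`. -/
theorem exists_isWave {σ ω c : ℝ} (hσ : 0 < σ) (hω : 0 < ω) (hc : c ^ 2 < 4 * ω) :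
    ∃ K, 0 < K ∧ ∀ δ, δ ≤ √(4 * ω - c ^ 2) / 2 → ∀ X γ,
      IsWave σ c K δ X (fun y => soliton σ ω c (y - X) * Complex.exp (Complex.I * ((γ : ℝ) : ℂ)))
        (fun y => solitonDeriv σ ω c (y - X) * Complex.exp (Complex.I * ((γ : ℝ) : ℂ))) := by
  set P := profileBound σ ω c ^ (1 / (2 * σ)) with hP
  have hP0 : 0 < P := Real.rpow_pos_of_pos (profileBound_pos hσ hω hc) _
  set D := √(4 * ω - c ^ 2) / 2 / (1 - |c / (2 * √ω)|) +
      (|c| / 2 + 1 / (2 * σ + 2) * profileBound σ ω c) with hD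
  have h4 : 0 < 1 - |c / (2 * √ω)| := by linarith [abs_speed_lt_one hω hc]
  have hD0 : 0 ≤ D := by
    have := profileBound_pos hσ hω hc
    positivity
  have hprof : ∀ δ, δ ≤ √(4 * ω - c ^ 2) / 2 → ∀ y,
      profile σ ω c y ≤ P * Real.exp (-(δ * |y|)) := fun δ hδ y => by
    refine (profile_le hσ hω hc y).trans ?_
    gcongr
  refine ⟨(1 + D) * P, by positivity, fun δ hδ X γ => ⟨fun x => ?_, ?_, fun x => ?_, fun x => ?_,
    fun x => ?_⟩⟩
  · have := (hasDerivAt_soliton hσ hω hc (x - X)).comp_sub_const x X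
    exact this.mul_const _
  · exact ((continuous_solitonDeriv hσ hω hc).comp (continuous_id.sub continuous_const)).mul
      continuous_const
  · rw [norm_mul, norm_exp_I_mul, mul_one, norm_soliton hσ hω hc]
    have h1 := hprof δ hδ (x - X)
    have h2 : 0 ≤ P * Real.exp (-(δ * |x - X|)) := by positivity
    nlinarith
  · rw [norm_mul, norm_exp_I_mul, mul_one]
    have h1 := hprof δ hδ (x - X)
    have h2 : 0 ≤ P * Real.exp (-(δ * |x - X|)) := by positivity
    have h3 := norm_solitonDeriv_le hσ hω hc (x - X)
    have h5 := mul_le_mul_of_nonneg_left h1 hD0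
    rw [← hD] at h3
    nlinarith
  · have hE : starRingEnd ℂ (Complex.exp (Complex.I * ((γ : ℝ) : ℂ))) *
        Complex.exp (Complex.I * ((γ : ℝ) : ℂ)) = 1 := by
      rw [mul_comm, Complex.mul_conj, Complex.normSq_eq_norm_sq, norm_exp_I_mul]
      simp
    have e : starRingEnd ℂ (soliton σ ω c (x - X) * Complex.exp (Complex.I * ((γ : ℝ) : ℂ))) *
        (solitonDeriv σ ω c (x - X) * Complex.exp (Complex.I * ((γ : ℝ) : ℂ))) =
        starRingEnd ℂ (soliton σ ω c (x - X)) * solitonDeriv σ ω c (x - X) := by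
      rw [map_mul]
      linear_combination (starRingEnd ℂ (soliton σ ω c (x - X)) * solitonDeriv σ ω c (x - X)) * hE
    rw [e, norm_mul, norm_exp_I_mul, mul_one]
    exact soliton_flux hσ hω hc (x - X)

/-- Solitary waves with parameters near a fixed admissible pair decay exponentially with uniform
constants. -/
theorem exists_uniform_decay {σ ω₀ c₀ : ℝ} (hσ : 0 < σ) (hω : 0 < ω₀) (hc : c₀ ^ 2 < 4 * ω₀) :
    ∃ η > 0, ∃ K > 0, ∀ ω c, |ω - ω₀| < η → |c - c₀| < η → Continuous (soliton σ ω c) ∧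
      ∀ x, ‖soliton σ ω c x‖ ≤ K * Real.exp (-(√(4 * ω₀ - c₀ ^ 2) / 4 * |x|)) := by
  have hκ : 0 < √(4 * ω₀ - c₀ ^ 2) := Real.sqrt_pos.2 (by linarith)
  have h1 : 0 < √ω₀ := Real.sqrt_pos.2 hω
  have h4 : 0 < 1 - |c₀ / (2 * √ω₀)| := by linarith [abs_speed_lt_one hω hc]
  have cb : ContinuousAt (fun p : ℝ × ℝ => profileBound σ p.1 p.2) (ω₀, c₀) := by
    unfold profileBound
    refine ContinuousAt.div (by fun_prop) ?_ (by positivity)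
    refine ContinuousAt.mul (by fun_prop) (continuousAt_const.sub (ContinuousAt.abs ?_))
    exact ContinuousAt.div (by fun_prop) (by fun_prop) (by positivity)
  have ck : ContinuousAt (fun p : ℝ × ℝ => √(4 * p.1 - p.2 ^ 2)) (ω₀, c₀) := by fun_prop
  have e1 := cb.eventually_lt_const (show profileBound σ ω₀ c₀ < profileBound σ ω₀ c₀ + 1 by linarith)
  have e2 := ck.eventually_const_lt (show √(4 * ω₀ - c₀ ^ 2) / 2 < √(4 * ω₀ - c₀ ^ 2) by linarith)
  have e3 : ∀ᶠ p : ℝ × ℝ in 𝓝 (ω₀, c₀), 0 < p.1 :=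
    continuousAt_fst.eventually_const_lt hω
  obtain ⟨η, hη, hball⟩ := Metric.eventually_nhds_iff.1 (e1.and (e2.and e3))
  set K := (profileBound σ ω₀ c₀ + 1) ^ (1 / (2 * σ)) with hK
  have hb0 := profileBound_pos hσ hω hc
  refine ⟨η, hη, K, Real.rpow_pos_of_pos (by linarith) _, fun ω c hω' hc' => ?_⟩
  have hd : dist (ω, c) (ω₀, c₀) < η := by
    rw [Prod.dist_eq, Real.dist_eq, Real.dist_eq]
    exact max_lt hω' hc'
  obtain ⟨b1, b2, b3⟩ := hball hd
  simp only at b1 b2 b3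
  have b4 : c ^ 2 < 4 * ω := by
    have := Real.sqrt_pos.1 ((by positivity : 0 < √(4 * ω₀ - c₀ ^ 2) / 2).trans b2)
    linarith
  refine ⟨continuous_iff_continuousAt.2 fun x => (hasDerivAt_soliton hσ b3 b4 x).continuousAt,
    fun x => ?_⟩
  rw [norm_soliton hσ b3 b4]
  refine (profile_le hσ b3 b4 x).trans ?_
  have := (profileBound_pos hσ b3 b4).le
  refine mul_le_mul (Real.rpow_le_rpow this b1.le (by positivity)) (Real.exp_le_exp.2 ?_)
    (Real.exp_pos _).le (Real.rpow_nonneg (by linarith) _)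
  nlinarith [abs_nonneg x]

/-! ### Almost additivity of the mass and its flux over separated waves -/

/-- A combination of the mass flux and the mass density at a value `z` with space derivative
`z'`. -/
def massFlux (σ a b : ℝ) (z z' : ℂ) : ℝ :=
  a * (2 * (starRingEnd ℂ z * z').im + ‖z‖ ^ (2 * σ) * ‖z‖ ^ 2 / (σ + 1)) + b * ‖z‖ ^ 2

theorem norm_rpow_mul_sq {σ : ℝ} (hσ : 0 ≤ σ) (z : ℂ) :
    ‖z‖ ^ (2 * σ) * ‖z‖ ^ 2 = ‖z‖ ^ (2 * σ + 2) := by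
  rw [Real.rpow_add_of_nonneg (norm_nonneg z) (by positivity) (by norm_num), Real.rpow_two]

/-- The mass term `|z|^{2σ+2}` of the flux is additive up to a multiple of `|z| |w|`. -/
theorem abs_rpow_add_sub_le {σ B : ℝ} (hσ : 0 ≤ σ) {z w : ℂ} (hz : ‖z‖ ≤ B) (hw : ‖w‖ ≤ B) :
    |‖z + w‖ ^ (2 * σ + 2) - ‖z‖ ^ (2 * σ + 2) - ‖w‖ ^ (2 * σ + 2)| ≤
      (2 * (2 * σ + 2) * (2 * B) ^ (2 * σ) + B ^ (2 * σ)) * (‖z‖ * ‖w‖) := by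
  wlog hzw : ‖w‖ ≤ ‖z‖ generalizing z w
  · have := this hw hz (not_le.1 hzw).le
    rw [add_comm z w, mul_comm ‖z‖ ‖w‖, sub_right_comm]
    exact this
  have hB : 0 ≤ B := (norm_nonneg z).trans hz
  have h1 := abs_rpow_sub_rpow_le (p := 2 * σ + 2) (M := 2 * ‖z‖) (by linarith)
    (norm_nonneg (z + w)) (norm_nonneg z) ((norm_add_le z w).trans (by linarith))
    (by linarith [norm_nonneg z])
  have h2 : |‖z + w‖ - ‖z‖| ≤ ‖w‖ := by
    simpa using abs_norm_sub_norm_le (z + w) z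
  have h3 : (2 * ‖z‖) ^ (2 * σ + 2 - 1) ≤ (2 * B) ^ (2 * σ) * (2 * ‖z‖) := by
    rw [show 2 * σ + 2 - 1 = 2 * σ + 1 by ring, Real.rpow_add_of_nonneg (by positivity)
      (by positivity) (by norm_num), Real.rpow_one]
    gcongr
  have h4 : ‖w‖ ^ (2 * σ + 2) ≤ B ^ (2 * σ) * (‖z‖ * ‖w‖) := by
    rw [← norm_rpow_mul_sq hσ, sq]
    gcongr
  have h5 : |‖z + w‖ ^ (2 * σ + 2) - ‖z‖ ^ (2 * σ + 2)| ≤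
      (2 * σ + 2) * ((2 * B) ^ (2 * σ) * (2 * ‖z‖)) * ‖w‖ :=
    h1.trans (by gcongr)
  have h6 : 0 ≤ ‖w‖ ^ (2 * σ + 2) := by positivity
  calc _ ≤ |‖z + w‖ ^ (2 * σ + 2) - ‖z‖ ^ (2 * σ + 2)| + |‖w‖ ^ (2 * σ + 2)| := abs_sub _ _
    _ ≤ (2 * σ + 2) * ((2 * B) ^ (2 * σ) * (2 * ‖z‖)) * ‖w‖ + B ^ (2 * σ) * (‖z‖ * ‖w‖) := by
        rw [abs_of_nonneg h6]
        exact add_le_add h5 h4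
    _ = _ := by ring

/-- `massFlux` is additive up to products of the two summands. -/
theorem exists_massFlux_add (σ : ℝ) (hσ : 0 ≤ σ) (a b B : ℝ) (hB : 0 ≤ B) :
    ∃ C, 0 ≤ C ∧ (∀ z z' w w' : ℂ, ‖z‖ ≤ B → ‖w‖ ≤ B →
      |massFlux σ a b (z + w) (z' + w') - massFlux σ a b z z' - massFlux σ a b w w'| ≤
        C * ((‖z‖ + ‖z'‖) * (‖w‖ + ‖w'‖))) ∧
      ∀ z z' : ℂ, ‖z‖ ≤ B → |massFlux σ a b z z'| ≤ C * (‖z‖ + ‖z'‖) ^ 2 := by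
  set D := 2 * (2 * σ + 2) * (2 * B) ^ (2 * σ) + B ^ (2 * σ) with hD
  have hD0 : 0 ≤ D := by positivity
  have hBD : B ^ (2 * σ) ≤ D := by
    rw [hD]
    linarith [show 0 ≤ 2 * (2 * σ + 2) * (2 * B) ^ (2 * σ) by positivity]
  have hdiv : ∀ r : ℝ, 0 ≤ r → r / (σ + 1) ≤ r := fun r hr => div_le_self hr (by linarith)
  refine ⟨|a| * (4 + D) + 2 * |b|, by positivity, fun z z' w w' hz hw => ?_, fun z z' hz => ?_⟩
  · have e : massFlux σ a b (z + w) (z' + w') - massFlux σ a b z z' - massFlux σ a b w w' =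
        a * (2 * ((starRingEnd ℂ z * w').im + (starRingEnd ℂ w * z').im) +
          (‖z + w‖ ^ (2 * σ + 2) - ‖z‖ ^ (2 * σ + 2) - ‖w‖ ^ (2 * σ + 2)) / (σ + 1)) +
        b * (2 * (starRingEnd ℂ z * w).re) := by
      have h1 : ‖z + w‖ ^ 2 = ‖z‖ ^ 2 + ‖w‖ ^ 2 + 2 * (starRingEnd ℂ z * w).re := by
        simp only [Complex.sq_norm, Complex.normSq_apply, Complex.add_re, Complex.add_im,
          Complex.mul_re, Complex.conj_re, Complex.conj_im]
        ring
      have h2 : (starRingEnd ℂ (z + w) * (z' + w')).im = (starRingEnd ℂ z * z').im +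
          (starRingEnd ℂ w * w').im + (starRingEnd ℂ z * w').im + (starRingEnd ℂ w * z').im := by
        rw [map_add, add_mul, mul_add, mul_add]
        simp only [Complex.add_im]
        ring
      simp only [massFlux, norm_rpow_mul_sq hσ]
      rw [h1, h2]
      ring
    have hp : 0 ≤ ‖z‖ * ‖w‖ := by positivity
    have hp1 : 0 ≤ ‖z‖ * ‖w'‖ := by positivity
    have hp2 : 0 ≤ ‖z'‖ * ‖w‖ := by positivity
    have hp3 : 0 ≤ ‖z'‖ * ‖w'‖ := by positivity
    have i1 : |(starRingEnd ℂ z * w').im| ≤ ‖z‖ * ‖w'‖ := by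
      simpa using Complex.abs_im_le_norm (starRingEnd ℂ z * w')
    have i2 : |(starRingEnd ℂ w * z').im| ≤ ‖z'‖ * ‖w‖ := by
      simpa [mul_comm] using Complex.abs_im_le_norm (starRingEnd ℂ w * z')
    have i3 : |(starRingEnd ℂ z * w).re| ≤ ‖z‖ * ‖w‖ := by
      simpa using Complex.abs_re_le_norm (starRingEnd ℂ z * w)
    have i4 : |(‖z + w‖ ^ (2 * σ + 2) - ‖z‖ ^ (2 * σ + 2) - ‖w‖ ^ (2 * σ + 2)) / (σ + 1)| ≤
        D * (‖z‖ * ‖w‖) := by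
      rw [abs_div, abs_of_pos (show 0 < σ + 1 by linarith)]
      exact (hdiv _ (abs_nonneg _)).trans (abs_rpow_add_sub_le hσ hz hw)
    rw [e]
    refine (abs_add_le _ _).trans ?_
    rw [abs_mul, abs_mul, add_mul]
    refine add_le_add ?_ ?_
    · rw [mul_assoc]
      refine mul_le_mul_of_nonneg_left ?_ (abs_nonneg a)
      refine (abs_add_le _ _).trans ?_
      have i5 := abs_add_le (starRingEnd ℂ z * w').im (starRingEnd ℂ w * z').im
      rw [abs_mul, abs_two]
      have := mul_nonneg hD0 hp1
      have := mul_nonneg hD0 hp2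
      have := mul_nonneg hD0 hp3
      nlinarith
    · rw [mul_comm (2 : ℝ) |b|, mul_assoc]
      refine mul_le_mul_of_nonneg_left ?_ (abs_nonneg b)
      rw [abs_mul, abs_two]
      nlinarith
  · have i1 : |(starRingEnd ℂ z * z').im| ≤ ‖z‖ * ‖z'‖ := by
      simpa using Complex.abs_im_le_norm (starRingEnd ℂ z * z')
    have hq : 0 ≤ ‖z‖ ^ (2 * σ) * ‖z‖ ^ 2 := by positivity
    have i2 : |‖z‖ ^ (2 * σ) * ‖z‖ ^ 2 / (σ + 1)| ≤ D * ‖z‖ ^ 2 := by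
      rw [abs_of_nonneg (by positivity)]
      refine (hdiv _ hq).trans (mul_le_mul_of_nonneg_right ?_ (by positivity))
      refine le_trans ?_ hBD
      gcongr
    have hp : 0 ≤ ‖z‖ * ‖z'‖ := by positivity
    rw [massFlux]
    refine (abs_add_le _ _).trans ?_
    rw [abs_mul, abs_mul, add_mul]
    refine add_le_add ?_ ?_
    · rw [mul_assoc]
      refine mul_le_mul_of_nonneg_left ?_ (abs_nonneg a)
      refine (abs_add_le _ _).trans ?_
      rw [abs_mul, abs_two]
      have := mul_nonneg hD0 hp
      have := mul_nonneg hD0 (sq_nonneg ‖z'‖)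
      nlinarith [sq_nonneg ‖z‖, sq_nonneg ‖z'‖]
    · rw [mul_comm (2 : ℝ) |b|, mul_assoc]
      refine mul_le_mul_of_nonneg_left ?_ (abs_nonneg b)
      rw [abs_of_nonneg (by positivity)]
      nlinarith [sq_nonneg ‖z‖, sq_nonneg ‖z'‖]

namespace IsWave

variable {σ c K δ X : ℝ} {R R' : ℝ → ℂ}

theorem continuous (h : IsWave σ c K δ X R R') : Continuous R :=
  continuous_iff_continuousAt.2 fun x => (h.hasDerivAt x).continuousAt

theorem nonneg (h : IsWave σ c K δ X R R') : 0 ≤ K := by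
  have := (norm_nonneg _).trans (h.decay X)
  simpa using this

theorem norm_le (h : IsWave σ c K δ X R R') (hδ : 0 ≤ δ) (x : ℝ) : ‖R x‖ ≤ K := by
  refine (h.decay x).trans (mul_le_of_le_one_right h.nonneg ?_)
  rw [Real.exp_le_one_iff, neg_nonpos]
  positivity

end IsWave

theorem sq_decay (K δ y : ℝ) :
    (K * Real.exp (-(δ * y))) ^ 2 = K ^ 2 * Real.exp (-(2 * δ * y)) := by
  rw [mul_pow, ← Real.exp_nat_mul]
  congr 2
  push_cast
  ring

theorem memLp_of_decay {K δ X : ℝ} (hδ : 0 < δ) {f : ℝ → ℂ} (hf : Continuous f)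
    (hd : ∀ x, ‖f x‖ ≤ K * Real.exp (-(δ * |x - X|))) : MemLp f 2 volume := by
  refine (memLp_two_iff_integrable_sq_norm hf.aestronglyMeasurable).2 ?_
  refine ((integrable_exp_neg_abs (show 0 < 2 * δ by positivity) X).1.const_mul (K ^ 2)).mono'
    (hf.norm.pow 2).aestronglyMeasurable (Eventually.of_forall fun x => ?_)
  rw [Real.norm_of_nonneg (by positivity), ← sq_decay]
  exact pow_le_pow_left₀ (norm_nonneg _) (hd x) 2

/-- A differentiable function in `L²` with derivative in `L²` is a Sobolev function. -/
theorem sobolevPair_of_hasDerivAt {f f' : ℝ → ℂ} (hd : ∀ x, HasDerivAt f (f' x) x)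
    (hf : MemLp f 2 volume) (hf' : MemLp f' 2 volume) : SobolevPair f f' := by
  refine ⟨hf, hf', fun ψ hψ hc => ?_⟩
  have hd1 : Continuous (deriv ψ) := hψ.continuous_deriv (by simp)
  have hψd : ∀ x, HasDerivAt ψ (deriv ψ x) x := fun x =>
    (hψ.differentiable (by simp) x).hasDerivAt
  have i1 := integrable_test_mul hd1 hc.deriv hf
  have i2 := integrable_test_mul hψ.continuous hc hf'
  have hz := integral_eq_zero_of_hasDerivAt_of_integrable
    (fun x => ((hψd x).ofReal_comp).mul (hd x)) (i1.add i2)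
    (integrable_test_mul hψ.continuous hc hf)
  rw [integral_add i1 i2] at hz
  exact eq_neg_of_add_eq_zero_left hz

theorem IsWave.sobolevPair {σ c K δ X : ℝ} {R R' : ℝ → ℂ} (h : IsWave σ c K δ X R R')
    (hδ : 0 < δ) : SobolevPair R R' :=
  sobolevPair_of_hasDerivAt h.hasDerivAt (memLp_of_decay hδ h.continuous h.decay)
    (memLp_of_decay hδ h.continuous_deriv h.decay_deriv)

theorem SobolevPair.add {u v u' v' : ℝ → ℂ} (h : SobolevPair u v) (h' : SobolevPair u' v') :
    SobolevPair (fun x => u x + u' x) (fun x => v x + v' x) := by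
  refine ⟨h.memLp.add h'.memLp, h.memLp_deriv.add h'.memLp_deriv, fun ψ hψ hc => ?_⟩
  have hd : Continuous (deriv ψ) := hψ.continuous_deriv (by simp)
  simp only [mul_add]
  rw [integral_add (integrable_test_mul hd hc.deriv h.memLp)
    (integrable_test_mul hd hc.deriv h'.memLp),
    integral_add (integrable_test_mul hψ.continuous hc h.memLp_deriv)
    (integrable_test_mul hψ.continuous hc h'.memLp_deriv), h.weak ψ hψ hc, h'.weak ψ hψ hc]
  ring

/-- Concentration: a slowly varying weight only sees the mass of a wave at its centre. -/
theorem IsWave.abs_integral_weight_sub_le {σ c K δ X ℓ : ℝ} {R R' : ℝ → ℂ}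
    (h : IsWave σ c K δ X R R') (hδ : 0 < δ) {g : ℝ → ℝ} (hg : Continuous g)
    (hℓ : ∀ x y, |g x - g y| ≤ ℓ * |x - y|) :
    Integrable (fun x => g x * ‖R x‖ ^ 2) ∧
      |(∫ x, g x * ‖R x‖ ^ 2) - g X * ∫ x, ‖R x‖ ^ 2| ≤ ℓ * (2 * K ^ 2 / δ ^ 2) := by
  have hℓ0 : 0 ≤ ℓ := by simpa using (abs_nonneg _).trans (hℓ 1 0)
  have iR : Integrable (fun x => ‖R x‖ ^ 2) := integrable_sq (h.sobolevPair hδ).memLp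
  have hpt : ∀ x, |(g x - g X) * ‖R x‖ ^ 2| ≤
      ℓ * (K ^ 2 / δ) * Real.exp (-(δ * |x - X|)) := fun x => by
    set y := |x - X| with hy
    have h1 : δ * y ≤ Real.exp (δ * y) := by linarith [Real.add_one_le_exp (δ * y)]
    have h2 : ‖R x‖ ^ 2 ≤ K ^ 2 * Real.exp (-(2 * δ * y)) := by
      rw [← sq_decay]
      exact pow_le_pow_left₀ (norm_nonneg _) (h.decay x) 2
    have h3 : Real.exp (-(2 * δ * y)) = Real.exp (-(δ * y)) * Real.exp (-(δ * y)) := by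
      rw [← Real.exp_add]
      congr 1
      ring
    have h4 : Real.exp (δ * y) * Real.exp (-(δ * y)) = 1 := by
      rw [← Real.exp_add]
      simp
    have h5 : y * Real.exp (-(2 * δ * y)) ≤ 1 / δ * Real.exp (-(δ * y)) := by
      rw [h3, ← mul_assoc]
      refine mul_le_mul_of_nonneg_right ?_ (Real.exp_pos _).le
      rw [le_div_iff₀ hδ]
      calc y * Real.exp (-(δ * y)) * δ = (δ * y) * Real.exp (-(δ * y)) := by ring
        _ ≤ Real.exp (δ * y) * Real.exp (-(δ * y)) := by gcongr
        _ = 1 := h4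
    rw [abs_mul, abs_of_nonneg (sq_nonneg ‖R x‖)]
    calc |g x - g X| * ‖R x‖ ^ 2 ≤ (ℓ * y) * (K ^ 2 * Real.exp (-(2 * δ * y))) :=
          mul_le_mul (hℓ x X) h2 (sq_nonneg _) (by positivity)
      _ = ℓ * K ^ 2 * (y * Real.exp (-(2 * δ * y))) := by ring
      _ ≤ ℓ * K ^ 2 * (1 / δ * Real.exp (-(δ * y))) := by gcongr
      _ = _ := by ring
  obtain ⟨ie, ve⟩ := integrable_exp_neg_abs hδ X
  have id : Integrable (fun x => (g x - g X) * ‖R x‖ ^ 2) :=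
    (ie.const_mul _).mono' (((hg.sub continuous_const).mul
      (h.continuous.norm.pow 2)).aestronglyMeasurable) (Eventually.of_forall hpt)
  have i1 : Integrable (fun x => g x * ‖R x‖ ^ 2) := by
    refine (id.add (iR.const_mul (g X))).congr (Eventually.of_forall fun x => ?_)
    simp only [Pi.add_apply]
    ring
  refine ⟨i1, ?_⟩
  rw [← integral_const_mul, ← integral_sub i1 (iR.const_mul (g X))]
  have e : ∀ x, g x * ‖R x‖ ^ 2 - g X * ‖R x‖ ^ 2 = (g x - g X) * ‖R x‖ ^ 2 := fun x => by ring
  simp only [e]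
  have hn : ∀ᵐ x, ‖(g x - g X) * ‖R x‖ ^ 2‖ ≤
      ℓ * (K ^ 2 / δ) * Real.exp (-(δ * |x - X|)) := Eventually.of_forall hpt
  refine (norm_integral_le_of_norm_le (ie.const_mul (ℓ * (K ^ 2 / δ))) hn).trans (le_of_eq ?_)
  rw [integral_const_mul, ve]
  field_simp

/-- The products left by expanding the flux around two waves of sizes `m₀`, `m₁` with a remainder of
size `p + q`; the weight `α`, the size of the remainder in `H¹`, makes all terms of order `α` after
integration. -/
theorem interaction_le {α m₀ m₁ p q P : ℝ} (hα : 0 < α) (hα1 : α ≤ 1) (hP : m₀ * m₁ ≤ P) :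
    2 * (m₀ + m₁) * (p + q) + 2 * m₀ * (2 * m₁) + (p + q) ^ 2 ≤
      2 * α * (m₀ ^ 2 + m₁ ^ 2) + 4 / α * (p ^ 2 + q ^ 2) + 4 * P := by
  have h1 : α * (2 * (m₀ + m₁) * (p + q)) ≤
      α * (2 * α * (m₀ ^ 2 + m₁ ^ 2) + (p + q) ^ 2 / α) := by
    have : α * (2 * α * (m₀ ^ 2 + m₁ ^ 2) + (p + q) ^ 2 / α) =
        2 * α ^ 2 * (m₀ ^ 2 + m₁ ^ 2) + (p + q) ^ 2 := by
      field_simp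
    rw [this]
    nlinarith [sq_nonneg (α * (m₀ + m₁) - (p + q)), sq_nonneg (α * (m₀ - m₁))]
  have h2 := le_of_mul_le_mul_left h1 hα
  have h3 : (p + q) ^ 2 ≤ (p + q) ^ 2 / α := by
    rw [le_div_iff₀ hα]
    exact mul_le_of_le_one_right (sq_nonneg _) hα1
  have h4 : (p + q) ^ 2 / α ≤ 2 / α * (p ^ 2 + q ^ 2) := by
    rw [div_mul_eq_mul_div]
    refine div_le_div_of_nonneg_right ?_ hα.le
    linarith [sq_nonneg (p - q)]
  have h5 : 4 / α * (p ^ 2 + q ^ 2) = 2 / α * (p ^ 2 + q ^ 2) + 2 / α * (p ^ 2 + q ^ 2) := by ring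
  linarith

/-- The product of two waves is exponentially small in their distance. -/
theorem exp_mul_exp_le {K δ X₀ X₁ : ℝ} (hδ : 0 ≤ δ) (x : ℝ) :
    K * Real.exp (-(δ * |x - X₀|)) * (K * Real.exp (-(δ * |x - X₁|))) ≤
      K ^ 2 * Real.exp (-(δ / 2 * |X₁ - X₀|)) * Real.exp (-(δ / 2 * |x - X₀|)) := by
  have h1 : |X₁ - X₀| ≤ |x - X₀| + |x - X₁| := by
    have := abs_sub (x - X₀) (x - X₁)
    simpa using this
  have h2 : K * Real.exp (-(δ * |x - X₀|)) * (K * Real.exp (-(δ * |x - X₁|))) =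
      K ^ 2 * Real.exp (-(δ * |x - X₀|) + -(δ * |x - X₁|)) := by
    rw [Real.exp_add]
    ring
  rw [h2, mul_assoc, ← Real.exp_add]
  refine mul_le_mul_of_nonneg_left (Real.exp_le_exp.2 ?_) (sq_nonneg K)
  have h3 := mul_le_mul_of_nonneg_left h1 (show 0 ≤ δ / 2 by positivity)
  have h4 := mul_nonneg hδ (abs_nonneg (x - X₁))
  linarith

/-- The integrated form of the pointwise remainder in `exists_massFlux_expansion`. -/
theorem integral_remainder_le {α δ K D C₁ X₀ X₁ : ℝ} (hδ : 0 < δ) (hα : 0 < α) (hC₁ : 0 ≤ C₁)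
    {F : ℝ → ℝ} (hF : Integrable F) (hFα : ∫ x, F x ≤ 2 * α ^ 2) :
    Integrable (fun x => C₁ * (2 * α * (K ^ 2 * Real.exp (-(2 * δ * |x - X₀|)) +
      K ^ 2 * Real.exp (-(2 * δ * |x - X₁|))) + 4 / α * F x +
      4 * (K ^ 2 * D * Real.exp (-(δ / 2 * |x - X₀|))))) ∧
    ∫ x, C₁ * (2 * α * (K ^ 2 * Real.exp (-(2 * δ * |x - X₀|)) +
      K ^ 2 * Real.exp (-(2 * δ * |x - X₁|))) + 4 / α * F x +
      4 * (K ^ 2 * D * Real.exp (-(δ / 2 * |x - X₀|)))) ≤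
      C₁ * ((4 * K ^ 2 / δ + 8) * α + 16 * K ^ 2 / δ * D) := by
  obtain ⟨i1, v1⟩ := integrable_exp_neg_abs (show 0 < 2 * δ by positivity) X₀
  obtain ⟨i2, v2⟩ := integrable_exp_neg_abs (show 0 < 2 * δ by positivity) X₁
  obtain ⟨i3, v3⟩ := integrable_exp_neg_abs (show 0 < δ / 2 by positivity) X₀
  have j1 : Integrable (fun x => 2 * α * (K ^ 2 * Real.exp (-(2 * δ * |x - X₀|)) +
      K ^ 2 * Real.exp (-(2 * δ * |x - X₁|)))) :=
    ((i1.const_mul (K ^ 2)).add (i2.const_mul (K ^ 2))).const_mul (2 * α)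
  have j2 : Integrable (fun x => 4 / α * F x) := hF.const_mul (4 / α)
  have j12 : Integrable (fun x => 2 * α * (K ^ 2 * Real.exp (-(2 * δ * |x - X₀|)) +
      K ^ 2 * Real.exp (-(2 * δ * |x - X₁|))) + 4 / α * F x) := j1.add j2
  have j3 : Integrable (fun x => 4 * (K ^ 2 * D * Real.exp (-(δ / 2 * |x - X₀|)))) :=
    (i3.const_mul (K ^ 2 * D)).const_mul 4
  refine ⟨(j12.add j3).const_mul C₁, ?_⟩
  rw [integral_const_mul, integral_add j12 j3, integral_add j1 j2, integral_const_mul,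
    integral_const_mul, integral_const_mul, integral_add (i1.const_mul _) (i2.const_mul _),
    integral_const_mul, integral_const_mul, integral_const_mul, v1, v2, v3]
  refine mul_le_mul_of_nonneg_left ?_ hC₁
  have e2 : 4 / α * ∫ x, F x ≤ 8 * α := by
    rw [div_mul_eq_mul_div, div_le_iff₀ hα]
    nlinarith
  have e3 : 2 * α * (K ^ 2 * (2 / (2 * δ)) + K ^ 2 * (2 / (2 * δ))) = 4 * K ^ 2 / δ * α := by
    field_simp
    ring
  have e4 : 4 * (K ^ 2 * D * (2 / (δ / 2))) = 16 * K ^ 2 / δ * D := by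
    field_simp
    ring
  rw [e3, e4]
  linarith

theorem abs_integral_mul_sub_le {f g ρ r₀ r₁ : ℝ → ℝ} {p₀ p₁ G₀ G₁ e₀ e₁ H : ℝ}
    (hf : AEStronglyMeasurable f volume) (hg : Continuous g) (hgH : ∀ x, |g x| ≤ H)
    (hρ : Integrable ρ) (hr₀ : Continuous r₀) (hr₁ : Continuous r₁)
    (hpt : ∀ᵐ x, |f x - p₀ * r₀ x - p₁ * r₁ x| ≤ ρ x)
    (i₀ : Integrable fun x => g x * r₀ x) (i₁ : Integrable fun x => g x * r₁ x)
    (h₀ : |(∫ x, g x * r₀ x) - G₀| ≤ e₀) (h₁ : |(∫ x, g x * r₁ x) - G₁| ≤ e₁) :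
    Integrable (fun x => g x * f x) ∧
      |(∫ x, g x * f x) - (p₀ * G₀ + p₁ * G₁)| ≤ H * (∫ x, ρ x) + |p₀| * e₀ + |p₁| * e₁ := by
  have hH : 0 ≤ H := (abs_nonneg _).trans (hgH 0)
  have hq : ∀ᵐ x, ‖g x * (f x - p₀ * r₀ x - p₁ * r₁ x)‖ ≤ H * ρ x := by
    filter_upwards [hpt] with x hx
    rw [Real.norm_eq_abs, abs_mul]
    exact mul_le_mul (hgH x) hx (abs_nonneg _) hH
  have iq : Integrable (fun x => g x * (f x - p₀ * r₀ x - p₁ * r₁ x)) :=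
    (hρ.const_mul H).mono' (hg.aestronglyMeasurable.mul
      ((hf.sub (continuous_const.mul hr₀).aestronglyMeasurable).sub
        (continuous_const.mul hr₁).aestronglyMeasurable)) hq
  have l0 := i₀.const_mul p₀
  have l1 := i₁.const_mul p₁
  have e : ∀ x, g x * f x = g x * (f x - p₀ * r₀ x - p₁ * r₁ x) + p₀ * (g x * r₀ x) +
      p₁ * (g x * r₁ x) := fun x => by ring
  have iql : Integrable (fun x => g x * (f x - p₀ * r₀ x - p₁ * r₁ x) + p₀ * (g x * r₀ x)) :=
    iq.add l0
  simp only [e]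
  refine ⟨iql.add l1, ?_⟩
  rw [integral_add iql l1, integral_add iq l0, integral_const_mul, integral_const_mul]
  have vq := norm_integral_le_of_norm_le (hρ.const_mul H) hq
  rw [integral_const_mul, Real.norm_eq_abs] at vq
  have b0 : |p₀ * ((∫ x, g x * r₀ x) - G₀)| ≤ |p₀| * e₀ := by
    rw [abs_mul]
    exact mul_le_mul_of_nonneg_left h₀ (abs_nonneg _)
  have b1 : |p₁ * ((∫ x, g x * r₁ x) - G₁)| ≤ |p₁| * e₁ := by
    rw [abs_mul]
    exact mul_le_mul_of_nonneg_left h₁ (abs_nonneg _)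
  rw [abs_le] at vq b0 b1 ⊢
  constructor <;> linarith [vq.1, vq.2, b0.1, b0.2, b1.1, b1.2]

/-- Pointwise expansion of the mass flux near a sum of two waves: each wave contributes its velocity
times its mass density. -/
theorem exists_massFlux_expansion (σ : ℝ) (hσ : 0 ≤ σ) (a b K δ c₀ c₁ : ℝ) (hK : 0 ≤ K)
    (hδ : 0 < δ) :
    ∃ C, 0 ≤ C ∧ ∀ (X₀ X₁ α x : ℝ) (z z' : ℂ) (R₀ R₀' R₁ R₁' : ℝ → ℂ),
      IsWave σ c₀ K δ X₀ R₀ R₀' → IsWave σ c₁ K δ X₁ R₁ R₁' → 0 < α → α ≤ 1 → ‖z‖ ≤ 1 →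
      |massFlux σ a b (R₀ x + R₁ x + z) (R₀' x + R₁' x + z') - (a * c₀ + b) * ‖R₀ x‖ ^ 2 -
        (a * c₁ + b) * ‖R₁ x‖ ^ 2| ≤
      C * (2 * α * (K ^ 2 * Real.exp (-(2 * δ * |x - X₀|)) +
        K ^ 2 * Real.exp (-(2 * δ * |x - X₁|))) + 4 / α * (‖z‖ ^ 2 + ‖z'‖ ^ 2) +
        4 * (K ^ 2 * Real.exp (-(δ / 2 * |X₁ - X₀|)) * Real.exp (-(δ / 2 * |x - X₀|)))) := by
  obtain ⟨C₁, hC₁, hadd, hself⟩ := exists_massFlux_add σ hσ a b (2 * K + 1) (by positivity)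
  refine ⟨C₁, hC₁, fun X₀ X₁ α x z z' R₀ R₀' R₁ R₁' w₀ w₁ hα hα1 hz => ?_⟩
  have hx1 : ‖z‖ ≤ 2 * K + 1 := by linarith
  have n0 := w₀.norm_le hδ.le x
  have n1 := w₁.norm_le hδ.le x
  have d0 := w₀.decay x
  have d1 := w₁.decay x
  have d0' := w₀.decay_deriv x
  have d1' := w₁.decay_deriv x
  have hprod := exp_mul_exp_le (K := K) (X₀ := X₀) (X₁ := X₁) hδ.le x
  have f0 : massFlux σ a b (R₀ x) (R₀' x) = (a * c₀ + b) * ‖R₀ x‖ ^ 2 := by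
    rw [massFlux, w₀.flux x]
    ring
  have f1 : massFlux σ a b (R₁ x) (R₁' x) = (a * c₁ + b) * ‖R₁ x‖ ^ 2 := by
    rw [massFlux, w₁.flux x]
    ring
  have s1 := hadd (R₀ x + R₁ x) (R₀' x + R₁' x) z z' ((norm_add_le _ _).trans (by linarith)) hx1
  have s2 := hadd (R₀ x) (R₀' x) (R₁ x) (R₁' x) (by linarith) (by linarith)
  have s3 := hself z z' hx1
  rw [← sq_decay, ← sq_decay, ← f0, ← f1]
  generalize K * Real.exp (-(δ * |x - X₀|)) = m₀ at *
  generalize K * Real.exp (-(δ * |x - X₁|)) = m₁ at *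
  have s4 : (‖R₀ x + R₁ x‖ + ‖R₀' x + R₁' x‖) * (‖z‖ + ‖z'‖) ≤
      (2 * (m₀ + m₁)) * (‖z‖ + ‖z'‖) := by
    refine mul_le_mul_of_nonneg_right ?_ (by positivity)
    have := norm_add_le (R₀ x) (R₁ x)
    have := norm_add_le (R₀' x) (R₁' x)
    linarith
  have s5 : (‖R₀ x‖ + ‖R₀' x‖) * (‖R₁ x‖ + ‖R₁' x‖) ≤ 2 * m₀ * (2 * m₁) :=
    mul_le_mul (by linarith) (by linarith) (by positivity)
      (by linarith [norm_nonneg (R₀ x)])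
  have t0 := mul_le_mul_of_nonneg_left (interaction_le (p := ‖z‖) (q := ‖z'‖) hα hα1 hprod) hC₁
  have t1 := s1.trans (mul_le_mul_of_nonneg_left s4 hC₁)
  have t2 := s2.trans (mul_le_mul_of_nonneg_left s5 hC₁)
  refine le_trans ?_ t0
  rw [mul_add, mul_add]
  rw [abs_le] at t1 t2 s3 ⊢
  constructor <;> linarith [t1.1, t1.2, t2.1, t2.2, s3.1, s3.2]

theorem continuous_massFlux {σ : ℝ} (hσ : 0 ≤ σ) (a b : ℝ) :
    Continuous (fun p : ℂ × ℂ => massFlux σ a b p.1 p.2) := by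
  have h1 : Continuous fun p : ℂ × ℂ => ‖p.1‖ ^ (2 * σ) :=
    (Real.continuous_rpow_const (by positivity)).comp continuous_fst.norm
  have h2 : Continuous fun p : ℂ × ℂ => (starRingEnd ℂ p.1 * p.2).im := by fun_prop
  exact (continuous_const.mul ((continuous_const.mul h2).add
    ((h1.mul (continuous_fst.norm.pow 2)).div_const _))).add
    (continuous_const.mul (continuous_fst.norm.pow 2))

theorem aestronglyMeasurable_massFlux {σ : ℝ} (hσ : 0 ≤ σ) (a b : ℝ) {u v : ℝ → ℂ}
    (hu : SobolevPair u v) :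
    AEStronglyMeasurable (fun x => massFlux σ a b (u x) (v x)) volume :=
  (continuous_massFlux hσ a b).comp_aestronglyMeasurable
    (f := fun x => (u x, v x)) (hu.memLp.1.prodMk hu.memLp_deriv.1)

/-- The weighted mass and mass flux of a function near a sum of two separated waves are those of two
point masses at the centres of the waves, up to the distance, the slope of the weight and an
exponentially small interaction. -/
theorem exists_integral_massFlux (σ : ℝ) (hσ : 0 ≤ σ) (a b K δ H c₀ c₁ : ℝ) (hK : 0 ≤ K)
    (hδ : 0 < δ) (hH : 0 ≤ H) :
    ∃ C, 0 ≤ C ∧ ∀ (X₀ X₁ α ℓ : ℝ) (u v R₀ R₀' R₁ R₁' : ℝ → ℂ) (g : ℝ → ℝ),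
      IsWave σ c₀ K δ X₀ R₀ R₀' → IsWave σ c₁ K δ X₁ R₁ R₁' → SobolevPair u v →
      0 < α → α ≤ 1 → h1Norm (fun x => u x - (R₀ x + R₁ x)) ≤ α →
      Continuous g → (∀ x, |g x| ≤ H) → (∀ x y, |g x - g y| ≤ ℓ * |x - y|) →
      Integrable (fun x => g x * massFlux σ a b (u x) (v x)) ∧
      |(∫ x, g x * massFlux σ a b (u x) (v x)) - ((a * c₀ + b) * (g X₀ * ∫ x, ‖R₀ x‖ ^ 2) +
        (a * c₁ + b) * (g X₁ * ∫ x, ‖R₁ x‖ ^ 2))| ≤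
        C * (α + ℓ + Real.exp (-(δ / 2 * |X₁ - X₀|))) := by
  obtain ⟨C₁, hC₁, hexp⟩ := exists_massFlux_expansion σ hσ a b K δ c₀ c₁ hK hδ
  refine ⟨H * C₁ * (4 * K ^ 2 / δ + 8) + H * C₁ * (16 * K ^ 2 / δ) +
    (|a * c₀ + b| + |a * c₁ + b|) * (2 * K ^ 2 / δ ^ 2), by positivity, ?_⟩
  intro X₀ X₁ α ℓ u v R₀ R₀' R₁ R₁' g w₀ w₁ hu hα hα1 hdist hg hgH hℓ
  have hℓ0 : 0 ≤ ℓ := by simpa using (abs_nonneg _).trans (hℓ 1 0)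
  have hpe := hu.sub ((w₀.sobolevPair hδ).add (w₁.sobolevPair hδ))
  have he2 := (integral_sq_le_h1Norm_sq (fun x => u x - (R₀ x + R₁ x))).trans
    (pow_le_pow_left₀ (h1Norm_nonneg _) hdist 2)
  have he2' := hpe.integral_deriv_sq_le.trans (pow_le_pow_left₀ (h1Norm_nonneg _) hdist 2)
  have j1 := integrable_sq hpe.memLp
  have j2 := integrable_sq hpe.memLp_deriv
  have hF := integral_add j1 j2
  obtain ⟨irem, vrem⟩ := integral_remainder_le (K := K) (X₀ := X₀) (X₁ := X₁)
    (D := Real.exp (-(δ / 2 * |X₁ - X₀|)))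
    (F := fun x => ‖u x - (R₀ x + R₁ x)‖ ^ 2 + ‖v x - (R₀' x + R₁' x)‖ ^ 2) hδ hα hC₁
    (j1.add j2) (hF.trans_le (by linarith))
  obtain ⟨g0i, g0⟩ := w₀.abs_integral_weight_sub_le hδ hg hℓ
  obtain ⟨g1i, g1⟩ := w₁.abs_integral_weight_sub_le hδ hg hℓ
  have hmeas := aestronglyMeasurable_massFlux hσ a b hu
  have hpt : ∀ᵐ x, |massFlux σ a b (u x) (v x) - (a * c₀ + b) * ‖R₀ x‖ ^ 2 -
      (a * c₁ + b) * ‖R₁ x‖ ^ 2| ≤ C₁ * (2 * α * (K ^ 2 * Real.exp (-(2 * δ * |x - X₀|)) +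
        K ^ 2 * Real.exp (-(2 * δ * |x - X₁|))) +
        4 / α * (‖u x - (R₀ x + R₁ x)‖ ^ 2 + ‖v x - (R₀' x + R₁' x)‖ ^ 2) +
        4 * (K ^ 2 * Real.exp (-(δ / 2 * |X₁ - X₀|)) * Real.exp (-(δ / 2 * |x - X₀|)))) := by
    filter_upwards [hpe.ae_norm_le] with x hx
    have := hexp X₀ X₁ α x (u x - (R₀ x + R₁ x)) (v x - (R₀' x + R₁' x)) R₀ R₀' R₁ R₁' w₀ w₁ hα
      hα1 ((hx.trans hdist).trans hα1)
    have eu : R₀ x + R₁ x + (u x - (R₀ x + R₁ x)) = u x := by ring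
    have ev : R₀' x + R₁' x + (v x - (R₀' x + R₁' x)) = v x := by ring
    rw [eu, ev] at this
    exact this
  obtain ⟨isum, vsum⟩ := abs_integral_mul_sub_le hmeas hg hgH irem (w₀.continuous.norm.pow 2)
    (w₁.continuous.norm.pow 2) hpt g0i g1i g0 g1
  refine ⟨isum, vsum.trans ?_⟩
  have hHv := mul_le_mul_of_nonneg_left vrem hH
  have hD0 : 0 ≤ Real.exp (-(δ / 2 * |X₁ - X₀|)) := (Real.exp_pos _).le
  generalize Real.exp (-(δ / 2 * |X₁ - X₀|)) = D at *
  have hE₁ : 0 ≤ H * C₁ * (4 * K ^ 2 / δ + 8) := by positivity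
  have hE₂ : 0 ≤ H * C₁ * (16 * K ^ 2 / δ) := by positivity
  have hE₃ : 0 ≤ (|a * c₀ + b| + |a * c₁ + b|) * (2 * K ^ 2 / δ ^ 2) := by positivity
  refine (add_le_add_left (add_le_add_left hHv _) _).trans ?_
  have := mul_nonneg hE₁ hℓ0
  have := mul_nonneg hE₁ hD0
  have := mul_nonneg hE₂ hα.le
  have := mul_nonneg hE₂ hℓ0
  have := mul_nonneg hE₃ hα.le
  have := mul_nonneg hE₃ hD0
  linarith

/-! ### A barrier for the positions of two point masses -/

/-- There is a level of the cutoff near which its slope is bounded below. -/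
theorem IsCutoff.exists_transition {φ : ℝ → ℝ} (h : IsCutoff φ) :
    ∃ b, 0 < φ b ∧ φ b < 1 ∧ ∃ p > 0, ∃ g > 0, ∀ y, |φ y - φ b| ≤ g → p ≤ deriv φ y := by
  -- the mean value theorem on `[-1, 1]` gives a point with slope `1 / 2`
  obtain ⟨b, -, hb⟩ := exists_deriv_eq_slope φ (show (-1 : ℝ) < 1 by norm_num)
    (h.contDiff.continuous.continuousOn) fun x _ =>
      (h.hasDerivAt x).differentiableAt.differentiableWithinAt
  rw [h.eq_zero (-1) le_rfl, h.eq_one 1 le_rfl] at hb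
  have hb' : deriv φ b = 1 / 2 := by rw [hb]; norm_num
  have hpos : 0 < φ b := by
    refine lt_of_le_of_ne (h.nonneg b) fun h0 => ?_
    have : IsLocalMin φ b := Eventually.of_forall fun x => h0 ▸ h.nonneg x
    rw [this.deriv_eq_zero] at hb'
    norm_num at hb'
  have hlt : φ b < 1 := by
    refine lt_of_le_of_ne (h.le_one b) fun h0 => ?_
    have : IsLocalMax φ b := Eventually.of_forall fun x => h0 ▸ h.le_one x
    rw [this.deriv_eq_zero] at hb'
    norm_num at hb'
  refine ⟨b, hpos, hlt, 1 / 4, by norm_num, ?_⟩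
  have hcont : ContinuousAt (deriv φ) b := h.contDiff_deriv.continuous.continuousAt
  obtain ⟨r, hr, hball⟩ := Metric.eventually_nhds_iff.1
    (hcont.eventually (lt_mem_nhds (show 1 / 4 < deriv φ b by rw [hb']; norm_num)))
  have hnear : ∀ y, |y - b| < r → 1 / 4 < deriv φ y := fun y hy => hball (by rwa [Real.dist_eq])
  have key : ∀ x y, b - r < x → x < y → y < b + r → φ x < φ y := fun x y hx hxy hy => by
    obtain ⟨z, hz, hz'⟩ := exists_deriv_eq_slope φ hxy
      (h.contDiff.continuous.continuousOn) fun x _ =>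
        (h.hasDerivAt x).differentiableAt.differentiableWithinAt
    have h1 : 0 < deriv φ z := lt_trans (by norm_num)
      (hnear z (abs_lt.2 ⟨by linarith [hz.1], by linarith [hz.2]⟩))
    rw [hz'] at h1
    have := (div_pos_iff_of_pos_right (sub_pos.2 hxy)).1 h1
    linarith
  have k1 := key (b - r / 2) b (by linarith) (by linarith) (by linarith)
  have k2 := key b (b + r / 2) (by linarith) (by linarith) (by linarith)
  refine ⟨min (φ b - φ (b - r / 2)) (φ (b + r / 2) - φ b) / 2,
    half_pos (lt_min (by linarith) (by linarith)), fun y hy => (hnear y ?_).le⟩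
  have m1 := min_le_left (φ b - φ (b - r / 2)) (φ (b + r / 2) - φ b)
  have m2 := min_le_right (φ b - φ (b - r / 2)) (φ (b + r / 2) - φ b)
  rw [abs_le] at hy
  rw [abs_lt]
  constructor
  · by_contra hcon
    have := h.monotone (show y ≤ b - r / 2 by linarith)
    linarith [hy.1]
  · by_contra hcon
    have := h.monotone (show b + r / 2 ≤ y by linarith)
    linarith [hy.2]

/-- A function decreasing whenever it is at the level `Λ` stays below that level. -/
theorem le_of_deriv_neg_at_level {T Λ : ℝ} {G G' : ℝ → ℝ}
    (hG : ∀ t ∈ Icc 0 T, HasDerivWithinAt G (G' t) (Icc 0 T) t) (h0 : G 0 ≤ Λ)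
    (hlev : ∀ t ∈ Icc 0 T, G t = Λ → G' t < 0) : ∀ t ∈ Icc 0 T, G t ≤ Λ :=
  image_le_of_deriv_right_lt_deriv_boundary' (f' := G') (B := fun _ => Λ) (B' := fun _ => 0)
    (fun t ht => (hG t ht).continuousWithinAt)
    (fun t ht => (hG t ⟨ht.1, ht.2.le⟩).mono_of_mem_nhdsWithin
      (mem_of_superset (Icc_mem_nhdsGE ht.2) (Icc_subset_Icc_left ht.1)))
    h0 continuousOn_const (fun _ _ => hasDerivWithinAt_const _ _ _)
    fun t ht => hlev t ⟨ht.1, ht.2.le⟩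

/-- Two point masses `M₀, M₁` at distance more than `2`, with velocities on both sides of `ν`, do not
cross the transition region `[-1, 1]` of a cutoff moving with velocity `ν`, even if the weighted
mass and its rate of change are only known up to an error `e`: the weighted mass cannot pass through
the levels `M₁ φ(b)` and `M₁ + M₀ φ(b)` in the wrong direction. -/
theorem IsCutoff.barrier {φ : ℝ → ℝ} (h : IsCutoff φ) {b p g M₀ M₁ d e W T ν c₀ c₁ : ℝ}
    {G G' y₀ y₁ : ℝ → ℝ} (hM₀ : 0 < M₀) (hM₁ : 0 < M₁) (hd : 0 < d) (hp : 0 < p) (hW : 0 < W)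
    (hT : 0 ≤ T) (hpg : ∀ y, |φ y - φ b| ≤ g → p ≤ deriv φ y)
    (a₀ : e < M₀ * φ b) (a₁ : e < M₁ * φ b) (b₀ : e < M₀ * (1 - φ b)) (b₁ : e < M₁ * (1 - φ b))
    (g₀ : e ≤ M₀ * g) (g₁ : e ≤ M₁ * g) (d₀ : e < d * M₀ * p) (d₁ : e < d * M₁ * p)
    (hG : ∀ t ∈ Icc 0 T, HasDerivWithinAt G (G' t) (Icc 0 T) t)
    (hsep : ∀ t ∈ Icc 0 T, 2 < y₁ t - y₀ t)
    (hGa : ∀ t ∈ Icc 0 T, |G t - (M₀ * φ (y₀ t) + M₁ * φ (y₁ t))| ≤ e)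
    (hGb : ∀ t ∈ Icc 0 T, |W * G' t -
      ((c₀ - ν) * (M₀ * deriv φ (y₀ t)) + (c₁ - ν) * (M₁ * deriv φ (y₁ t)))| ≤ e)
    (hν₀ : c₀ + d ≤ ν) (hν₁ : ν ≤ c₁ - d) (i₀ : y₀ 0 ≤ -1) (i₁ : 1 ≤ y₁ 0) :
    ∀ t ∈ Icc 0 T, y₀ t < 1 ∧ -1 < y₁ t := by
  have hmul : ∀ y, ∀ M > 0, 0 ≤ M * φ y ∧ M * φ y ≤ M := fun y M hM =>
    ⟨mul_nonneg hM.le (h.nonneg y), mul_le_of_le_one_right hM.le (h.le_one y)⟩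
  have hz : (0 : ℝ) ∈ Icc 0 T := ⟨le_rfl, hT⟩
  -- at the level `M₁ φ(b)` the mass `M₀` lies left of the transition region, and `φ' ≥ p` at the
  -- position of `M₁`, which moves to the right relative to the cutoff: `G` increases
  have hlow : ∀ t ∈ Icc 0 T, -G t ≤ -(M₁ * φ b) := by
    refine le_of_deriv_neg_at_level (G' := fun t => -G' t) (fun t ht => (hG t ht).neg) ?_ ?_
    · have h1 := abs_le.1 (hGa 0 hz)
      rw [h.eq_one _ i₁] at h1
      linarith [h1.1, (hmul (y₀ 0) M₀ hM₀).1]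
    · intro t ht hlev
      have h1 := abs_le.1 (hGa t ht)
      have h2 := abs_le.1 (hGb t ht)
      have h3 := hsep t ht
      rcases le_or_gt 1 (y₁ t) with h4 | h4
      · rw [h.eq_one _ h4] at h1
        linarith [h1.1, (hmul (y₀ t) M₀ hM₀).1]
      have h5 : y₀ t ≤ -1 := by linarith
      rw [h.eq_zero _ h5] at h1
      rw [h.deriv_eq_zero (Or.inl h5)] at h2
      have h6 : |φ (y₁ t) - φ b| ≤ g := by
        refine le_of_mul_le_mul_left ?_ hM₁
        rw [← abs_of_pos hM₁, ← abs_mul, abs_of_pos hM₁]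
        refine le_trans ?_ g₁
        rw [abs_le]
        constructor <;> linarith [h1.1, h1.2]
      have h7 : d * M₁ * p ≤ (c₁ - ν) * (M₁ * deriv φ (y₁ t)) := by
        rw [mul_assoc]
        exact mul_le_mul (by linarith) (mul_le_mul_of_nonneg_left (hpg _ h6) hM₁.le)
          (by positivity) (by linarith)
      have h8 : 0 < W * G' t := by linarith [h2.1]
      linarith [pos_of_mul_pos_right h8 hW.le]
  -- symmetrically at the level `M₁ + M₀ φ(b)`, where the mass `M₁` is counted in full
  have hup : ∀ t ∈ Icc 0 T, G t ≤ M₁ + M₀ * φ b := by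
    refine le_of_deriv_neg_at_level (G' := G') hG ?_ ?_
    · have h1 := abs_le.1 (hGa 0 hz)
      rw [h.eq_zero _ i₀] at h1
      linarith [h1.2, (hmul (y₁ 0) M₁ hM₁).2]
    · intro t ht hlev
      have h1 := abs_le.1 (hGa t ht)
      have h2 := abs_le.1 (hGb t ht)
      have h3 := hsep t ht
      rcases le_or_gt (y₀ t) (-1) with h4 | h4
      · rw [h.eq_zero _ h4] at h1
        linarith [h1.2, (hmul (y₁ t) M₁ hM₁).2]
      have h5 : 1 ≤ y₁ t := by linarith
      rw [h.eq_one _ h5] at h1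
      rw [h.deriv_eq_zero (Or.inr h5)] at h2
      have h6 : |φ (y₀ t) - φ b| ≤ g := by
        refine le_of_mul_le_mul_left ?_ hM₀
        rw [← abs_of_pos hM₀, ← abs_mul, abs_of_pos hM₀]
        refine le_trans ?_ g₀
        rw [abs_le]
        constructor <;> linarith [h1.1, h1.2]
      have h7 : d * M₀ * p ≤ (ν - c₀) * (M₀ * deriv φ (y₀ t)) := by
        rw [mul_assoc]
        exact mul_le_mul (by linarith) (mul_le_mul_of_nonneg_left (hpg _ h6) hM₀.le)
          (by positivity) (by linarith)
      have h8 : W * G' t < 0 := by linarith [h2.2]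
      by_contra h9
      linarith [mul_nonneg hW.le (not_lt.1 h9)]
  intro t ht
  have h1 := abs_le.1 (hGa t ht)
  have h3 := hsep t ht
  constructor
  · by_contra h4
    rw [h.eq_one _ (show 1 ≤ y₀ t by linarith), h.eq_one _ (show 1 ≤ y₁ t by linarith)] at h1
    linarith [h1.1, hup t ht]
  · by_contra h4
    rw [h.eq_zero _ (show y₀ t ≤ -1 by linarith), h.eq_zero _ (show y₁ t ≤ -1 by linarith)] at h1
    linarith [h1.2, hlow t ht]

/-! ### Separation of the two waves along the flow -/

theorem IsWave.mono {σ c K K' δ X : ℝ} {R R' : ℝ → ℂ} (h : IsWave σ c K δ X R R') (hK : K ≤ K') :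
    IsWave σ c K' δ X R R' :=
  ⟨h.hasDerivAt, h.continuous_deriv,
    fun x => (h.decay x).trans (mul_le_mul_of_nonneg_right hK (Real.exp_pos _).le),
    fun x => (h.decay_deriv x).trans (mul_le_mul_of_nonneg_right hK (Real.exp_pos _).le), h.flux⟩

theorem exists_isWave_pair {σ : ℝ} {ω c : Fin 2 → ℝ} (hσ : 0 < σ) (hω : ∀ k, 0 < ω k)
    (hc : ∀ k, c k ^ 2 < 4 * ω k) :
    ∃ K > 0, ∃ δ > 0, ∀ k X γ, IsWave σ (c k) K δ X
      (fun y => soliton σ (ω k) (c k) (y - X) * Complex.exp (Complex.I * ((γ : ℝ) : ℂ)))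
      (fun y => solitonDeriv σ (ω k) (c k) (y - X) * Complex.exp (Complex.I * ((γ : ℝ) : ℂ))) := by
  choose K hK hwave using fun k => exists_isWave hσ (hω k) (hc k)
  have hκ : ∀ k, 0 < √(4 * ω k - c k ^ 2) / 2 := fun k =>
    half_pos (Real.sqrt_pos.2 (by linarith [hc k]))
  refine ⟨max (K 0) (K 1), lt_max_of_lt_left (hK 0),
    min (√(4 * ω 0 - c 0 ^ 2) / 2) (√(4 * ω 1 - c 1 ^ 2) / 2), lt_min (hκ 0) (hκ 1),
    Fin.forall_fin_two.2 ⟨fun X γ => ?_, fun X γ => ?_⟩⟩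
  · exact (hwave 0 _ (min_le_left _ _) X γ).mono (le_max_left _ _)
  · exact (hwave 1 _ (min_le_right _ _) X γ).mono (le_max_right _ _)

/-- The mass of a solitary wave. -/
def solitonMass (σ ω c : ℝ) : ℝ := ∫ x, ‖soliton σ ω c x‖ ^ 2

theorem integral_norm_soliton_sub_sq (σ ω c X γ : ℝ) :
    ∫ y, ‖soliton σ ω c (y - X) * Complex.exp (Complex.I * ((γ : ℝ) : ℂ))‖ ^ 2 =
      solitonMass σ ω c := by
  simp only [norm_mul, norm_exp_I_mul, mul_one]
  exact integral_sub_right_eq_self (fun y => ‖soliton σ ω c y‖ ^ 2) X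

theorem solitonMass_pos {σ ω c : ℝ} (hσ : 0 < σ) (hω : 0 < ω) (hc : c ^ 2 < 4 * ω) :
    0 < solitonMass σ ω c := by
  obtain ⟨K, -, hw⟩ := exists_isWave hσ hω hc
  have hκ : 0 < √(4 * ω - c ^ 2) / 2 := half_pos (Real.sqrt_pos.2 (by linarith))
  have hi := integrable_sq ((hw _ le_rfl 0 0).sobolevPair hκ).memLp
  simp only [sub_zero, norm_mul, norm_exp_I_mul, mul_one] at hi
  refine (integral_pos_iff_support_of_nonneg (fun x => sq_nonneg _) hi).2 ?_
  have : Function.support (fun x => ‖soliton σ ω c x‖ ^ 2) = univ := by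
    refine eq_univ_of_forall fun x => ?_
    rw [Function.mem_support, norm_soliton hσ hω hc]
    exact (pow_pos (profile_pos hσ hω hc x) 2).ne'
  rw [this]
  simp

theorem re_pair_self {h : ℝ → ℝ} {f : ℝ → ℂ} {C : ℝ} (hh : AEStronglyMeasurable h volume)
    (hC : ∀ x, |h x| ≤ C) (hf : MemLp f 2 volume) :
    (pair h f f).re = ∫ x, h x * ‖f x‖ ^ 2 := by
  rw [pair]
  refine (integral_re (integrable_pair hh hC hf hf)).symm.trans
    (integral_congr_ae (Eventually.of_forall fun x => ?_))
  simp only [RCLike.re_to_complex]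
  rw [Complex.re_ofReal_mul, re_conj_mul_self]

theorem IsCutoff.abs_sub_le {φ : ℝ → ℝ} (h : IsCutoff φ) {M : ℝ} (hM : ∀ x, |deriv φ x| ≤ M)
    (x y : ℝ) : |φ x - φ y| ≤ M * |x - y| :=
  Convex.norm_image_sub_le_of_norm_deriv_le (s := univ)
    (fun z _ => (h.hasDerivAt z).differentiableAt) (fun z _ => hM z) convex_univ (mem_univ _)
    (mem_univ _)

theorem IsCutoff.abs_deriv_sub_le {φ : ℝ → ℝ} (h : IsCutoff φ) {M : ℝ}
    (hM : ∀ x, |deriv (deriv φ) x| ≤ M) (x y : ℝ) : |deriv φ x - deriv φ y| ≤ M * |x - y| :=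
  Convex.norm_image_sub_le_of_norm_deriv_le (s := univ)
    (fun z _ => (h.hasDerivAt_deriv z).differentiableAt) (fun z _ => hM z) convex_univ (mem_univ _)
    (mem_univ _)

theorem abs_comp_scale_sub_le {f : ℝ → ℝ} {M W : ℝ} (hW : 0 < W)
    (hf : ∀ x y, |f x - f y| ≤ M * |x - y|) (Y x y : ℝ) :
    |f ((x - Y) / W) - f ((y - Y) / W)| ≤ M / W * |x - y| := by
  refine (hf _ _).trans (le_of_eq ?_)
  rw [← sub_div, sub_sub_sub_cancel_right, abs_div, abs_of_pos hW]
  ring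

theorem solitonSum_two (σ : ℝ) (ω c x γ : Fin 2 → ℝ) (y : ℝ) : solitonSum σ ω c x γ y =
    soliton σ (ω 0) (c 0) (y - x 0) * Complex.exp (Complex.I * ((γ 0 : ℝ) : ℂ)) +
    soliton σ (ω 1) (c 1) (y - x 1) * Complex.exp (Complex.I * ((γ 1 : ℝ) : ℂ)) :=
  Fin.sum_univ_two _

/-- The mass to the right of a wide cutoff moving with velocity `ν`, and its time derivative. -/
theorem IsSolution.hasDerivWithinAt_mass {σ T u φ X ν W t} (hσ : 1 ≤ σ) (hu : IsSolution σ T u)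
    (h : IsCutoff φ) (hW : 0 < W) (ht : t ∈ Icc 0 T) :
    HasDerivWithinAt (fun s => ∫ x, φ ((x - X - ν * s) / W) * massFlux σ 0 1 (u s x)
      (weakDeriv (u s) x))
      (1 / W * ∫ x, deriv φ ((x - X - ν * t) / W) * massFlux σ 1 (-ν) (u t x)
        (weakDeriv (u t) x)) (Icc 0 T) t := by
  obtain ⟨C, hw⟩ := h.isWeight_const T X ν hW
  have hder := hu.hasDerivWithinAt_weightedDensity (A := 1) (B := 0) hσ hw ht
  have hp : ∀ s ∈ Icc 0 T, SobolevPair (u s) (weakDeriv (u s)) := fun s hs =>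
    (hu.memH1 s hs).sobolevPair
  have hflux := ((hp t ht).weightedFlux_eq (A := 1) (B := 0) hσ (hw.d₀ t ht)
    (continuous_of_hasDerivAt (hw.d₁ t ht)) (hw.cont₃ t ht).aestronglyMeasurable
    (hw.contt t ht).aestronglyMeasurable (hw.b₀ t ht) (hw.b₁ t ht) (hw.b₃ t ht) (hw.bt t ht)).2
  rw [hflux] at hder
  have hdens : ∀ s ∈ Icc 0 T, (∫ x, φ ((x - X - ν * s) / W) * massFlux σ 0 1 (u s x)
      (weakDeriv (u s) x)) = weightedDensity 1 0 (fun x => φ ((x - X - ν * s) / W)) (u s)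
      (weakDeriv (u s)) := fun s hs => by
    rw [weightedDensity, re_pair_self (continuous_of_hasDerivAt (hw.d₀ s hs)).aestronglyMeasurable
      (hw.b₀ s hs) (hp s hs).memLp]
    simp [massFlux]
  refine (hder.congr hdens (hdens t ht)).congr_deriv ?_
  rw [← integral_const_mul]
  refine integral_congr_ae (Eventually.of_forall fun x => ?_)
  simp only [fluxAt, massFlux]
  field_simp
  ring

/-- For small `α`, a wide cutoff and a large separation, the error of `exists_integral_massFlux` is
below any given threshold. The width `W` is chosen before the separation. -/
theorem exists_small_error {C q M δ : ℝ} (hC : 0 ≤ C) (hq : 0 < q) (hM : 0 < M) (hδ : 0 < δ) :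
    ∃ α₀ > 0, α₀ ≤ 1 ∧ ∃ W > 0, ∃ L₁ > 0, 2 * W ≤ L₁ ∧ ∀ α s, α ≤ α₀ → L₁ ≤ s →
      C * (α + M / W + Real.exp (-(δ / 2 * s))) ≤ q := by
  set r := q / (3 * (C + 1)) with hr
  have hr0 : 0 < r := by positivity
  obtain ⟨L', hL'⟩ := (((Real.tendsto_exp_neg_atTop_nhds_zero.comp
    (tendsto_id.const_mul_atTop (half_pos hδ))).eventually (gt_mem_nhds hr0)).and
    (eventually_ge_atTop 0)).exists_forall_of_atTop
  refine ⟨min 1 r, lt_min one_pos hr0, min_le_left _ _, M / r, by positivity,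
    max (max 1 L') (2 * (M / r)), lt_max_of_lt_left (lt_max_of_lt_left one_pos),
    le_max_right _ _, fun α s hα hs => ?_⟩
  have h1 := (hL' s (((le_max_right _ _).trans (le_max_left _ _)).trans hs)).1
  simp only [Function.comp, id] at h1
  have h2 : M / (M / r) = r := by field_simp
  have h3 : α ≤ r := hα.trans (min_le_right _ _)
  rw [h2]
  have h4 : C * (α + r + Real.exp (-(δ / 2 * s))) ≤ C * (3 * r) :=
    mul_le_mul_of_nonneg_left (by linarith) hC
  refine h4.trans ?_
  rw [hr, show C * (3 * (q / (3 * (C + 1)))) = C / (C + 1) * q by field_simp]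
  exact mul_le_of_le_one_left hq.le ((div_le_one (by linarith)).2 (by linarith))

/-- A line with velocity `ν` strictly between those of the two waves, starting well between them,
stays between them for as long as the solution stays in the tube. -/
theorem exists_crossing_bound {σ : ℝ} {φ : ℝ → ℝ} {ω c : Fin 2 → ℝ} {ν : ℝ} (hσ : 1 ≤ σ)
    (h : IsCutoff φ) (hω : ∀ k, 0 < ω k) (hc : ∀ k, c k ^ 2 < 4 * ω k) (hν₀ : c 0 < ν)
    (hν₁ : ν < c 1) :
    ∃ α₀ > 0, ∃ W > 0, ∃ L₁ > 0, ∀ α L T, 0 < α → α ≤ α₀ → L₁ ≤ L → 0 ≤ T →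
      ∀ u, IsSolution σ T u → ∀ y γ : ℝ → Fin 2 → ℝ,
      (∀ t ∈ Icc 0 T, L < y t 1 - y t 0 ∧
        h1Norm (fun x => u t x - solitonSum σ ω c (y t) (γ t) x) ≤ α) →
      ∀ X, y 0 0 ≤ X - W → X + W ≤ y 0 1 →
      ∀ t ∈ Icc 0 T, y t 0 < X + ν * t + W ∧ X + ν * t - W < y t 1 := by
  have hσ0 : 0 < σ := by linarith
  obtain ⟨K, hK, δ, hδ, hwave⟩ := exists_isWave_pair hσ0 hω hc
  obtain ⟨M, hM1, hM, hM', -⟩ := h.exists_deriv_bound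
  obtain ⟨b, hb0, hb1, p, hp, g, hg, hpg⟩ := h.exists_transition
  obtain ⟨C₁, hC₁, hmass⟩ := exists_integral_massFlux σ hσ0.le 0 1 K δ 1 (c 0) (c 1) hK.le hδ
    zero_le_one
  obtain ⟨C₂, hC₂, hflux⟩ := exists_integral_massFlux σ hσ0.le 1 (-ν) K δ M (c 0) (c 1) hK.le hδ
    (by linarith)
  have hM₀ := solitonMass_pos hσ0 (hω 0) (hc 0)
  have hM₁ := solitonMass_pos hσ0 (hω 1) (hc 1)
  set M₀ := solitonMass σ (ω 0) (c 0) with hM₀d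
  set M₁ := solitonMass σ (ω 1) (c 1) with hM₁d
  set d := min (ν - c 0) (c 1 - ν) with hd
  have hd0 : 0 < d := lt_min (by linarith) (by linarith)
  have hdl : d ≤ ν - c 0 := min_le_left _ _
  have hdr : d ≤ c 1 - ν := min_le_right _ _
  have hb1' : 0 < 1 - φ b := by linarith
  -- an error below all the thresholds of the barrier
  obtain ⟨q, hq, hqlt⟩ : ∃ q > 0, ∀ N ∈ ({M₀, M₁} : Set ℝ), q < N * φ b ∧ q < N * (1 - φ b) ∧
      q < N * g ∧ q < d * N * p := by
    set z := min (min (φ b) (1 - φ b)) (min g (d * p)) with hz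
    have hz0 : 0 < z := lt_min (lt_min hb0 hb1') (lt_min hg (mul_pos hd0 hp))
    have hmin : 0 < min M₀ M₁ := lt_min hM₀ hM₁
    have hall : ∀ N, min M₀ M₁ ≤ N → min M₀ M₁ * z / 2 < N * φ b ∧
        min M₀ M₁ * z / 2 < N * (1 - φ b) ∧ min M₀ M₁ * z / 2 < N * g ∧
        min M₀ M₁ * z / 2 < d * N * p := by
      intro N hN
      have key : ∀ r, z ≤ r → min M₀ M₁ * z / 2 < N * r := fun r hr => by
        have h1 : min M₀ M₁ * z ≤ N * r := mul_le_mul hN hr hz0.le (hmin.le.trans hN)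
        have h2 : 0 < min M₀ M₁ * z := mul_pos hmin hz0
        linarith
      refine ⟨key _ ((min_le_left _ _).trans (min_le_left _ _)),
        key _ ((min_le_left _ _).trans (min_le_right _ _)),
        key _ ((min_le_right _ _).trans (min_le_left _ _)), ?_⟩
      have := key _ ((min_le_right _ _).trans (min_le_right _ _))
      calc _ < N * (d * p) := this
        _ = _ := by ring
    refine ⟨min M₀ M₁ * z / 2, by positivity, fun N hN => ?_⟩
    rcases hN with rfl | rfl
    · exact hall _ (min_le_left _ _)
    · exact hall _ (min_le_right _ _)
  obtain ⟨q00, q01, q02, q03⟩ := hqlt M₀ (by simp)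
  obtain ⟨q10, q11, q12, q13⟩ := hqlt M₁ (by simp)
  obtain ⟨α₀, hα₀, hα₀1, W, hW, L₁, hL₁, hWL, herr⟩ := exists_small_error (C := max C₁ C₂)
    (q := q) (M := M) (δ := δ) (hC₁.trans (le_max_left _ _)) hq (by linarith) hδ
  refine ⟨α₀, hα₀, W, hW, L₁, hL₁, ?_⟩
  intro α L T hα hαα hL hT u hu y γ hy X hX₀ hX₁
  have hp' : ∀ s ∈ Icc 0 T, SobolevPair (u s) (weakDeriv (u s)) := fun s hs =>
    (hu.memH1 s hs).sobolevPair
  have hbound : ∀ t ∈ Icc 0 T, ∀ C' ≤ max C₁ C₂,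
      C' * (α + M / W + Real.exp (-(δ / 2 * |y t 1 - y t 0|))) ≤ q := fun t ht C' hC' => by
    refine le_trans (mul_le_mul_of_nonneg_right hC' (by positivity)) (herr α _ hαα ?_)
    exact hL.trans ((hy t ht).1.le.trans (le_abs_self _))
  have hdist : ∀ t ∈ Icc 0 T, h1Norm (fun x => u t x - (soliton σ (ω 0) (c 0) (x - y t 0) *
      Complex.exp (Complex.I * ((γ t 0 : ℝ) : ℂ)) + soliton σ (ω 1) (c 1) (x - y t 1) *
      Complex.exp (Complex.I * ((γ t 1 : ℝ) : ℂ)))) ≤ α := fun t ht => by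
    have := (hy t ht).2
    simp only [solitonSum_two] at this
    exact this
  have hshift : ∀ (f : ℝ → ℝ) t, (fun x => f ((x - (X + ν * t)) / W)) =
      fun x => f ((x - X - ν * t) / W) := fun f t => by
    funext x
    rw [sub_add_eq_sub_sub]
  have hlip := fun t => abs_comp_scale_sub_le hW (h.abs_sub_le hM) (X + ν * t)
  have hlip' := fun t => abs_comp_scale_sub_le hW (h.abs_deriv_sub_le hM') (X + ν * t)
  have main := h.barrier (b := b) (p := p) (g := g) (M₀ := M₀) (M₁ := M₁) (d := d) (e := q)
    (W := W) (T := T) (ν := ν) (c₀ := c 0) (c₁ := c 1)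
    (G := fun s => ∫ x, φ ((x - X - ν * s) / W) * massFlux σ 0 1 (u s x) (weakDeriv (u s) x))
    (G' := fun t => 1 / W * ∫ x, deriv φ ((x - X - ν * t) / W) * massFlux σ 1 (-ν) (u t x)
        (weakDeriv (u t) x))
    (y₀ := fun t => (y t 0 - X - ν * t) / W) (y₁ := fun t => (y t 1 - X - ν * t) / W)
    hM₀ hM₁ hd0 hp hW hT hpg q00 q10 q01 q11 q02.le q12.le q03 q13
    (fun t ht => hu.hasDerivWithinAt_mass hσ h hW ht) ?_ ?_ ?_ (by linarith) (by linarith) ?_ ?_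
  · intro t ht
    obtain ⟨h1, h2⟩ := main t ht
    rw [div_lt_iff₀ hW] at h1
    rw [lt_div_iff₀ hW] at h2
    constructor <;> linarith
  · intro t ht
    rw [← sub_div, lt_div_iff₀ hW]
    linarith [(hy t ht).1]
  · intro t ht
    have := (hmass (y t 0) (y t 1) α (M / W) (u t) (weakDeriv (u t)) _ _ _ _
      (fun x => φ ((x - (X + ν * t)) / W)) (hwave 0 (y t 0) (γ t 0)) (hwave 1 (y t 1) (γ t 1))
      (hp' t ht) hα (hαα.trans hα₀1) (hdist t ht)
      (h.contDiff.continuous.comp (by fun_prop))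
      (fun x => by rw [abs_of_nonneg (h.nonneg _)]; exact h.le_one _) (hlip t)).2
    rw [integral_norm_soliton_sub_sq, integral_norm_soliton_sub_sq] at this
    refine le_trans (le_of_eq ?_) (this.trans (hbound t ht C₁ (le_max_left _ _)))
    simp only [sub_add_eq_sub_sub]
    congr 1
    ring
  · intro t ht
    have := (hflux (y t 0) (y t 1) α (M / W) (u t) (weakDeriv (u t)) _ _ _ _
      (fun x => deriv φ ((x - (X + ν * t)) / W)) (hwave 0 (y t 0) (γ t 0))
      (hwave 1 (y t 1) (γ t 1)) (hp' t ht) hα (hαα.trans hα₀1) (hdist t ht)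
      (h.contDiff_deriv.continuous.comp (by fun_prop)) (fun x => hM _) (hlip' t)).2
    rw [integral_norm_soliton_sub_sq, integral_norm_soliton_sub_sq] at this
    refine le_trans (le_of_eq ?_) (this.trans (hbound t ht C₂ (le_max_right _ _)))
    simp only [sub_add_eq_sub_sub]
    congr 1
    rw [← mul_assoc, mul_one_div_cancel hW.ne']
    ring
  · rw [div_le_iff₀ hW]
    linarith
  · rw [le_div_iff₀ hW]
    linarith

/-! ### Comparison of the centres of two decompositions -/

/-- Four times the rate at which both waves (and all waves with nearby parameters) are known to
decay. -/
def decayRate (ω c : Fin 2 → ℝ) : ℝ :=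
  min (√(4 * ω 0 - c 0 ^ 2)) (√(4 * ω 1 - c 1 ^ 2))

theorem decayRate_pos {ω c : Fin 2 → ℝ} (hc : ∀ k, c k ^ 2 < 4 * ω k) : 0 < decayRate ω c :=
  lt_min (Real.sqrt_pos.2 (by linarith [hc 0])) (Real.sqrt_pos.2 (by linarith [hc 1]))

/-- Solitary waves with parameters near the given ones decay at a common rate with a common
constant. -/
theorem exists_uniform_decay_pair {σ : ℝ} {ω₀ c₀ : Fin 2 → ℝ} (hσ : 0 < σ) (hω : ∀ k, 0 < ω₀ k)
    (hc : ∀ k, c₀ k ^ 2 < 4 * ω₀ k) :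
    ∃ η > 0, ∃ K > 0, ∀ k ω c X γ, |ω - ω₀ k| < η → |c - c₀ k| < η →
      Continuous (fun y => soliton σ ω c (y - X) * Complex.exp (Complex.I * ((γ : ℝ) : ℂ))) ∧
      ∀ x, ‖soliton σ ω c (x - X) * Complex.exp (Complex.I * ((γ : ℝ) : ℂ))‖ ≤
        K * Real.exp (-(decayRate ω₀ c₀ / 4 * |x - X|)) := by
  choose η hη K hK hdec using fun k => exists_uniform_decay hσ (hω k) (hc k)
  have hle : ∀ k, min (η 0) (η 1) ≤ η k ∧ K k ≤ max (K 0) (K 1) ∧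
      decayRate ω₀ c₀ ≤ √(4 * ω₀ k - c₀ k ^ 2) :=
    Fin.forall_fin_two.2 ⟨⟨min_le_left _ _, le_max_left _ _, min_le_left _ _⟩,
      ⟨min_le_right _ _, le_max_right _ _, min_le_right _ _⟩⟩
  refine ⟨min (η 0) (η 1), lt_min (hη 0) (hη 1), max (K 0) (K 1), lt_max_of_lt_left (hK 0), ?_⟩
  intro k ω c X γ h1 h2
  obtain ⟨l1, l2, l3⟩ := hle k
  obtain ⟨d1, d2⟩ := hdec k ω c (h1.trans_le l1) (h2.trans_le l1)
  refine ⟨(d1.comp (continuous_id.sub continuous_const)).mul continuous_const, fun x => ?_⟩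
  rw [norm_mul, norm_exp_I_mul, mul_one]
  refine (d2 (x - X)).trans (mul_le_mul l2 (Real.exp_le_exp.2 ?_) (Real.exp_pos _).le
    ((hK k).le.trans l2))
  have := mul_le_mul_of_nonneg_right l3 (abs_nonneg (x - X))
  linarith

theorem norm_sum_five_sq_le (a b c d e : ℂ) : ‖a - b + c + d - e‖ ^ 2 ≤
    5 * (‖a‖ ^ 2 + ‖b‖ ^ 2 + ‖c‖ ^ 2 + ‖d‖ ^ 2 + ‖e‖ ^ 2) := by
  have h : ‖a - b + c + d - e‖ ≤ ‖a‖ + ‖b‖ + ‖c‖ + ‖d‖ + ‖e‖ := by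
    have h1 := norm_sub_le (a - b + c + d) e
    have h2 := norm_add_le (a - b + c) d
    have h3 := norm_add_le (a - b) c
    have h4 := norm_sub_le a b
    linarith
  refine (pow_le_pow_left₀ (norm_nonneg _) h 2).trans ?_
  generalize ‖a‖ = a, ‖b‖ = b, ‖c‖ = c, ‖d‖ = d, ‖e‖ = e
  nlinarith [sq_nonneg (a - b), sq_nonneg (a - c), sq_nonneg (a - d), sq_nonneg (a - e),
    sq_nonneg (b - c), sq_nonneg (b - d), sq_nonneg (b - e), sq_nonneg (c - d),
    sq_nonneg (c - e), sq_nonneg (d - e)]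

/-- If a function bounded below on a unit neighbourhood of `X` is a sum of two functions small in
`L²` and three localized ones, then one of the latter is centred near `X`. -/
theorem exists_near_centre {K δ m : ℝ} (hK : 0 < K) (hδ : 0 < δ) (hm : 0 < m) :
    ∃ r > 0, ∃ β > 0, ∀ (R f₁ f₂ g₁ g₂ g₃ : ℝ → ℂ) (X Y₁ Y₂ Y₃ : ℝ),
      MemLp f₁ 2 volume → MemLp f₂ 2 volume → ∫ x, ‖f₁ x‖ ^ 2 ≤ β → ∫ x, ‖f₂ x‖ ^ 2 ≤ β →
      (∀ x, ‖g₁ x‖ ≤ K * Real.exp (-(δ * |x - Y₁|))) →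
      (∀ x, ‖g₂ x‖ ≤ K * Real.exp (-(δ * |x - Y₂|))) →
      (∀ x, ‖g₃ x‖ ≤ K * Real.exp (-(δ * |x - Y₃|))) →
      (∀ x, R x = f₁ x - f₂ x + g₁ x + g₂ x - g₃ x) →
      (∀ x ∈ Icc (X - 1) (X + 1), m ≤ ‖R x‖ ^ 2) → r < |Y₃ - X| →
      |Y₁ - X| ≤ r ∨ |Y₂ - X| ≤ r := by
  obtain ⟨ρ, hρ1, hρ⟩ : ∃ ρ, 0 ≤ ρ ∧ (K * Real.exp (-(δ * ρ))) ^ 2 ≤ m / 30 := by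
    have h1 : Tendsto (fun ρ => (K * Real.exp (-(δ * ρ))) ^ 2) atTop (𝓝 ((K * 0) ^ 2)) :=
      ((Real.tendsto_exp_neg_atTop_nhds_zero.comp
        (tendsto_id.const_mul_atTop hδ)).const_mul K).pow 2
    have h2 : (K * 0) ^ 2 < m / 30 := by
      rw [mul_zero, zero_pow two_ne_zero]
      positivity
    obtain ⟨ρ, h3, h4⟩ := ((h1.eventually (gt_mem_nhds h2)).and (eventually_ge_atTop 0)).exists
    exact ⟨ρ, h4, h3.le⟩
  refine ⟨ρ + 1, by linarith, m / 40, by positivity, ?_⟩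
  intro R f₁ f₂ g₁ g₂ g₃ X Y₁ Y₂ Y₃ m1 m2 b1 b2 d1 d2 d3 hR hlow hY₃
  by_contra! hcon
  have hfar : ∀ (g : ℝ → ℂ) (Y : ℝ), (∀ x, ‖g x‖ ≤ K * Real.exp (-(δ * |x - Y|))) →
      ρ + 1 < |Y - X| → ∀ x ∈ Icc (X - 1) (X + 1), ‖g x‖ ^ 2 ≤ m / 30 := by
    intro g Y hg hY x hx
    refine le_trans (pow_le_pow_left₀ (norm_nonneg _) ((hg x).trans ?_) 2) hρ
    refine mul_le_mul_of_nonneg_left (Real.exp_le_exp.2 (neg_le_neg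
      (mul_le_mul_of_nonneg_left ?_ hδ.le))) hK.le
    have h1 : |x - X| ≤ 1 := abs_le.2 ⟨by linarith [hx.1], by linarith [hx.2]⟩
    have h2 : |Y - X| ≤ |x - X| + |x - Y| := by
      have := abs_sub (x - X) (x - Y)
      simpa using this
    linarith
  have i1 := (integrable_sq m1).add (integrable_sq m2)
  have hpt : ∀ x ∈ Icc (X - 1) (X + 1), m / 2 ≤ 5 * (‖f₁ x‖ ^ 2 + ‖f₂ x‖ ^ 2) := by
    intro x hx
    have h1 := hlow x hx
    rw [hR] at h1
    have h2 := norm_sum_five_sq_le (f₁ x) (f₂ x) (g₁ x) (g₂ x) (g₃ x)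
    linarith [hfar g₁ Y₁ d1 hcon.1 x hx, hfar g₂ Y₂ d2 hcon.2 x hx, hfar g₃ Y₃ d3 hY₃ x hx]
  have h3 : ∫ _ in Icc (X - 1) (X + 1), m / 2 ≤
      ∫ x in Icc (X - 1) (X + 1), 5 * (‖f₁ x‖ ^ 2 + ‖f₂ x‖ ^ 2) :=
    setIntegral_mono_on (by simp) ((i1.const_mul 5).integrableOn) measurableSet_Icc hpt
  have h4 : ∫ x in Icc (X - 1) (X + 1), 5 * (‖f₁ x‖ ^ 2 + ‖f₂ x‖ ^ 2) ≤
      ∫ x, 5 * (‖f₁ x‖ ^ 2 + ‖f₂ x‖ ^ 2) :=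
    setIntegral_le_integral (i1.const_mul 5) (Eventually.of_forall fun x => by positivity)
  have h5 : ∫ x, 5 * (‖f₁ x‖ ^ 2 + ‖f₂ x‖ ^ 2) =
      5 * ((∫ x, ‖f₁ x‖ ^ 2) + ∫ x, ‖f₂ x‖ ^ 2) := by
    rw [integral_const_mul, integral_add (integrable_sq m1) (integrable_sq m2)]
  rw [setIntegral_const, measureReal_def, Real.volume_Icc, ENNReal.toReal_ofReal (by linarith),
    smul_eq_mul] at h3
  linarith

theorem exists_soliton_lower_bound {σ : ℝ} {ω c : Fin 2 → ℝ} (hσ : 0 < σ) (hω : ∀ k, 0 < ω k)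
    (hc : ∀ k, c k ^ 2 < 4 * ω k) :
    ∃ m > 0, ∀ k X γ, ∀ x ∈ Icc (X - 1) (X + 1),
      m ≤ ‖soliton σ (ω k) (c k) (x - X) * Complex.exp (Complex.I * ((γ : ℝ) : ℂ))‖ ^ 2 := by
  have h : ∀ k, ∃ m > 0, ∀ x ∈ Icc (-1 : ℝ) 1, m ≤ ‖soliton σ (ω k) (c k) x‖ ^ 2 := fun k => by
    have hcont : Continuous (soliton σ (ω k) (c k)) :=
      continuous_iff_continuousAt.2 fun x => (hasDerivAt_soliton hσ (hω k) (hc k) x).continuousAt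
    obtain ⟨z, -, hz⟩ := isCompact_Icc.exists_isMinOn (nonempty_Icc.2 (by norm_num))
      ((hcont.norm.pow 2).continuousOn (s := Icc (-1 : ℝ) 1))
    refine ⟨‖soliton σ (ω k) (c k) z‖ ^ 2, ?_, fun x hx => hz hx⟩
    rw [norm_soliton hσ (hω k) (hc k)]
    exact pow_pos (profile_pos hσ (hω k) (hc k) z) 2
  choose m hm hlow using h
  refine ⟨min (m 0) (m 1), lt_min (hm 0) (hm 1), fun k X γ x hx => ?_⟩
  have hle : ∀ k, min (m 0) (m 1) ≤ m k :=
    Fin.forall_fin_two.2 ⟨min_le_left _ _, min_le_right _ _⟩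
  rw [norm_mul, norm_exp_I_mul, mul_one]
  exact (hle k).trans (hlow k _ ⟨by linarith [hx.1], by linarith [hx.2]⟩)

/-- If each of two separated points has one of `x 0`, `x 1` near it, these are different, so both `x
0` and `x 1` are near one of the points. -/
theorem exists_forall_of_forall_exists_near {x y : Fin 2 → ℝ} {r : ℝ} (hsep : 2 * r < y 1 - y 0)
    (h : ∀ k, ∃ j, |x j - y k| ≤ r) : ∀ j, ∃ k, |x j - y k| ≤ r := by
  choose f hf using h
  have hinj : Function.Injective f := by
    have hne : f 0 ≠ f 1 := fun h01 => by
      have h0 := abs_le.1 (hf 0)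
      have h1 := abs_le.1 (hf 1)
      rw [h01] at h0
      linarith [h0.1, h0.2, h1.1, h1.2]
    intro i j hij
    fin_cases i <;> fin_cases j
    · rfl
    · exact absurd hij hne
    · exact absurd hij.symm hne
    · rfl
  intro j
  obtain ⟨k, rfl⟩ := Finite.injective_iff_surjective.1 hinj j
  exact ⟨k, hf k⟩

/-- Two decompositions of the same function into separated waves with nearby parameters and small
remainders have nearby centres, up to the order of the waves. -/
theorem exists_centre_comparison {σ : ℝ} {ω₀ c₀ : Fin 2 → ℝ} (hσ : 0 < σ) (hω : ∀ k, 0 < ω₀ k)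
    (hc : ∀ k, c₀ k ^ 2 < 4 * ω₀ k) :
    ∃ r > 0, ∃ η > 0, ∀ (v : ℝ → ℂ) (y γ₀ ω c x γ : Fin 2 → ℝ), MemLp v 2 volume →
      2 * r < y 1 - y 0 → h1Norm (fun z => v z - solitonSum σ ω₀ c₀ y γ₀ z) ≤ η →
      (∀ k, |ω k - ω₀ k| < η ∧ |c k - c₀ k| < η) →
      h1Norm (fun z => v z - solitonSum σ ω c x γ z) ≤ η → ∀ j, ∃ k, |x j - y k| ≤ r := by
  obtain ⟨η₁, hη₁, K, hK, hdec⟩ := exists_uniform_decay_pair hσ hω hc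
  obtain ⟨m, hm, hlow⟩ := exists_soliton_lower_bound hσ hω hc
  have hδ : 0 < decayRate ω₀ c₀ / 4 := by
    have := decayRate_pos hc
    positivity
  obtain ⟨r, hr, β, hβ, hnear⟩ := exists_near_centre hK hδ hm
  refine ⟨r, hr, min η₁ (√β), lt_min hη₁ (Real.sqrt_pos.2 hβ), ?_⟩
  intro v y γ₀ ω c x γ hv hsep htube hpar hε
  refine exists_forall_of_forall_exists_near hsep ?_
  have p1 := fun k => hdec k (ω k) (c k) (x k) (γ k) ((hpar k).1.trans_le (min_le_left _ _))
    ((hpar k).2.trans_le (min_le_left _ _))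
  have p0 := fun k => hdec k (ω₀ k) (c₀ k) (y k) (γ₀ k) (by simpa using hη₁) (by simpa using hη₁)
  have l1 := fun k => memLp_of_decay hδ (p1 k).1 (p1 k).2
  have l0 := fun k => memLp_of_decay hδ (p0 k).1 (p0 k).2
  have hsq : ∀ f : ℝ → ℂ, h1Norm f ≤ min η₁ (√β) → ∫ z, ‖f z‖ ^ 2 ≤ β := fun f hf => by
    refine (integral_sq_le_h1Norm_sq f).trans ?_
    calc h1Norm f ^ 2 ≤ √β ^ 2 :=
          pow_le_pow_left₀ (h1Norm_nonneg _) (hf.trans (min_le_right _ _)) 2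
      _ = β := Real.sq_sqrt hβ.le
  have b1 := hsq _ hε
  have b2 := hsq _ htube
  have e : ∀ a b c : ℝ → ℂ, (fun z => a z - (b z + c z)) = a - (b + c) := fun _ _ _ => rfl
  simp only [solitonSum_two] at b1 b2
  have n1 : MemLp (fun z => v z - (_ + _)) 2 volume := hv.sub ((l1 0).add (l1 1))
  have n2 : MemLp (fun z => v z - (_ + _)) 2 volume := hv.sub ((l0 0).add (l0 1))
  have hsep' : r < |y 1 - y 0| := lt_of_lt_of_le (by linarith) (le_abs_self _)
  refine Fin.forall_fin_two.2 ⟨?_, ?_⟩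
  · have := hnear _ _ _ _ _ _ (y 0) (x 0) (x 1) (y 1) n1 n2 b1 b2 (p1 0).2 (p1 1).2 (p0 1).2
      (fun z => by ring) (hlow 0 (y 0) (γ₀ 0)) hsep'
    rcases this with h | h
    · exact ⟨0, h⟩
    · exact ⟨1, h⟩
  · have := hnear _ _ _ _ _ _ (y 1) (x 0) (x 1) (y 0) n1 n2 b1 b2 (p1 0).2 (p1 1).2 (p0 0).2
      (fun z => by ring) (hlow 1 (y 1) (γ₀ 1)) (by rwa [abs_sub_comm])
    rcases this with h | h
    · exact ⟨0, h⟩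
    · exact ⟨1, h⟩

/-! ### The flux through a region where the solution is small -/

/-- For `2 A = B ν` the flux is, after completing the square with `w = z' - i ν z / 2`, a negative
quadratic form in `w` up to terms of relative size `|z|^{2σ}` and `S⁻²`. Here `S` is the width of the
cutoff, `y` the position relative to it, and `p`, `p₃` the values of `φ'(y)` and `φ'''(y)`. -/
theorem fluxAt_le {σ A B ν S p p₃ y M : ℝ} (hσ : 0 < σ) (hB : 0 ≤ B) (hAB : 2 * A = B * ν)
    (hν : 0 < ν) (hS : 0 < S) (hp : 0 ≤ p) (hpM : p ≤ M) (hp₃ : |p₃| ≤ M) (hy : |y| ≤ 1) {z z' : ℂ}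
    (hz : ‖z‖ ^ (2 * σ) ≤ ν * σ / (σ + 1)) :
    fluxAt σ A B (p / S) (p₃ / S ^ 3) (-p * (ν + y * (1 / (2 * S))) / S) z z' ≤
      B * M / S ^ 3 * ‖z‖ ^ 2 := by
  set w : ℂ := z' - Complex.I * ((ν / 2 : ℝ) : ℂ) * z with hw
  have hz' : z' = w + Complex.I * ((ν / 2 : ℝ) : ℂ) * z := by rw [hw]; ring
  have e1 : (starRingEnd ℂ z * z').im = (starRingEnd ℂ z * w).im + ν / 2 * ‖z‖ ^ 2 := by
    rw [hz']
    simp only [Complex.sq_norm, Complex.normSq_apply, Complex.add_re, Complex.add_im,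
      Complex.mul_re, Complex.mul_im, Complex.conj_re, Complex.conj_im, Complex.I_re,
      Complex.I_im, Complex.ofReal_re, Complex.ofReal_im]
    ring
  have e2 : ‖z'‖ ^ 2 = ‖w‖ ^ 2 + ν * (starRingEnd ℂ z * w).im + ν ^ 2 / 4 * ‖z‖ ^ 2 := by
    rw [hz']
    simp only [Complex.sq_norm, Complex.normSq_apply, Complex.add_re, Complex.add_im,
      Complex.mul_re, Complex.mul_im, Complex.conj_re, Complex.conj_im, Complex.I_re,
      Complex.I_im, Complex.ofReal_re, Complex.ofReal_im]
    ring
  have hI : |(starRingEnd ℂ z * w).im| ≤ ‖z‖ * ‖w‖ := by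
    simpa using Complex.abs_im_le_norm (starRingEnd ℂ z * w)
  have hA : A = B * ν / 2 := by linarith
  rw [fluxAt, e1, e2, hA]
  have hP0 : 0 ≤ ‖z‖ ^ (2 * σ) := Real.rpow_nonneg (norm_nonneg z) _
  have hρ0 := norm_nonneg z
  have hw0 := norm_nonneg w
  generalize ‖z‖ ^ (2 * σ) = P at *
  generalize (starRingEnd ℂ z * w).im = I at *
  generalize ‖z‖ = ρ at *
  generalize ‖w‖ = q at *
  have hI1 := (abs_le.1 hI).1
  -- the nonlinear term is absorbed because `P` is below the threshold
  have n1 : -(P * I) - P * (ν * σ / (2 * (σ + 1))) * ρ ^ 2 ≤ q ^ 2 / 2 := by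
    set l := ν * σ / (σ + 1) with hl
    have hl0 : 0 < l := by positivity
    have hl2 : ν * σ / (2 * (σ + 1)) = l / 2 := by
      rw [hl]
      field_simp
    have h1 : -(P * I) ≤ P * (ρ * q) := by
      nlinarith
    have h2 : l * (ρ * q) ≤ q ^ 2 / 2 + l ^ 2 / 2 * ρ ^ 2 := by
      nlinarith [sq_nonneg (q - l * ρ)]
    have h3 : P * (l * (ρ * q)) ≤ P * (q ^ 2 / 2 + l ^ 2 / 2 * ρ ^ 2) :=
      mul_le_mul_of_nonneg_left h2 hP0
    have h4 : P * q ^ 2 ≤ l * q ^ 2 := mul_le_mul_of_nonneg_right hz (sq_nonneg q)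
    rw [hl2]
    refine le_of_mul_le_mul_left ?_ hl0
    have h5 := mul_le_mul_of_nonneg_left h1 hl0.le
    linarith
  have n2 : y * I * (1 / (2 * S)) ≤ q ^ 2 + ρ ^ 2 / (16 * S ^ 2) := by
    have h1 : y * I ≤ ρ * q := by
      refine (le_abs_self _).trans ?_
      rw [abs_mul]
      exact (mul_le_mul hy hI (abs_nonneg _) zero_le_one).trans_eq (one_mul _)
    have h2 : y * I * (1 / (2 * S)) ≤ ρ * q * (1 / (2 * S)) :=
      mul_le_mul_of_nonneg_right h1 (by positivity)
    have h3 : q ^ 2 + ρ ^ 2 / (16 * S ^ 2) - ρ * q * (1 / (2 * S)) = (q - ρ / (4 * S)) ^ 2 := by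
      field_simp
      ring
    linarith [sq_nonneg (q - ρ / (4 * S))]
  have n3 : p₃ * ρ ^ 2 ≤ M * ρ ^ 2 :=
    mul_le_mul_of_nonneg_right ((le_abs_self _).trans hp₃) (sq_nonneg ρ)
  have n4 : p * ρ ^ 2 ≤ M * ρ ^ 2 := mul_le_mul_of_nonneg_right hpM (sq_nonneg ρ)
  have hpS : 0 ≤ B * (p / S) := by positivity
  have key : B * ν / 2 * (p / S * (2 * (I + ν / 2 * ρ ^ 2) + P * ρ ^ 2 / (σ + 1)) +
      -p * (ν + y * (1 / (2 * S))) / S * ρ ^ 2) -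
      B * (2 * (p / S) * (q ^ 2 + ν * I + ν ^ 2 / 4 * ρ ^ 2) - 1 / 2 * (p₃ / S ^ 3) * ρ ^ 2 +
        p / S * (P * (I + ν / 2 * ρ ^ 2)) +
        -p * (ν + y * (1 / (2 * S))) / S * (I + ν / 2 * ρ ^ 2)) =
      B * (p / S) * (-2 * q ^ 2 + (-(P * I) - P * (ν * σ / (2 * (σ + 1))) * ρ ^ 2) +
        y * I * (1 / (2 * S))) + B / (2 * S ^ 3) * (p₃ * ρ ^ 2) := by
    field_simp
    ring
  rw [key]
  have k1 : B * (p / S) * (-2 * q ^ 2 + (-(P * I) - P * (ν * σ / (2 * (σ + 1))) * ρ ^ 2) +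
        y * I * (1 / (2 * S))) ≤ B * (p / S) * (ρ ^ 2 / (16 * S ^ 2)) :=
    mul_le_mul_of_nonneg_left (by linarith [sq_nonneg q]) hpS
  have k2 : B * (p / S) * (ρ ^ 2 / (16 * S ^ 2)) = B / (16 * S ^ 3) * (p * ρ ^ 2) := by
    field_simp
  have k3 : B / (16 * S ^ 3) * (p * ρ ^ 2) ≤ B / (16 * S ^ 3) * (M * ρ ^ 2) :=
    mul_le_mul_of_nonneg_left n4 (by positivity)
  have k4 : B / (2 * S ^ 3) * (p₃ * ρ ^ 2) ≤ B / (2 * S ^ 3) * (M * ρ ^ 2) :=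
    mul_le_mul_of_nonneg_left n3 (by positivity)
  have k5 : B * M / S ^ 3 * ρ ^ 2 - (B / (16 * S ^ 3) * (M * ρ ^ 2) +
      B / (2 * S ^ 3) * (M * ρ ^ 2)) = 7 / 16 * (B / S ^ 3 * (M * ρ ^ 2)) := by
    field_simp
    ring
  have k6 : 0 ≤ B / S ^ 3 * (M * ρ ^ 2) := by
    have : 0 ≤ M := hp.trans hpM
    positivity
  linarith

/-- The localized functionals are differentiable, and their derivative is controlled by the mass in
the transition region of the cutoff, provided the solution is small there. -/
theorem IsSolution.exists_hasDerivWithinAt_locFunctional {σ T A B ν M a X t : ℝ} {u : ℝ → ℝ → ℂ}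
    {φ : ℝ → ℝ} (hσ : 1 ≤ σ) (hu : IsSolution σ T u) (h : IsCutoff φ) (ha : 0 < a)
    (hM : ∀ x, |deriv φ x| ≤ M) (hM₃ : ∀ x, |deriv (deriv (deriv φ)) x| ≤ M) (hB : 0 ≤ B)
    (hAB : 2 * A = B * ν) (hν : 0 < ν) (ht : t ∈ Icc 0 T)
    (hsmall : ∀ᵐ x, |x - X - ν * t| ≤ √(t + a) → ‖u t x‖ ^ (2 * σ) ≤ ν * σ / (σ + 1)) :
    ∃ J', HasDerivWithinAt (locFunctional φ a X u A B ν) J' (Icc 0 T) t ∧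
      J' ≤ B * M / √(t + a) ^ 3 * ∫ x in {x | |x - X - ν * t| ≤ √(t + a)}, ‖u t x‖ ^ 2 := by
  obtain ⟨C, hw⟩ := h.isWeight_sqrt T X ν ha
  have hder := hu.hasDerivWithinAt_weightedDensity (A := A) (B := B) hσ hw ht
  have hp := (hu.memH1 t ht).sobolevPair
  obtain ⟨hint, hflux⟩ := hp.weightedFlux_eq (A := A) (B := B) hσ (hw.d₀ t ht)
    (continuous_of_hasDerivAt (hw.d₁ t ht)) (hw.cont₃ t ht).aestronglyMeasurable
    (hw.contt t ht).aestronglyMeasurable (hw.b₀ t ht) (hw.b₁ t ht) (hw.b₃ t ht) (hw.bt t ht)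
  rw [hflux] at hder
  refine ⟨_, hder.congr (fun s hs => locFunctional_eq h (hu.memH1 s hs))
    (locFunctional_eq h (hu.memH1 t ht)), ?_⟩
  have hS : 0 < √(t + a) := Real.sqrt_pos.2 (by linarith [ht.1])
  have hmeas : MeasurableSet {x | |x - X - ν * t| ≤ √(t + a)} :=
    (isClosed_le (by fun_prop) continuous_const).measurableSet
  rw [← integral_const_mul, ← integral_indicator hmeas]
  refine integral_mono_ae hint (((integrable_sq hp.memLp).const_mul _).indicator hmeas) ?_
  filter_upwards [hsmall] with x hx
  by_cases hxr : |x - X - ν * t| ≤ √(t + a)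
  · rw [indicator_of_mem (show x ∈ {x | |x - X - ν * t| ≤ √(t + a)} from hxr)]
    refine fluxAt_le (by linarith) hB hAB hν hS (h.deriv_nonneg _) ((le_abs_self _).trans (hM _))
      (hM₃ _) ?_ (hx hxr)
    rwa [abs_div, abs_of_pos hS, div_le_one hS]
  · rw [indicator_of_notMem (show x ∉ {x | |x - X - ν * t| ≤ √(t + a)} from hxr)]
    have h1 : 1 < |(x - X - ν * t) / √(t + a)| := by
      rw [abs_div, abs_of_pos hS, one_lt_div hS]
      exact not_le.1 hxr
    have h2 : deriv φ ((x - X - ν * t) / √(t + a)) = 0 := by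
      refine h.deriv_eq_zero ?_
      rcases lt_abs.1 h1 with h3 | h3
      · exact Or.inr h3.le
      · exact Or.inl (by linarith)
    simp [fluxAt, h2, h.deriv₃_eq_zero h1]

/-! ### The differential inequality -/

/-- The mass of a localized function at distance at least `D` from its centre. -/
theorem setIntegral_sq_le_of_decay {K δ D X : ℝ} {g : ℝ → ℂ} {s : Set ℝ} (hδ : 0 < δ)
    (hg : Continuous g) (hs : MeasurableSet s)
    (hdec : ∀ x, ‖g x‖ ≤ K * Real.exp (-(δ * |x - X|))) (hD : ∀ x ∈ s, D ≤ |x - X|) :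
    ∫ x in s, ‖g x‖ ^ 2 ≤ 2 * K ^ 2 / δ * Real.exp (-(δ * D)) := by
  obtain ⟨ie, ve⟩ := integrable_exp_neg_abs hδ X
  have ie' := ie.const_mul (K ^ 2 * Real.exp (-(δ * D)))
  have hpt : ∀ x ∈ s, ‖g x‖ ^ 2 ≤ K ^ 2 * Real.exp (-(δ * D)) * Real.exp (-(δ * |x - X|)) := by
    intro x hx
    refine (pow_le_pow_left₀ (norm_nonneg _) (hdec x) 2).trans ?_
    rw [sq_decay, mul_assoc (K ^ 2), ← Real.exp_add]
    refine mul_le_mul_of_nonneg_left (Real.exp_le_exp.2 ?_) (sq_nonneg K)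
    have := mul_le_mul_of_nonneg_left (hD x hx) hδ.le
    linarith
  calc ∫ x in s, ‖g x‖ ^ 2
      ≤ ∫ x in s, K ^ 2 * Real.exp (-(δ * D)) * Real.exp (-(δ * |x - X|)) :=
        setIntegral_mono_on (integrable_sq (memLp_of_decay hδ hg hdec)).integrableOn
          ie'.integrableOn hs hpt
    _ ≤ ∫ x, K ^ 2 * Real.exp (-(δ * D)) * Real.exp (-(δ * |x - X|)) :=
        setIntegral_le_integral ie' (Eventually.of_forall fun x => by positivity)
    _ = _ := by
        rw [integral_const_mul, ve]
        ring

theorem setIntegral_sq_le_of_decomposition {K δ D X₀ X₁ : ℝ} {f e g₀ g₁ : ℝ → ℂ} {s : Set ℝ}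
    (hδ : 0 < δ) (he : MemLp e 2 volume) (h₀ : Continuous g₀) (h₁ : Continuous g₁)
    (hs : MeasurableSet s) (d₀ : ∀ x, ‖g₀ x‖ ≤ K * Real.exp (-(δ * |x - X₀|)))
    (d₁ : ∀ x, ‖g₁ x‖ ≤ K * Real.exp (-(δ * |x - X₁|))) (hf : ∀ x, f x = e x + (g₀ x + g₁ x))
    (D₀ : ∀ x ∈ s, D ≤ |x - X₀|) (D₁ : ∀ x ∈ s, D ≤ |x - X₁|) :
    ∫ x in s, ‖f x‖ ^ 2 ≤ 3 * (∫ x, ‖e x‖ ^ 2) + 12 * K ^ 2 / δ * Real.exp (-(δ * D)) := by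
  have ie := integrable_sq he
  have l0 := memLp_of_decay hδ h₀ d₀
  have l1 := memLp_of_decay hδ h₁ d₁
  have i0 := (integrable_sq l0).integrableOn (s := s)
  have i1 := (integrable_sq l1).integrableOn (s := s)
  have b0 := setIntegral_sq_le_of_decay hδ h₀ hs d₀ D₀
  have b1 := setIntegral_sq_le_of_decay hδ h₁ hs d₁ D₁
  have be : ∫ x in s, ‖e x‖ ^ 2 ≤ ∫ x, ‖e x‖ ^ 2 :=
    setIntegral_le_integral ie (Eventually.of_forall fun x => sq_nonneg _)
  have lf : MemLp f 2 volume := by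
    have : f = e + (g₀ + g₁) := funext hf
    rw [this]
    exact he.add (l0.add l1)
  have i01 : IntegrableOn (fun x => ‖g₀ x‖ ^ 2 + ‖g₁ x‖ ^ 2) s := i0.add i1
  have ie01 : IntegrableOn (fun x => ‖e x‖ ^ 2 + (‖g₀ x‖ ^ 2 + ‖g₁ x‖ ^ 2)) s :=
    ie.integrableOn.add i01
  have hpt : ∀ x ∈ s, ‖f x‖ ^ 2 ≤ 3 * (‖e x‖ ^ 2 + (‖g₀ x‖ ^ 2 + ‖g₁ x‖ ^ 2)) := fun x _ => by
    have h1 : ‖f x‖ ≤ ‖e x‖ + (‖g₀ x‖ + ‖g₁ x‖) := by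
      rw [hf]
      exact (norm_add_le _ _).trans (add_le_add_right (norm_add_le _ _) _)
    refine (pow_le_pow_left₀ (norm_nonneg _) h1 2).trans ?_
    nlinarith [sq_nonneg (‖e x‖ - ‖g₀ x‖), sq_nonneg (‖e x‖ - ‖g₁ x‖),
      sq_nonneg (‖g₀ x‖ - ‖g₁ x‖)]
  have hmono := setIntegral_mono_on (integrable_sq lf).integrableOn (ie01.const_mul 3) hs hpt
  rw [integral_const_mul, integral_add ie.integrableOn i01, integral_add i0 i1] at hmono
  have : 12 * K ^ 2 / δ * Real.exp (-(δ * D)) =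
      3 * (2 * K ^ 2 / δ * Real.exp (-(δ * D)) + 2 * K ^ 2 / δ * Real.exp (-(δ * D))) := by ring
  linarith

/-- Away from its centres, a function in the tube is small. -/
theorem exists_ae_norm_le_of_tube {σ : ℝ} {ω c : Fin 2 → ℝ} (hσ : 0 < σ) (hω : ∀ k, 0 < ω k)
    (hc : ∀ k, c k ^ 2 < 4 * ω k) :
    ∃ K > 0, ∀ (v : ℝ → ℂ) (y γ : Fin 2 → ℝ) (α : ℝ), MemH1 v →
      h1Norm (fun x => v x - solitonSum σ ω c y γ x) ≤ α →
      ∀ᵐ x, ∀ D, (∀ k, D ≤ |x - y k|) →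
        ‖v x‖ ≤ α + K * Real.exp (-(decayRate ω c / 4 * D)) := by
  obtain ⟨η, hη, K, hK, hdec⟩ := exists_uniform_decay_pair hσ hω hc
  obtain ⟨K', hK', δ', hδ', hwave⟩ := exists_isWave_pair hσ hω hc
  refine ⟨2 * K, by positivity, fun v y γ α hv hα => ?_⟩
  have hp := hv.sobolevPair.sub (((hwave 0 (y 0) (γ 0)).sobolevPair hδ').add
    ((hwave 1 (y 1) (γ 1)).sobolevPair hδ'))
  simp only [solitonSum_two] at hα
  filter_upwards [hp.ae_norm_le] with x hx D hD
  have hk : ∀ k, ‖soliton σ (ω k) (c k) (x - y k) *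
      Complex.exp (Complex.I * ((γ k : ℝ) : ℂ))‖ ≤ K * Real.exp (-(decayRate ω c / 4 * D)) := by
    intro k
    refine ((hdec k (ω k) (c k) (y k) (γ k) (by simpa using hη) (by simpa using hη)).2 x).trans
      (mul_le_mul_of_nonneg_left (Real.exp_le_exp.2 ?_) hK.le)
    have h1 := decayRate_pos hc
    have := mul_le_mul_of_nonneg_left (hD k) (show 0 ≤ decayRate ω c / 4 by positivity)
    linarith
  have h0 := hk 0
  have h1 := hk 1
  have hx' := hx.trans hα
  generalize soliton σ (ω 0) (c 0) (x - y 0) * Complex.exp (Complex.I * ((γ 0 : ℝ) : ℂ)) = R₀ at *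
  generalize soliton σ (ω 1) (c 1) (x - y 1) * Complex.exp (Complex.I * ((γ 1 : ℝ) : ℂ)) = R₁ at *
  have e : v x = (v x - (R₀ + R₁)) + (R₀ + R₁) := by ring
  have n1 := norm_add_le (v x - (R₀ + R₁)) (R₀ + R₁)
  have n2 := norm_add_le R₀ R₁
  rw [← e] at n1
  linarith

theorem sqrt_add_sq_div_le {L t : ℝ} (hL : 0 < L) (ht : 0 ≤ t) :
    √(t + L ^ 2 / 64) ≤ L / 8 + 4 / L * t := by
  -- the concave function `√(t + a)` lies below its tangent at `t = 0`
  rw [Real.sqrt_le_left (by positivity)]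
  have h : (L / 8 + 4 / L * t) ^ 2 = L ^ 2 / 64 + t + (4 / L * t) ^ 2 := by
    field_simp
    ring
  rw [h]
  linarith [sq_nonneg (4 / L * t)]

/-- The transition region of the cutoff recedes from both waves. -/
theorem add_le_abs_sub_of_mem_region {L t x x₀ x₁ y₀ y₁ ν c₀ c₁ gap d W₀ W₁ r : ℝ} (hL : 0 < L)
    (ht : 0 ≤ t) (hx : |x - (x₀ + x₁) / 2 - ν * t| ≤ √(t + L ^ 2 / 64)) (hsep : L < x₁ - x₀)
    (hy₀ : y₀ < x₀ + 2 * W₀ + (c₀ + d) * t) (hy₁ : x₁ - 2 * W₁ + (c₁ - d) * t < y₁)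
    (g₀ : gap ≤ ν - c₀) (g₁ : gap ≤ c₁ - ν) (hd : d ≤ gap / 4) (hLg : 4 / L ≤ gap / 4)
    (hW₀ : 2 * W₀ + r ≤ L / 8) (hW₁ : 2 * W₁ + r ≤ L / 8) :
    L / 4 + gap / 2 * t + r ≤ |x - y₀| ∧ L / 4 + gap / 2 * t + r ≤ |x - y₁| := by
  have h1 := abs_le.1 (hx.trans (sqrt_add_sq_div_le hL ht))
  have h2 := mul_le_mul_of_nonneg_right g₀ ht
  have h3 := mul_le_mul_of_nonneg_right g₁ ht
  have h4 := mul_le_mul_of_nonneg_right hd ht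
  have h5 := mul_le_mul_of_nonneg_right hLg ht
  constructor
  · refine le_trans ?_ (le_abs_self _)
    linarith [h1.1]
  · rw [abs_sub_comm]
    refine le_trans ?_ (le_abs_self _)
    linarith [h1.2]

/-- The differential inequality for a functional with `2 A = B ν` whose cutoff moves with a velocity
`ν` at distance at least `gap` from those of the waves. -/
theorem exists_locFunctional_estimate {σ g ν₁ Bm : ℝ} {φ : ℝ → ℝ} {ω₀ c₀ : Fin 2 → ℝ}
    (hσ : 1 ≤ σ) (h : IsCutoff φ) (hω : ∀ k, 0 < ω₀ k) (hc : ∀ k, c₀ k ^ 2 < 4 * ω₀ k)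
    (hg : 0 < g) (hν₁ : 0 < ν₁) (hBm : 0 < Bm) (hgc : g ≤ c₀ 1 - c₀ 0) :
    ∃ α₀ > 0, ∃ η > 0, ∃ L₀ > 0, ∃ C > 0,
      ∀ α L T : ℝ, 0 < α → α < α₀ → L₀ < L → 0 < T →
      ∀ u : ℝ → ℝ → ℂ, IsSolution σ T u → ∀ x₀ γ₀ : Fin 2 → ℝ, L < x₀ 1 - x₀ 0 →
      h1Norm (fun y => u 0 y - solitonSum σ ω₀ c₀ x₀ γ₀ y) < α →
      (∀ t ∈ Ioc 0 T, u t ∈ tube σ ω₀ c₀ α (L / 2)) →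
      ∀ ω c x γ : ℝ → Fin 2 → ℝ, ∀ ε : ℝ → ℝ → ℂ,
      (∀ t y, ε t y = u t y - solitonSum σ (ω t) (c t) (x t) (γ t) y) →
      (∀ t ∈ Icc 0 T, h1Norm (ε t) + ∑ k, (|ω t k - ω₀ k| + |c t k - c₀ k|) < η) →
      ∀ A B ν gap : ℝ, 0 ≤ B → B ≤ Bm → 2 * A = B * ν → ν₁ ≤ ν → g ≤ gap → gap ≤ ν - c₀ 0 →
      gap ≤ c₀ 1 - ν → ∀ t ∈ Icc 0 T,
      ∃ J', HasDerivWithinAt (locFunctional φ (L ^ 2 / 64) ((x₀ 0 + x₀ 1) / 2) u A B ν) J'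
        (Icc 0 T) t ∧ J' ≤ C / √(t + L ^ 2 / 64) ^ 3 * (h1Norm (ε t) ^ 2 +
          Real.exp (-(decayRate ω₀ c₀ / 4 * (L / 4 + gap / 2 * t)))) := by
  have hσ0 : 0 < σ := by linarith
  set δ := decayRate ω₀ c₀ / 4 with hδd
  have hδ : 0 < δ := by
    have := decayRate_pos hc
    positivity
  obtain ⟨M, hM1, hM, -, hM₃⟩ := h.exists_deriv_bound
  -- lines slightly faster than the left wave and slightly slower than the right one separate the
  -- centres of the tube from the transition region
  obtain ⟨αl, hαl, Wl, hWl, Ll, hLl, hleft⟩ := exists_crossing_bound (ν := c₀ 0 + g / 4) hσ h hω hc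
    (by linarith) (by linarith)
  obtain ⟨αr, hαr, Wr, hWr, Lr, hLr, hright⟩ := exists_crossing_bound (ν := c₀ 1 - g / 4) hσ h hω
    hc (by linarith) (by linarith)
  obtain ⟨r, hr, η₁, hη₁, hcomp⟩ := exists_centre_comparison hσ0 hω hc
  obtain ⟨η₂, hη₂, K, hK, hdec⟩ := exists_uniform_decay_pair hσ0 hω hc
  obtain ⟨K', hK', hsm⟩ := exists_ae_norm_le_of_tube hσ0 hω hc
  -- the size below which the nonlinear term of the flux is absorbed
  set s₀ := (ν₁ * σ / (σ + 1)) ^ (1 / (2 * σ)) with hs₀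
  have hthr : 0 < ν₁ * σ / (σ + 1) := by positivity
  have hs₀0 : 0 < s₀ := Real.rpow_pos_of_pos hthr _
  have hs₀p : s₀ ^ (2 * σ) = ν₁ * σ / (σ + 1) := by
    rw [hs₀, ← Real.rpow_mul hthr.le, one_div_mul_cancel (by positivity), Real.rpow_one]
  obtain ⟨Ls, hLs⟩ : ∃ Ls, ∀ L, Ls ≤ L → K' * Real.exp (-(δ * (L / 4))) ≤ s₀ / 2 := by
    have h1 : Tendsto (fun L => K' * Real.exp (-(δ * (L / 4)))) atTop (𝓝 (K' * 0)) :=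
      (Real.tendsto_exp_neg_atTop_nhds_zero.comp
        ((tendsto_id.atTop_div_const (by norm_num : (0 : ℝ) < 4)).const_mul_atTop hδ)).const_mul K'
    have h2 : K' * 0 < s₀ / 2 := by
      rw [mul_zero]
      exact half_pos hs₀0
    obtain ⟨Ls, h3⟩ := (h1.eventually (gt_mem_nhds h2)).exists_forall_of_atTop
    exact ⟨Ls, fun L hL => (h3 L hL).le⟩
  refine ⟨min (min αl αr) (min η₁ (s₀ / 2)), lt_min (lt_min hαl hαr) (lt_min hη₁ (half_pos hs₀0)),
    min η₁ η₂, lt_min hη₁ hη₂,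
    max (max (2 * Ll) (2 * Lr)) (max (max (8 * (2 * Wl + r)) (8 * (2 * Wr + r)))
      (max (16 / g) Ls)), lt_max_of_lt_left (lt_max_of_lt_left (by positivity)),
    Bm * M * (3 + 12 * K ^ 2 / δ), by positivity, ?_⟩
  intro α L T hα hαα hLL hT u hu x₀ γ₀ hx₀ hu₀ htube ω c x γ ε hε hη A B ν gap hB hBB hAB hν hgg
    hg₀ hg₁ t ht
  simp only [lt_min_iff] at hαα
  simp only [max_lt_iff] at hLL
  obtain ⟨⟨hα1, hα2⟩, hα3, hα4⟩ := hαα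
  obtain ⟨⟨hL1, hL2⟩, ⟨hL3, hL4⟩, hL5, hL6⟩ := hLL
  have hL : 0 < L := by linarith
  have hν0 : 0 < ν := hν₁.trans_le hν
  -- centres for the tube, starting at the given ones
  obtain ⟨y, γ', hy, hy0⟩ : ∃ y γ' : ℝ → Fin 2 → ℝ, (∀ t ∈ Icc 0 T, L / 2 < y t 1 - y t 0 ∧
      h1Norm (fun z => u t z - solitonSum σ ω₀ c₀ (y t) (γ' t) z) ≤ α) ∧ y 0 = x₀ := by
    have hex : ∀ t, ∃ y γ' : Fin 2 → ℝ, (t ∈ Icc 0 T → L / 2 < y 1 - y 0 ∧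
        h1Norm (fun z => u t z - solitonSum σ ω₀ c₀ y γ' z) ≤ α) ∧ (t = 0 → y = x₀) := fun t => by
      rcases eq_or_ne t 0 with rfl | hne
      · exact ⟨x₀, γ₀, fun _ => ⟨by linarith, hu₀.le⟩, fun _ => rfl⟩
      by_cases hmem : t ∈ Icc 0 T
      · obtain ⟨-, -, y, γ', h1, h2⟩ := htube t ⟨lt_of_le_of_ne hmem.1 hne.symm, hmem.2⟩
        exact ⟨y, γ', fun _ => ⟨h1, h2.le⟩, fun h0 => absurd h0 hne⟩
      · exact ⟨x₀, γ₀, fun h0 => absurd h0 hmem, fun h0 => absurd h0 hne⟩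
    choose y γ' h1 h2 using hex
    exact ⟨y, γ', h1, h2 0 rfl⟩
  have hl := (hleft α (L / 2) T hα hα1.le (by linarith) hT.le u hu y γ' hy (x₀ 0 + Wl)
    (by rw [hy0]; linarith) (by rw [hy0]; linarith) t ht).1
  have hrt := (hright α (L / 2) T hα hα2.le (by linarith) hT.le u hu y γ' hy (x₀ 1 - Wr)
    (by rw [hy0]; linarith) (by rw [hy0]; linarith) t ht).2
  have hLg : 4 / L ≤ gap / 4 := by
    rw [div_lt_iff₀ hg] at hL5
    rw [div_le_iff₀ hL]
    have := mul_le_mul_of_nonneg_right hgg hL.le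
    linarith
  have hreg : ∀ z, |z - (x₀ 0 + x₀ 1) / 2 - ν * t| ≤ √(t + L ^ 2 / 64) →
      ∀ k, L / 4 + gap / 2 * t + r ≤ |z - y t k| := fun z hz => by
    have := add_le_abs_sub_of_mem_region (r := r) hL ht.1 hz hx₀ (y₀ := y t 0) (y₁ := y t 1)
      (c₀ := c₀ 0) (c₁ := c₀ 1) (gap := gap) (d := g / 4) (W₀ := Wl) (W₁ := Wr) (by linarith)
      (by linarith) hg₀ hg₁ (by linarith) hLg (by linarith) (by linarith)
    exact Fin.forall_fin_two.2 this
  have hgt : 0 ≤ gap / 2 * t := mul_nonneg (by linarith) ht.1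
  have hsmall : ∀ᵐ z, |z - (x₀ 0 + x₀ 1) / 2 - ν * t| ≤ √(t + L ^ 2 / 64) →
      ‖u t z‖ ^ (2 * σ) ≤ ν * σ / (σ + 1) := by
    filter_upwards [hsm (u t) (y t) (γ' t) α (hu.memH1 t ht) (hy t ht).2] with z hz hzr
    have h1 := hz (L / 4) fun k => by linarith [hreg z hzr k]
    have h2 := hLs L hL6.le
    calc ‖u t z‖ ^ (2 * σ) ≤ s₀ ^ (2 * σ) :=
          Real.rpow_le_rpow (norm_nonneg _) (by linarith) (by positivity)
      _ = ν₁ * σ / (σ + 1) := hs₀p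
      _ ≤ ν * σ / (σ + 1) := by gcongr
  obtain ⟨J', hJ', hJ'le⟩ := hu.exists_hasDerivWithinAt_locFunctional hσ h
    (show 0 < L ^ 2 / 64 by positivity) hM hM₃ hB hAB hν0 ht hsmall
  refine ⟨J', hJ', hJ'le.trans ?_⟩
  -- the parameters and the remainder of the given decomposition
  have hηt := hη t ht
  rw [Fin.sum_univ_two] at hηt
  have hn := h1Norm_nonneg (ε t)
  have a1 := abs_nonneg (ω t 0 - ω₀ 0)
  have a2 := abs_nonneg (ω t 1 - ω₀ 1)
  have a3 := abs_nonneg (c t 0 - c₀ 0)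
  have a4 := abs_nonneg (c t 1 - c₀ 1)
  have hpar : ∀ k, |ω t k - ω₀ k| < min η₁ η₂ ∧ |c t k - c₀ k| < min η₁ η₂ :=
    Fin.forall_fin_two.2 ⟨⟨by linarith, by linarith⟩, ⟨by linarith, by linarith⟩⟩
  have hεt : ε t = fun z => u t z - solitonSum σ (ω t) (c t) (x t) (γ t) z := funext (hε t)
  have hεη : h1Norm (fun z => u t z - solitonSum σ (ω t) (c t) (x t) (γ t) z) ≤ η₁ := by
    rw [← hεt]
    linarith [min_le_left η₁ η₂]
  have hnear := hcomp (u t) (y t) (γ' t) (ω t) (c t) (x t) (γ t) (hu.memH1 t ht).1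
    (by linarith [(hy t ht).1]) ((hy t ht).2.trans hα3.le)
    (fun k => ⟨(hpar k).1.trans_le (min_le_left _ _), (hpar k).2.trans_le (min_le_left _ _)⟩) hεη
  have hfar : ∀ j, ∀ z ∈ {z | |z - (x₀ 0 + x₀ 1) / 2 - ν * t| ≤ √(t + L ^ 2 / 64)},
      L / 4 + gap / 2 * t ≤ |z - x t j| := fun j z hz => by
    obtain ⟨k, hk⟩ := hnear j
    have h1 := hreg z hz k
    have h2 := abs_sub_le z (x t j) (y t k)
    linarith
  have hw := fun k => hdec k (ω t k) (c t k) (x t k) (γ t k)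
    ((hpar k).1.trans_le (min_le_right _ _)) ((hpar k).2.trans_le (min_le_right _ _))
  have hεL : MemLp (ε t) 2 volume := by
    rw [hεt]
    simp only [solitonSum_two]
    exact (hu.memH1 t ht).1.sub ((memLp_of_decay hδ (hw 0).1 (hw 0).2).add
      (memLp_of_decay hδ (hw 1).1 (hw 1).2))
  have hmeas : MeasurableSet {z | |z - (x₀ 0 + x₀ 1) / 2 - ν * t| ≤ √(t + L ^ 2 / 64)} :=
    (isClosed_le (by fun_prop) continuous_const).measurableSet
  have hmass := setIntegral_sq_le_of_decomposition (f := u t) hδ hεL (hw 0).1 (hw 1).1 hmeas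
    (hw 0).2 (hw 1).2 (fun z => by rw [hε, solitonSum_two]; ring) (hfar 0) (hfar 1)
  have hsq := integral_sq_le_h1Norm_sq (ε t)
  have hS : 0 < √(t + L ^ 2 / 64) := Real.sqrt_pos.2 (by have := ht.1; positivity)
  have hM0 : 0 < M := by linarith
  have hE := (Real.exp_pos (-(δ * (L / 4 + gap / 2 * t)))).le
  have hKδ : 0 ≤ 12 * K ^ 2 / δ := by positivity
  generalize Real.exp (-(δ * (L / 4 + gap / 2 * t))) = E at *
  calc B * M / √(t + L ^ 2 / 64) ^ 3 *
        ∫ z in {z | |z - (x₀ 0 + x₀ 1) / 2 - ν * t| ≤ √(t + L ^ 2 / 64)}, ‖u t z‖ ^ 2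
      ≤ Bm * M / √(t + L ^ 2 / 64) ^ 3 * (3 * h1Norm (ε t) ^ 2 + 12 * K ^ 2 / δ * E) := by
        refine mul_le_mul ?_ (hmass.trans (by linarith)) (integral_nonneg fun z => sq_nonneg _)
          (by positivity)
        gcongr
    _ ≤ Bm * M / √(t + L ^ 2 / 64) ^ 3 * ((3 + 12 * K ^ 2 / δ) * (h1Norm (ε t) ^ 2 + E)) := by
        refine mul_le_mul_of_nonneg_left ?_ (by positivity)
        have := mul_nonneg hKδ (sq_nonneg (h1Norm (ε t)))
        linarith
    _ = _ := by ring

/-! ### Integration in time -/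

/-- Comparison with the primitive `-2 D / √(s + a)` of `D / √(s + a)³`. -/
theorem sub_le_of_deriv_le_inv_sqrt_cube {F F' : ℝ → ℝ} {t a D : ℝ} (ht : 0 ≤ t) (ha : 0 < a)
    (hD : 0 ≤ D) (hc : ContinuousOn F (Icc 0 t)) (hd : ∀ s ∈ Ioo 0 t, HasDerivAt F (F' s) s)
    (hle : ∀ s ∈ Ioo 0 t, F' s ≤ D / √(s + a) ^ 3) : F t - F 0 ≤ 2 * D / √a := by
  have hS : ∀ s, 0 ≤ s → 0 < √(s + a) := fun s hs => Real.sqrt_pos.2 (by linarith)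
  have hder : ∀ s ∈ Ioo 0 t, HasDerivAt (fun s => F s + 2 * D / √(s + a))
      (F' s - D / √(s + a) ^ 3) s := fun s hs => by
    have h1 := hS s hs.1.le
    have h2 : HasDerivAt (fun s => √(s + a)) (1 / (2 * √(s + a))) s :=
      ((hasDerivAt_id s).add_const a).sqrt (by have := hs.1; simp only [id]; linarith)
    refine ((hd s hs).add ((hasDerivAt_const s (2 * D)).div h2 h1.ne')).congr_deriv ?_
    field_simp
    ring
  have hanti : AntitoneOn (fun s => F s + 2 * D / √(s + a)) (Icc 0 t) := by
    refine antitoneOn_of_deriv_nonpos (convex_Icc 0 t) (hc.add ?_) ?_ ?_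
    · exact continuousOn_const.div (by fun_prop) fun s hs => (hS s hs.1).ne'
    · rw [interior_Icc]
      exact fun s hs => (hder s hs).differentiableAt.differentiableWithinAt
    · rw [interior_Icc]
      intro s hs
      rw [(hder s hs).deriv]
      linarith [hle s hs]
  have h1 := hanti (left_mem_Icc.2 ht) (right_mem_Icc.2 ht) ht
  simp only [zero_add] at h1
  have h2 : 0 ≤ 2 * D / √(t + a) := div_nonneg (by positivity) (hS t ht).le
  linarith

/-- The differential inequality integrates to almost monotonicity, since `(t + a)^{-3/2}` has
integral `2 a^{-1/2}` on the half line and `a = L² / 64`. -/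
theorem sub_le_of_differential_inequality {F n : ℝ → ℝ} {T C L κ gap θ N : ℝ} (hC : 0 ≤ C)
    (hL : 1 ≤ L) (hκ : 0 ≤ κ) (hgap : 0 ≤ gap) (hθ : θ ≤ κ / 64)
    (hn : ∀ t ∈ Icc 0 T, n t ^ 2 ≤ N)
    (hF : ∀ t ∈ Icc 0 T, ∃ J', HasDerivWithinAt F J' (Icc 0 T) t ∧
      J' ≤ C / √(t + L ^ 2 / 64) ^ 3 * (n t ^ 2 + Real.exp (-(κ / 4 * (L / 4 + gap / 2 * t))))) :
    ∀ t ∈ Icc 0 T, F t - F 0 ≤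
      16 * C / L * (⨆ s : Ioo (0 : ℝ) t, n s ^ 2) + 16 * C * Real.exp (-θ * L) := by
  intro t ht
  have hL0 : 0 < L := by linarith
  set S := ⨆ s : Ioo (0 : ℝ) t, n s ^ 2 with hSd
  have hS0 : 0 ≤ S := Real.iSup_nonneg fun s => sq_nonneg _
  have hbdd : BddAbove (range fun s : Ioo (0 : ℝ) t => n s ^ 2) := by
    refine ⟨N, ?_⟩
    rintro _ ⟨s, rfl⟩
    exact hn s ⟨s.2.1.le, s.2.2.le.trans ht.2⟩
  have hSle : ∀ s ∈ Ioo 0 t, n s ^ 2 ≤ S := fun s hs => le_ciSup hbdd ⟨s, hs⟩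
  set E := Real.exp (-θ * L) with hE
  have hE0 : 0 < E := Real.exp_pos _
  have hElt : ∀ s, 0 ≤ s → Real.exp (-(κ / 4 * (L / 4 + gap / 2 * s))) ≤ E := fun s hs => by
    refine Real.exp_le_exp.2 ?_
    have h1 : 0 ≤ κ / 4 * (gap / 2 * s) := by positivity
    have h2 := mul_le_mul_of_nonneg_right hθ hL0.le
    have h3 : 0 ≤ κ * L := by positivity
    linarith
  choose! F' hF' hle using hF
  have hmain := sub_le_of_deriv_le_inv_sqrt_cube (F := F) (F' := F') (t := t) (a := L ^ 2 / 64)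
    (D := C * (S + E)) ht.1 (by positivity) (by positivity)
    (fun s hs => ((hF' s ⟨hs.1, hs.2.trans ht.2⟩).continuousWithinAt).mono
      (Icc_subset_Icc_right ht.2))
    (fun s hs => (hF' s ⟨hs.1.le, hs.2.le.trans ht.2⟩).hasDerivAt
      (Icc_mem_nhds hs.1 (hs.2.trans_le ht.2)))
    (fun s hs => by
      refine (hle s ⟨hs.1.le, hs.2.le.trans ht.2⟩).trans ?_
      rw [mul_div_right_comm]
      exact mul_le_mul_of_nonneg_left (add_le_add (hSle s hs) (hElt s hs.1.le)) (by positivity))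
  have hsq : √(L ^ 2 / 64) = L / 8 := by
    rw [show L ^ 2 / 64 = (L / 8) ^ 2 by ring]
    exact Real.sqrt_sq (by positivity)
  rw [hsq] at hmain
  refine hmain.trans ?_
  have h1 : 2 * (C * (S + E)) / (L / 8) = 16 * C / L * S + 16 * C * E / L := by
    field_simp
    ring
  rw [h1]
  gcongr
  exact div_le_self (by positivity) hL

/-- The exponential error of the differential inequality in terms of a rate `θ` limited both by the
decay of the waves and by the gap between the velocities. -/
theorem exp_neg_region_le {κ L gap t θ : ℝ} (hL : 0 ≤ L) (ht : 0 ≤ t) (hκ : 0 ≤ κ) (hθ : 0 ≤ θ)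
    (hgap : 0 ≤ gap) (hθκ : θ ≤ κ / 64) (hθg : θ ≤ 4 * gap) :
    Real.exp (-(κ / 4 * (L / 4 + gap / 2 * t))) ≤ Real.exp (-θ * (L + θ * t)) := by
  refine Real.exp_le_exp.2 ?_
  have h1 : θ * θ ≤ κ / 64 * (4 * gap) := mul_le_mul hθκ hθg hθ (by positivity)
  have h2 := mul_le_mul_of_nonneg_right h1 ht
  have h3 := mul_le_mul_of_nonneg_right hθκ hL
  have h4 : 0 ≤ κ * L := by positivity
  have h5 : 0 ≤ κ * gap * t := by positivity
  nlinarith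

theorem sqrt_cube_eq_rpow {x : ℝ} (hx : 0 ≤ x) : √x ^ 3 = x ^ (3 / 2 : ℝ) := by
  rw [Real.sqrt_eq_rpow, ← Real.rpow_natCast, ← Real.rpow_mul hx]
  norm_num

/-! ### The parameters -/

theorem pos_and_sq_lt_of_stable {ω c z : ℝ} (hz : z < 1) (h₁ : -2 * √ω < c) (h₂ : c < 2 * z * √ω) :
    0 < ω ∧ c ^ 2 < 4 * ω := by
  have h0 : 0 < √ω := by
    refine lt_of_le_of_ne (Real.sqrt_nonneg ω) fun h => ?_
    rw [← h] at h₁ h₂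
    linarith
  have hω : 0 < ω := Real.sqrt_pos.1 h0
  refine ⟨hω, ?_⟩
  have h3 := Real.sq_sqrt hω.le
  have h4 : c < 2 * √ω := by nlinarith
  nlinarith

/-- The slope `Δω / Δc` is stable under small changes of the parameters. -/
theorem exists_slope_bound {ω₀ c₀ : Fin 2 → ℝ} {m τ : ℝ} (hc : c₀ 0 < c₀ 1) (hm : 0 < m)
    (hslope : ω₀ 1 - ω₀ 0 = m * (c₀ 1 - c₀ 0)) (hτ : 0 < τ) :
    ∃ η > 0, ∀ ω c : Fin 2 → ℝ, (∑ k, (|ω k - ω₀ k| + |c k - c₀ k|) < η) →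
      0 < c 1 - c 0 ∧ c 1 - c 0 ≤ c₀ 1 - c₀ 0 + 1 ∧ |(ω 1 - ω 0) / (c 1 - c 0) - m| ≤ τ := by
  have hd : 0 < c₀ 1 - c₀ 0 := by linarith
  refine ⟨min (min 1 ((c₀ 1 - c₀ 0) / 2)) (τ * (c₀ 1 - c₀ 0) / (2 * (1 + m))),
    lt_min (lt_min one_pos (by positivity)) (by positivity), fun ω c h => ?_⟩
  rw [Fin.sum_univ_two] at h
  simp only [lt_min_iff] at h
  obtain ⟨⟨h1, h2⟩, h3⟩ := h
  rw [lt_div_iff₀ (by positivity)] at h3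
  have a1 := abs_nonneg (ω 0 - ω₀ 0)
  have a2 := abs_nonneg (ω 1 - ω₀ 1)
  have b1 := abs_le.1 (le_refl |c 0 - c₀ 0|)
  have b2 := abs_le.1 (le_refl |c 1 - c₀ 1|)
  have e1 := abs_le.1 (le_refl |ω 0 - ω₀ 0|)
  have e2 := abs_le.1 (le_refl |ω 1 - ω₀ 1|)
  have a3 := abs_nonneg (c 0 - c₀ 0)
  have a4 := abs_nonneg (c 1 - c₀ 1)
  generalize |ω 0 - ω₀ 0| = A₀ at *
  generalize |ω 1 - ω₀ 1| = A₁ at *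
  generalize |c 0 - c₀ 0| = B₀ at *
  generalize |c 1 - c₀ 1| = B₁ at *
  have hΔ : (c₀ 1 - c₀ 0) / 2 ≤ c 1 - c 0 := by linarith [b1.1, b1.2, b2.1, b2.2]
  have hpos : 0 < c 1 - c 0 := by linarith
  refine ⟨hpos, by linarith [b1.1, b1.2, b2.1, b2.2], ?_⟩
  rw [show (ω 1 - ω 0) / (c 1 - c 0) - m = ((ω 1 - ω 0) - m * (c 1 - c 0)) / (c 1 - c 0) by
    field_simp, abs_div, abs_of_pos hpos, div_le_iff₀ hpos]
  have hnum : |(ω 1 - ω 0) - m * (c 1 - c 0)| ≤ (A₀ + B₀ + (A₁ + B₁)) * (1 + m) := by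
    have m1 := mul_le_mul_of_nonneg_left b1.1 hm.le
    have m2 := mul_le_mul_of_nonneg_left b1.2 hm.le
    have m3 := mul_le_mul_of_nonneg_left b2.1 hm.le
    have m4 := mul_le_mul_of_nonneg_left b2.2 hm.le
    have m5 := mul_nonneg hm.le a1
    have m6 := mul_nonneg hm.le a2
    rw [abs_le]
    constructor <;> linarith [e1.1, e1.2, e2.1, e2.2]
  have := mul_le_mul_of_nonneg_left hΔ hτ.le
  linarith

end

end GDNLS

/-- Almost monotonicity of the localized mass-momentum functionals. The remainder `ε` is that of an
arbitrary decomposition of `u` into two modulated solitary waves with parameters near `ω₀, c₀` and a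
small remainder; neither orthogonality conditions nor regularity in time of the parameters are
required, so the decomposition fixed by the usual orthogonality conditions is included. -/
theorem proposition4p3
    (σ z₀ : ℝ) (hσ : σ ∈ Set.Ioo (1 : ℝ) 2) (hz₀ : z₀ ∈ Set.Ioo (0 : ℝ) 1)
    (hF : GDNLS.stabilityF z₀ σ = 0)
    (ω₀ c₀ : Fin 2 → ℝ)
    (hstab : ∀ k, -2 * Real.sqrt (ω₀ k) < c₀ k ∧ c₀ k < 2 * z₀ * Real.sqrt (ω₀ k))
    (htech : 0 < (ω₀ 1 - ω₀ 0) / (c₀ 1 - c₀ 0))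
    (hspeed₁ : c₀ 0 < (ω₀ 1 - ω₀ 0) / (c₀ 1 - c₀ 0))
    (hspeed₂ : 4 * ((ω₀ 1 - ω₀ 0) / (c₀ 1 - c₀ 0)) < c₀ 1)
    (φ : ℝ → ℝ) (hφ : GDNLS.IsCutoff φ) :
    ∃ α₀ > 0, ∃ η > 0, ∃ L₀ > 0, ∃ C > 0,
      ∀ α L T : ℝ, 0 < α → α < α₀ → L₀ < L → 0 < T →
      ∀ u : ℝ → ℝ → ℂ, GDNLS.IsSolution σ T u →
      -- `u(0)` is in the tube of size `α` with separation `L`, with centres `x₀ 0`, `x₀ 1`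
      ∀ x₀ γ₀ : Fin 2 → ℝ, L < x₀ 1 - x₀ 0 →
      GDNLS.h1Norm (fun y => u 0 y - GDNLS.solitonSum σ ω₀ c₀ x₀ γ₀ y) < α →
      (∀ t ∈ Set.Ioc 0 T, u t ∈ GDNLS.tube σ ω₀ c₀ α (L / 2)) →
      -- a decomposition of `u` near the two solitary waves, with remainder `ε`
      ∀ ω c x γ : ℝ → Fin 2 → ℝ, ∀ ε : ℝ → ℝ → ℂ,
      (∀ t y, ε t y = u t y - GDNLS.solitonSum σ (ω t) (c t) (x t) (γ t) y) →
      (∀ t ∈ Set.Icc 0 T,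
        GDNLS.h1Norm (ε t) + ∑ k, (|ω t k - ω₀ k| + |c t k - c₀ k|) < η) →
      let Δω : ℝ := ω 0 1 - ω 0 0
      let Δc : ℝ := c 0 1 - c 0 0
      let μ : ℝ := 2 * (Δω / Δc)
      let κ : Fin 2 → ℝ := fun k => Real.sqrt (4 * ω₀ k - c₀ k ^ 2)
      let θ₃ : ℝ := min (min (κ 0 / 64) (κ 1 / 64)) (min (4 * (μ - c₀ 0)) (4 * (c₀ 1 - μ)))
      let θ₄ : ℝ :=
        min (min (κ 0 / 64) (κ 1 / 64)) (min (μ - 2 * c₀ 0) (4 * c₀ 1 - 2 * μ))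
      let a : ℝ := L ^ 2 / 64
      let xbar : ℝ := (x₀ 0 + x₀ 1) / 2
      let J : ℝ → ℝ := GDNLS.locFunctional φ a xbar u (Δω / 2) (Δc / 2) μ
      let Jp0 : ℝ → ℝ := GDNLS.locFunctional φ a xbar u Δω (Δc / 2) (4 * (Δω / Δc))
      let Jm0 : ℝ → ℝ := GDNLS.locFunctional φ a xbar u (Δω / 4) (Δc / 2) (Δω / Δc)
      let J0p : ℝ → ℝ := GDNLS.locFunctional φ a xbar u (Δω / 2) Δc (Δω / Δc)
      let J0m : ℝ → ℝ := GDNLS.locFunctional φ a xbar u (Δω / 2) (Δc / 4) (4 * (Δω / Δc))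
      let S : ℝ → ℝ := fun t => ⨆ s : Set.Ioo (0 : ℝ) t, GDNLS.h1Norm (ε s) ^ 2
      -- the differential inequality
      (∀ t ∈ Set.Icc 0 T, ∃ J' : ℝ, HasDerivWithinAt J J' (Set.Icc 0 T) t ∧
        J' ≤ C / (t + a) ^ (3 / 2 : ℝ) * GDNLS.h1Norm (ε t) ^ 2
          + C / (t + a) ^ (3 / 2 : ℝ) * Real.exp (-θ₃ * (L + θ₃ * t))) ∧
      -- almost monotonicity along the five lines
      (∀ t ∈ Set.Icc 0 T,
        J t - J 0 ≤ C / L * S t + C * Real.exp (-θ₃ * L) ∧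
        Jp0 t - Jp0 0 ≤ C / L * S t + C * Real.exp (-θ₄ * L) ∧
        Jm0 t - Jm0 0 ≤ C / L * S t + C * Real.exp (-θ₄ * L) ∧
        J0p t - J0p 0 ≤ C / L * S t + C * Real.exp (-θ₄ * L) ∧
        J0m t - J0m 0 ≤ C / L * S t + C * Real.exp (-θ₄ * L)) := by
  set m := (ω₀ 1 - ω₀ 0) / (c₀ 1 - c₀ 0) with hm
  have hω : ∀ k, 0 < ω₀ k := fun k =>
    (GDNLS.pos_and_sq_lt_of_stable hz₀.2 (hstab k).1 (hstab k).2).1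
  have hc : ∀ k, c₀ k ^ 2 < 4 * ω₀ k := fun k =>
    (GDNLS.pos_and_sq_lt_of_stable hz₀.2 (hstab k).1 (hstab k).2).2
  have hc01 : c₀ 0 < c₀ 1 := by linarith
  have hslope : ω₀ 1 - ω₀ 0 = m * (c₀ 1 - c₀ 0) := by
    rw [hm, div_mul_cancel₀ _ (by linarith : c₀ 1 - c₀ 0 ≠ 0)]
  -- the velocities `q, 2 q, 4 q` of the cutoffs stay away from `0`, `c₀ 0` and `c₀ 1` if the slope
  -- `q` is within `τ` of `m`
  obtain ⟨τ, hτ, hτ₀, hτ₁, hτm⟩ : ∃ τ > 0, 8 * τ ≤ m - c₀ 0 ∧ 8 * τ ≤ c₀ 1 - 4 * m ∧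
      8 * τ ≤ m := by
    refine ⟨min (min (m - c₀ 0) (c₀ 1 - 4 * m)) m / 8, ?_, ?_, ?_, ?_⟩
    · have : 0 < min (min (m - c₀ 0) (c₀ 1 - 4 * m)) m :=
        lt_min (lt_min (by linarith) (by linarith)) htech
      linarith
    · linarith [min_le_left (min (m - c₀ 0) (c₀ 1 - 4 * m)) m,
        min_le_left (m - c₀ 0) (c₀ 1 - 4 * m)]
    · linarith [min_le_left (min (m - c₀ 0) (c₀ 1 - 4 * m)) m,
        min_le_right (m - c₀ 0) (c₀ 1 - 4 * m)]
    · linarith [min_le_right (min (m - c₀ 0) (c₀ 1 - 4 * m)) m]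
  obtain ⟨η₁, hη₁, hpar⟩ := GDNLS.exists_slope_bound hc01 htech hslope hτ
  obtain ⟨α₀, hα₀, η₂, hη₂, L₀, hL₀, C, hC, hest⟩ :=
    GDNLS.exists_locFunctional_estimate (g := τ) (ν₁ := τ) (Bm := c₀ 1 - c₀ 0 + 1) hσ.1.le hφ hω hc
      hτ hτ (by linarith) (by linarith)
  refine ⟨α₀, hα₀, min η₁ η₂, lt_min hη₁ hη₂, max L₀ 1, lt_max_of_lt_left hL₀, 16 * C,
    by positivity, ?_⟩
  intro α L T hα hαα hLL hT u hu x₀ γ₀ hx₀ hu₀ htube ω c x γ ε hε hη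
    Δω Δc μ κ θ₃ θ₄ a xbar J Jp0 Jm0 J0p J0m S
  have hL1 : 1 ≤ L := ((le_max_right _ _).trans_lt hLL).le
  have hL : 0 < L := by linarith
  have hηsplit : ∀ t ∈ Set.Icc 0 T, GDNLS.h1Norm (ε t) < min η₁ η₂ ∧
      (∑ k, (|ω t k - ω₀ k| + |c t k - c₀ k|)) < min η₁ η₂ := fun t ht => by
    have h1 := hη t ht
    have h2 := GDNLS.h1Norm_nonneg (ε t)
    have h3 : 0 ≤ ∑ k, (|ω t k - ω₀ k| + |c t k - c₀ k|) :=
      Finset.sum_nonneg fun k _ => by positivity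
    constructor <;> linarith
  have hz : (0 : ℝ) ∈ Set.Icc 0 T := ⟨le_rfl, hT.le⟩
  obtain ⟨hΔ, hΔle, hq⟩ := hpar (ω 0) (c 0) ((hηsplit 0 hz).2.trans_le (min_le_left _ _))
  change 0 < Δc at hΔ
  change Δc ≤ _ at hΔle
  change |Δω / Δc - m| ≤ τ at hq
  have hq1 := (abs_le.1 hq).1
  have hq2 := (abs_le.1 hq).2
  have hqΔ : Δω / Δc * Δc = Δω := div_mul_cancel₀ _ hΔ.ne'
  have hκ : 0 ≤ GDNLS.decayRate ω₀ c₀ := (GDNLS.decayRate_pos hc).le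
  have hθ : ∀ θ, θ ≤ min (κ 0 / 64) (κ 1 / 64) → θ ≤ GDNLS.decayRate ω₀ c₀ / 64 := fun θ h => by
    have h1 : θ * 64 ≤ κ 0 := (le_div_iff₀ (by norm_num)).1 (h.trans (min_le_left _ _))
    have h2 : θ * 64 ≤ κ 1 := (le_div_iff₀ (by norm_num)).1 (h.trans (min_le_right _ _))
    exact (le_div_iff₀ (by norm_num)).2 (le_min h1 h2)
  have hθ₃ : θ₃ ≤ GDNLS.decayRate ω₀ c₀ / 64 := hθ _ (min_le_left _ _)
  have hθ₄ : θ₄ ≤ GDNLS.decayRate ω₀ c₀ / 64 := hθ _ (min_le_left _ _)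
  have hder := hest α L T hα hαα ((le_max_left _ _).trans_lt hLL) hT u hu x₀ γ₀ hx₀ hu₀ htube ω c x
    γ ε hε (fun t ht => (hη t ht).trans_le (min_le_right _ _))
  have hN : ∀ t ∈ Set.Icc 0 T, GDNLS.h1Norm (ε t) ^ 2 ≤ η₂ ^ 2 := fun t ht =>
    pow_le_pow_left₀ (GDNLS.h1Norm_nonneg _)
      ((hηsplit t ht).1.le.trans (min_le_right _ _)) 2
  have hmono : ∀ A B ν θ : ℝ, 0 ≤ B → B ≤ Δc → 2 * A = B * ν → τ ≤ ν → τ ≤ ν - c₀ 0 →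
      τ ≤ c₀ 1 - ν → θ ≤ GDNLS.decayRate ω₀ c₀ / 64 → ∀ t ∈ Set.Icc 0 T,
      GDNLS.locFunctional φ a xbar u A B ν t - GDNLS.locFunctional φ a xbar u A B ν 0 ≤
        16 * C / L * S t + 16 * C * Real.exp (-θ * L) := by
    intro A B ν θ hB hBΔ hAB hν h0 h1 hθ'
    exact GDNLS.sub_le_of_differential_inequality (n := fun t => GDNLS.h1Norm (ε t)) hC.le hL1 hκ
      hτ.le hθ' hN (hder A B ν τ hB (hBΔ.trans hΔle) hAB hν le_rfl h0 h1)
  refine ⟨fun t ht => ?_, fun t ht => ⟨?_, ?_, ?_, ?_, ?_⟩⟩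
  · have hgap : τ ≤ min (μ - c₀ 0) (c₀ 1 - μ) := le_min (by linarith) (by linarith)
    obtain ⟨J', hJ', hle⟩ := hder (Δω / 2) (Δc / 2) μ _ (by linarith) (by linarith)
      (by linarith) (by linarith) hgap (min_le_left _ _) (min_le_right _ _) t ht
    refine ⟨J', hJ', hle.trans ?_⟩
    have hta : 0 < t + a := by
      have := ht.1
      positivity
    have hθ₃0 : 0 ≤ θ₃ := by
      refine le_min (le_min ?_ ?_) (le_min (by linarith) (by linarith))
      · exact div_nonneg (Real.sqrt_nonneg _) (by norm_num)
      · exact div_nonneg (Real.sqrt_nonneg _) (by norm_num)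
    have hθ₃g : θ₃ ≤ 4 * min (μ - c₀ 0) (c₀ 1 - μ) := by
      rw [mul_min_of_nonneg _ _ (by norm_num : (0 : ℝ) ≤ 4)]
      exact min_le_right _ _
    have hexp := GDNLS.exp_neg_region_le hL.le ht.1 hκ hθ₃0 (hτ.le.trans hgap) hθ₃ hθ₃g
    have hpow : √(t + L ^ 2 / 64) ^ 3 = (t + a) ^ (3 / 2 : ℝ) := GDNLS.sqrt_cube_eq_rpow hta.le
    rw [hpow, ← mul_add]
    refine mul_le_mul ?_ (add_le_add le_rfl hexp) (by positivity) (by positivity)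
    gcongr
    linarith
  · exact hmono (Δω / 2) (Δc / 2) μ _ (by linarith) (by linarith) (by linarith)
      (by linarith) (by linarith) (by linarith) hθ₃ t ht
  · exact hmono Δω (Δc / 2) (4 * (Δω / Δc)) _ (by linarith) (by linarith) (by linarith)
      (by linarith) (by linarith) (by linarith) hθ₄ t ht
  · exact hmono (Δω / 4) (Δc / 2) (Δω / Δc) _ (by linarith) (by linarith) (by linarith)
      (by linarith) (by linarith) (by linarith) hθ₄ t ht
  · exact hmono (Δω / 2) Δc (Δω / Δc) _ (by linarith) (by linarith) (by linarith)
      (by linarith) (by linarith) (by linarith) hθ₄ t ht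
  · exact hmono (Δω / 2) (Δc / 4) (4 * (Δω / Δc)) _ (by linarith) (by linarith) (by linarith)
      (by linarith) (by linarith) (by linarith) hθ₄ t ht
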